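/- Let $\mathbb H$ be a separable complex Hilbert space with inner product $\langle\cdot,\cdot\rangle$ linear in the first argument. Fix a complete orthonormal system (CONS) $\{r_j\}$ of $\mathbb H$, called real, and put $\overline x=\sum_j\overline{\langle x,r_j\rangle}\,r_j$; write $x\otimes y$ for the operator $z\mapsto\langle z,y\rangle x$. Let $\|\cdot\|_{\rm tr}$ be the trace norm, and let $\mathbb X$ be the Hilbert space of Hilbert–Schmidt operators on $\mathbb H$ with the Hilbert–Schmidt norm. Let $X=\{X(t),t\in\mathbb R\}$ be a zero-mean Gaussian process in $\mathbb H$ (all finite-dimensional distributions are Gaussian in the real sense; $X$ need not be real or circularly symmetric) which is stationary: $\mathbb E[X(t+h)\otimes X(t)]=:C(h)$ and $\mathbb E[X(t+h)\otimes\overline{X(t)}]=:\check C(h)$ do not depend on $t$. For $\delta>0$ and $\theta\in\mathbb R$ put $$f(\theta;\delta)=\frac{\delta}{2\pi}\sum_{k\in\mathbb Z}e^{\mathrm i k\delta\theta}C(k\delta),\qquad \check f(\theta;\delta)=\frac{\delta}{2\pi}\sum_{k\in\mathbb Z}e^{-\mathrm i k\delta\theta}\check C(k\delta),$$ $$f(\theta;0)=\frac1{2\pi}\int_{\mathbb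 R}e^{\mathrm i x\theta}C(x)\,dx,\qquad \check f(\theta;0)=\frac1{2\pi}\int_{\mathbb R}e^{-\mathrm i x\theta}\check C(x)\,dx .$$ ($f$ is the spectral density, $\check f$ the pseudo-spectral density.) Let $K:\mathbb R\to[0,\infty)$ have compact support, be symmetric about $0$ and of bounded variation, and write $\|K\|_2^2=\int K^2(x)\,dx$. Let $\delta_n>0$ and $\Delta_n>0$, $n\ge1$, satisfy $\delta_n\to\delta_\infty\in[0,\infty)$ and $n\delta_n/\Delta_n\to\infty$. Fix $\theta\in[-\pi/\delta_\infty,\pi/\delta_\infty]$ (any $\theta\in\mathbb R$ if $\delta_\infty=0$). Assume that $f(\theta;\delta_\infty)$ and $\check f(\theta;\delta_\infty)$ are well defined in trace norm, i.e. $\sum_k(\|C(k\delta_\infty)\|_{\rm tr}+\|\check C(k\delta_\infty)\|_{\rm tr})<\infty$ if $\delta_\infty>0$, and $C,\check C$ are Bochner integrable in trace norm on $\mathbb R$ if $\delta_\infty=0$. Assume that there are $L_n>0$ with $L_n\delta_n\to\infty$ and $L_n/\Delta_n\to0$ such that, for some CONS $\{e_k\}$ of $\mathbb H$, with $C_{k,\ell}(t)=\langle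 C(t)e_k,e_\ell\rangle$ and $\check C_{k,\ell}(t)=\langle\check C(t)\overline{e_k},e_\ell\rangle$: (a) $\sup_n\delta_n\sum_{x\in\mathbb Z}\|C(\delta_nx)\|_{\rm tr}<\infty$ and $\delta_n\sum_{|x|>L_n}\|C(\delta_nx)\|_{\rm tr}\to0$; (b) $\|f(\theta;\delta_n)-f(\theta;\delta_\infty)\|_{\rm tr}\to0$; (c) $\sup_n\delta_n\sum_{x\in\mathbb Z}\|\check C(\delta_nx)\|_{\rm tr}<\infty$ and $\delta_n\sum_{|x|>L_n}\|\check C(\delta_nx)\|_{\rm tr}\to0$; (d) $\|\check f(\theta;\delta_n)-\check f(\theta;\delta_\infty)\|_{\rm tr}\to0$; (e) there are $a_{k,\ell}$ with $\sum_{k,\ell}a_{k,\ell}<\infty$ and $\delta_n^2\sum_{x_1,x_2\in\mathbb Z}|C_{k,k}(\delta_nx_1)|\,|C_{\ell,\ell}(\delta_nx_2)|\le a_{k,\ell}$ for all $n,k,\ell$; (f) there are $b_{k,\ell}$ with $\sum_{k,\ell}b_{k,\ell}<\infty$ and $\delta_n^2\sum_{x_1,x_2\in\mathbb Z}|\check C_{k,\ell}(\delta_nx_1)|\,|\check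 C_{k,\ell}(\delta_nx_2)|\le b_{k,\ell}$ for all $n,k,\ell$. If $\delta_\infty>0$ and $|\theta|=\pi/\delta_\infty$, assume in addition that $\Delta_n(\delta_n-\delta_\infty)\to0$ (which holds trivially for a fixed grid $\delta_n\equiv\delta_\infty$). Let $$\hat f_n(\theta)=\frac{\delta_n}{2\pi n}\sum_{i,j=1}^n e^{\mathrm i(i-j)\delta_n\theta}\,K\!\left(\frac{i-j}{\Delta_n}\,\delta_n\right)X(\delta_ni)\otimes X(\delta_nj),\qquad \mathcal T_n(\theta)=\sqrt{\frac{n\delta_n}{\Delta_n}}\,\bigl[\hat f_n(\theta)-\mathbb E\hat f_n(\theta)\bigr].$$ Then $\mathcal T_n(\theta)$ converges in distribution in $\mathbb X$ to a zero-mean Gaussian element $\mathcal T(\theta)$ of $\mathbb X$ such that, for every finite collection $g_1,\dots,g_m\in\mathbb H$ and positive numbers $a_1,\dots,a_m$, the variable $\sum_\ell a_\ell\langle\mathcal T(\theta)g_\ell,g_\ell\rangle$ is almost surely real and $$\operatorname{Var}\Bigl(\sum_{\ell=1}^m a_\ell\langle\mathcal T(\theta)g_\ell,g_\ell\rangle\Bigr)=\|K\|_2^2\sum_{\ell_1,\ell_2=1}^m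 a_{\ell_1}a_{\ell_2}\Bigl[\bigl|\langle f(\theta;\delta_\infty)g_{\ell_2},g_{\ell_1}\rangle\bigr|^2+c(\theta)\bigl|\langle\check f(\theta;\delta_\infty)\overline{g_{\ell_2}},g_{\ell_1}\rangle\bigr|^2\Bigr],$$ where $c(\theta)$ is the indicator of $\theta=0$ if $\delta_\infty=0$, and of $\theta\in\{0,\pm\pi/\delta_\infty\}$ if $\delta_\infty>0$. -/

import Mathlib

open MeasureTheory ProbabilityTheory Filter Topology
open scoped ENNReal NNReal

noncomputable section

namespace SpectralCLT

/-! ### Hilbert–Schmidt and trace-class operators -/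

theorem enorm_inner_comm {H : Type*} [NormedAddCommGroup H] [InnerProductSpace ℂ H] (x y : H) :
    ‖inner ℂ x y‖ₑ = ‖inner ℂ y x‖ₑ := by
  rw [← ofReal_norm, ← ofReal_norm, norm_inner_symm]

/-- Parseval's identity in `ℝ≥0∞`. -/
theorem tsum_enorm_inner_sq {H ι : Type*} [NormedAddCommGroup H] [InnerProductSpace ℂ H]
    (e : HilbertBasis ι ℂ H) (x : H) :
    ∑' i, ‖inner ℂ (e i) x‖ₑ ^ 2 = ‖x‖ₑ ^ 2 := by
  have h := e.hasSum_inner_mul_inner x x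
  have h2 : HasSum (fun i => ‖inner ℂ (e i) x‖ ^ 2) (‖x‖ ^ 2) := by
    have h3 := Complex.hasSum_re h
    rw [inner_self_eq_norm_sq_to_K] at h3
    convert h3 using 1
    · funext i
      rw [← inner_conj_symm x (e i), ← Complex.normSq_eq_conj_mul_self, Complex.normSq_eq_norm_sq,
        Complex.ofReal_re]
    · norm_cast
  have h4 : ∀ y : ℝ, 0 ≤ y → ENNReal.ofReal (y ^ 2) = ENNReal.ofReal y ^ 2 :=
    fun y hy => ENNReal.ofReal_pow hy 2
  rw [← ofReal_norm, ← h4 _ (norm_nonneg _), ← h2.tsum_eq,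
    ENNReal.ofReal_tsum_of_nonneg (fun _ => by positivity) h2.summable]
  simp only [← ofReal_norm, h4 _ (norm_nonneg _)]

/-- The index set of an auxiliary complete orthonormal system. -/
def auxIndex (H : Type*) [NormedAddCommGroup H] [InnerProductSpace ℂ H] [CompleteSpace H] :
    Set H :=
  (exists_hilbertBasis ℂ H).choose

/-- An auxiliary complete orthonormal system, used to define the Hilbert–Schmidt and trace norms
(which do not depend on it, see `hsSq_eq` and `traceNorm_eq`). -/
def auxBasis (H : Type*) [NormedAddCommGroup H] [InnerProductSpace ℂ H] [CompleteSpace H] :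
    HilbertBasis (auxIndex H) ℂ H :=
  (exists_hilbertBasis ℂ H).choose_spec.choose

section Operators

variable {H : Type*} [NormedAddCommGroup H] [InnerProductSpace ℂ H] [CompleteSpace H]

/-- The squared Hilbert–Schmidt norm `∑ ‖T eᵢ‖²`, possibly infinite. -/
def hsSq (T : H →L[ℂ] H) : ℝ≥0∞ := ∑' i, ‖T (auxBasis H i)‖ₑ ^ 2

theorem tsum_enorm_sq_comm {ι κ : Type*} (e : HilbertBasis ι ℂ H) (f : HilbertBasis κ ℂ H)
    (T : H →L[ℂ] H) :
    ∑' i, ‖T (e i)‖ₑ ^ 2 = ∑' j, ‖(ContinuousLinearMap.adjoint T) (f j)‖ₑ ^ 2 := by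
  simp_rw [← tsum_enorm_inner_sq f (T (e _)),
    ← tsum_enorm_inner_sq e ((ContinuousLinearMap.adjoint T) (f _))]
  rw [ENNReal.tsum_comm]
  refine tsum_congr fun j => tsum_congr fun i => ?_
  rw [ContinuousLinearMap.adjoint_inner_right, enorm_inner_comm]

/-- The Hilbert–Schmidt norm does not depend on the complete orthonormal system. -/
theorem hsSq_eq {ι : Type*} (e : HilbertBasis ι ℂ H) (T : H →L[ℂ] H) :
    hsSq T = ∑' i, ‖T (e i)‖ₑ ^ 2 :=
  (tsum_enorm_sq_comm (auxBasis H) (auxBasis H) T).trans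
    (tsum_enorm_sq_comm e (auxBasis H) T).symm

/-- The trace norm `∑ ⟨(T* T)^{1/2} eᵢ, eᵢ⟩`, possibly infinite. -/
def traceNorm (T : H →L[ℂ] H) : ℝ≥0∞ :=
  ∑' i, ENNReal.ofReal (inner ℂ (auxBasis H i) (CFC.abs T (auxBasis H i))).re

theorem ofReal_re_inner_abs (T : H →L[ℂ] H) (x : H) :
    ENNReal.ofReal (inner ℂ x (CFC.abs T x)).re = ‖CFC.sqrt (CFC.abs T) x‖ₑ ^ 2 := by
  have h0 : (0 : H →L[ℂ] H) ≤ CFC.abs T := CFC.abs_nonneg T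
  have h1 : CFC.sqrt (CFC.abs T) * CFC.sqrt (CFC.abs T) = CFC.abs T :=
    CFC.sqrt_mul_sqrt_self _ h0
  have h2 : IsSelfAdjoint (CFC.sqrt (CFC.abs T)) := (CFC.sqrt_nonneg (CFC.abs T)).isSelfAdjoint
  have h3 : inner ℂ x (CFC.abs T x)
      = inner ℂ (CFC.sqrt (CFC.abs T) x) (CFC.sqrt (CFC.abs T) x) := by
    conv_lhs => rw [← h1]
    rw [mul_apply_eq_comp, ← ContinuousLinearMap.adjoint_inner_left,
      ← ContinuousLinearMap.star_eq_adjoint, h2.star_eq]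
  rw [h3, inner_self_eq_norm_sq_to_K, ← ofReal_norm,
    ← ENNReal.ofReal_pow (norm_nonneg _)]
  norm_cast

/-- The trace norm does not depend on the complete orthonormal system. -/
theorem traceNorm_eq {ι : Type*} (e : HilbertBasis ι ℂ H) (T : H →L[ℂ] H) :
    traceNorm T = ∑' i, ENNReal.ofReal (inner ℂ (e i) (CFC.abs T (e i))).re := by
  simp only [traceNorm, ofReal_re_inner_abs]
  exact hsSq_eq e _

end Operators

/-- The linear space of Hilbert–Schmidt operators. -/
def hsSubmodule (H : Type*) [NormedAddCommGroup H] [InnerProductSpace ℂ H] [CompleteSpace H] :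
    Submodule ℂ (H →L[ℂ] H) where
  carrier := {T | Memℓp (fun i => T (auxBasis H i)) 2}
  add_mem' := fun hS hT => hS.add hT
  zero_mem' := zero_memℓp (E := fun _ : auxIndex H => H)
  smul_mem' := fun c _ hT => hT.const_smul c

theorem mem_hsSubmodule {H : Type*} [NormedAddCommGroup H] [InnerProductSpace ℂ H]
    [CompleteSpace H] (T : H →L[ℂ] H) : T ∈ hsSubmodule H ↔ hsSq T < ∞ := by
  change Memℓp (fun i => T (auxBasis H i)) 2 ↔ _
  rw [memℓp_gen_iff (by norm_num), hsSq]
  have h : ∀ i, ‖T (auxBasis H i)‖ₑ ^ 2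
      = ENNReal.ofReal (‖T (auxBasis H i)‖ ^ (2 : ℝ≥0∞).toReal) := fun i => by
    rw [← ofReal_norm, ← ENNReal.ofReal_pow (norm_nonneg _)]
    norm_num
  simp_rw [h]
  constructor
  · intro hs
    exact hs.tsum_ofReal_lt_top
  · intro hs
    have := ENNReal.summable_toReal hs.ne
    refine this.congr fun i => ?_
    rw [ENNReal.toReal_ofReal (by positivity)]

/-- The space of Hilbert–Schmidt operators on `H`, with the Hilbert–Schmidt inner product
`⟪S, T⟫ = ∑ᵢ ⟪S eᵢ, T eᵢ⟫`; a new type, so that it does not carry the operator norm. -/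
def HSOperator (H : Type*) [NormedAddCommGroup H] [InnerProductSpace ℂ H] [CompleteSpace H] :
    Type _ :=
  ↥(hsSubmodule H)

namespace HSOperator

variable {H : Type*} [NormedAddCommGroup H] [InnerProductSpace ℂ H] [CompleteSpace H]

instance instAddCommGroup : AddCommGroup (HSOperator H) :=
  inferInstanceAs (AddCommGroup ↥(hsSubmodule H))

instance instModule : Module ℂ (HSOperator H) :=
  inferInstanceAs (Module ℂ ↥(hsSubmodule H))

/-- The underlying bounded operator. -/
def toCLM : HSOperator H →ₗ[ℂ] (H →L[ℂ] H) := (hsSubmodule H).subtype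

/-- The sequence `(T eᵢ)ᵢ ∈ ℓ²`. -/
def toL2 : HSOperator H →ₗ[ℂ] lp (fun _ : auxIndex H => H) 2 where
  toFun T := ⟨fun i => toCLM T (auxBasis H i), T.2⟩
  map_add' _ _ := rfl
  map_smul' _ _ := rfl

theorem toL2_apply (T : HSOperator H) (i : auxIndex H) : toL2 T i = toCLM T (auxBasis H i) := rfl

theorem toL2_injective : Function.Injective (toL2 (H := H)) := by
  intro S T h
  apply Subtype.ext
  change toCLM S = toCLM T
  refine ContinuousLinearMap.ext_on
    (Submodule.dense_iff_topologicalClosure_eq_top.2 (auxBasis H).dense_span) ?_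
  rintro _ ⟨i, rfl⟩
  rw [← toL2_apply, ← toL2_apply, h]

instance instNormedAddCommGroup : NormedAddCommGroup (HSOperator H) :=
  NormedAddCommGroup.induced (HSOperator H) (lp (fun _ : auxIndex H => H) 2) toL2 toL2_injective

theorem norm_eq (T : HSOperator H) : ‖T‖ = ‖toL2 T‖ := rfl

instance instInnerProductSpace : InnerProductSpace ℂ (HSOperator H) where
  norm_smul_le c T := by simp only [norm_eq, map_smul]; exact norm_smul_le _ _
  inner S T := inner ℂ (toL2 S) (toL2 T)
  norm_sq_eq_re_inner T := norm_sq_eq_re_inner (𝕜 := ℂ) (toL2 T)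
  conj_inner_symm S T := inner_conj_symm (𝕜 := ℂ) (toL2 S) (toL2 T)
  add_left S T U := by rw [map_add]; exact inner_add_left (𝕜 := ℂ) _ _ _
  smul_left S T c := by rw [map_smul]; exact inner_smul_left (𝕜 := ℂ) _ _ _

/-- The Hilbert–Schmidt norm, in terms of an arbitrary complete orthonormal system. -/
theorem enorm_sq_eq {ι : Type*} (e : HilbertBasis ι ℂ H) (T : HSOperator H) :
    ‖T‖ₑ ^ 2 = ∑' i, ‖toCLM T (e i)‖ₑ ^ 2 := by
  rw [← hsSq_eq e, hsSq, ← ofReal_norm, ← ENNReal.ofReal_pow (norm_nonneg _), norm_eq]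
  have h := lp.hasSum_norm (p := 2) (by norm_num) (toL2 T)
  norm_num at h
  rw [← h.tsum_eq, ENNReal.ofReal_tsum_of_nonneg (fun _ => by positivity) h.summable]
  refine tsum_congr fun i => ?_
  rw [← ofReal_norm, ← ENNReal.ofReal_pow (norm_nonneg _), toL2_apply]

theorem toL2_surjective : Function.Surjective (toL2 (H := H)) := by
  intro f
  have key : ∀ x : H, Summable (fun i => ‖(auxBasis H).repr x i • f i‖) ∧
      ∑' i, ‖(auxBasis H).repr x i • f i‖ ≤ ‖f‖ * ‖x‖ := by
    intro x
    have hx := lp.hasSum_norm (p := 2) (by norm_num) ((auxBasis H).repr x)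
    have hf := lp.hasSum_norm (p := 2) (by norm_num) f
    have h2 : (2 : ℝ≥0∞).toReal = 2 := by norm_num
    rw [h2] at hx hf
    have h := Real.summable_and_inner_le_Lp_mul_Lq_tsum_of_nonneg (Real.HolderConjugate.two_two)
      (fun i => norm_nonneg ((auxBasis H).repr x i)) (fun i => norm_nonneg (f i))
      hx.summable hf.summable
    simp only [norm_smul]
    refine ⟨h.1, h.2.trans_eq ?_⟩
    rw [hx.tsum_eq, hf.tsum_eq, ← Real.rpow_mul (norm_nonneg _), ← Real.rpow_mul (norm_nonneg _)]
    norm_num [mul_comm]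
  let T : H →L[ℂ] H := LinearMap.mkContinuous
    { toFun := fun x => ∑' i, (auxBasis H).repr x i • f i
      map_add' := fun x y => by
        rw [← (key x).1.of_norm.tsum_add (key y).1.of_norm]
        simp [add_smul]
      map_smul' := fun c x => by
        rw [RingHom.id_apply, ← (key x).1.of_norm.tsum_const_smul c]
        simp [mul_smul] } ‖f‖
    (fun x => (norm_tsum_le_tsum_norm (key x).1).trans (key x).2)
  have hT : ∀ i, T (auxBasis H i) = f i := by
    classical
    intro i
    change ∑' j, (auxBasis H).repr (auxBasis H i) j • f j = f i
    rw [tsum_eq_single i]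
    · simp [HilbertBasis.repr_self, lp.single_apply]
    · intro j hj
      simp [HilbertBasis.repr_self, lp.single_apply, hj]
  have hmem : T ∈ hsSubmodule H := by
    change Memℓp (fun i => T (auxBasis H i)) 2
    simp_rw [hT]
    exact lp.memℓp f
  exact ⟨⟨T, hmem⟩, by ext i; exact hT i⟩

/-- `T ↦ (T eᵢ)ᵢ` is an isometric isomorphism onto `ℓ²`. -/
def equivL2 : HSOperator H ≃ₗᵢ[ℂ] lp (fun _ : auxIndex H => H) 2 where
  toLinearEquiv := LinearEquiv.ofBijective toL2 ⟨toL2_injective, toL2_surjective⟩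
  norm_map' _ := rfl

instance instCompleteSpace : CompleteSpace (HSOperator H) :=
  (completeSpace_congr (e := (equivL2 (H := H)).toEquiv)
    (equivL2 (H := H)).isometry.isUniformEmbedding).2 inferInstance

instance instMeasurableSpace : MeasurableSpace (HSOperator H) := borel _

instance instBorelSpace : BorelSpace (HSOperator H) := ⟨rfl⟩

/-- The outer product `x ⊗ y`, that is `z ↦ ⟨z, y⟩ x` (with `⟨·, ·⟩` linear in the first
variable), as a Hilbert–Schmidt operator. -/
def outer (x y : H) : HSOperator H :=
  ⟨InnerProductSpace.rankOne ℂ x y, by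
    rw [mem_hsSubmodule, hsSq]
    have h : ∀ i, ‖InnerProductSpace.rankOne ℂ x y (auxBasis H i)‖ₑ ^ 2
        = ‖inner ℂ (auxBasis H i) y‖ₑ ^ 2 * ‖x‖ₑ ^ 2 := fun i => by
      rw [InnerProductSpace.rankOne_apply, enorm_smul, mul_pow, enorm_inner_comm]
    simp_rw [h, ENNReal.tsum_mul_right, tsum_enorm_inner_sq]
    exact ENNReal.mul_lt_top (by simp) (by simp)⟩

theorem toCLM_outer (x y z : H) : toCLM (outer x y) z = inner ℂ y z • x := rfl

end HSOperator

/-! ### Covariance, pseudo-covariance, spectral densities -/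

/-- Complex conjugation `x ↦ ∑ⱼ conj ⟨x, rⱼ⟩ rⱼ` with respect to the real basis `r`. -/
def conjH {κ H : Type*} [NormedAddCommGroup H] [InnerProductSpace ℂ H]
    (r : HilbertBasis κ ℂ H) (x : H) : H := r.repr.symm (star (r.repr x))

theorem hasSum_conjH {κ H : Type*} [NormedAddCommGroup H] [InnerProductSpace ℂ H]
    (r : HilbertBasis κ ℂ H) (x : H) :
    HasSum (fun j => (starRingEnd ℂ) (inner ℂ (r j) x) • r j) (conjH r x) := by
  have h := r.hasSum_repr_symm (star (r.repr x))
  simpa [conjH, HilbertBasis.repr_apply_apply] using h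

section Spectral

variable {H : Type*} [NormedAddCommGroup H] [InnerProductSpace ℂ H] [CompleteSpace H]
variable {Ω : Type*} [MeasurableSpace Ω]

/-- The covariance operator `E[X(t) ⊗ X(s)]`. -/
def cov (P : Measure Ω) (X : ℝ → Ω → H) (t s : ℝ) : H →L[ℂ] H :=
  ∫ ω, InnerProductSpace.rankOne ℂ (X t ω) (X s ω) ∂P

/-- The pseudo-covariance operator `E[X(t) ⊗ conj X(s)]`. -/
def pcov {κ : Type*} (r : HilbertBasis κ ℂ H) (P : Measure Ω) (X : ℝ → Ω → H) (t s : ℝ) :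
    H →L[ℂ] H :=
  ∫ ω, InnerProductSpace.rankOne ℂ (X t ω) (conjH r (X s ω)) ∂P

/-- The covariance and the pseudo-covariance depend only on the lag. -/
structure IsStationary {κ : Type*} (r : HilbertBasis κ ℂ H) (P : Measure Ω) (X : ℝ → Ω → H) :
    Prop where
  cov_eq : ∀ t s h : ℝ, cov P X (t + h) (s + h) = cov P X t s
  pcov_eq : ∀ t s h : ℝ, pcov r P X (t + h) (s + h) = pcov r P X t s

/-- The stationary covariance operator `C(h)`. -/
def statCov (P : Measure Ω) (X : ℝ → Ω → H) (h : ℝ) : H →L[ℂ] H := cov P X h 0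

/-- The stationary pseudo-covariance operator `Č(h)`. -/
def statPCov {κ : Type*} (r : HilbertBasis κ ℂ H) (P : Measure Ω) (X : ℝ → Ω → H) (h : ℝ) :
    H →L[ℂ] H := pcov r P X h 0

open Classical in
/-- The Fourier transform with mesh `δ` of an operator function `C`, at frequency `θ`:
`(1 / 2π) ∫ e^{i x θ} C(x) dx` if `δ = 0` and `(δ / 2π) ∑ₖ e^{i k δ θ} C(k δ)` if `δ ≠ 0`. -/
def foldedTransform (C : ℝ → H →L[ℂ] H) (θ δ : ℝ) : H →L[ℂ] H :=
  if δ = 0 then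
    ((1 / (2 * Real.pi) : ℝ) : ℂ) • ∫ x : ℝ, Complex.exp (Complex.I * x * θ) • C x
  else
    ((δ / (2 * Real.pi) : ℝ) : ℂ) •
      ∑' k : ℤ, Complex.exp (Complex.I * k * δ * θ) • C (k * δ)

open Classical in
/-- The trace-norm condition under which the Fourier transform with mesh `δ` is well defined as a
trace-class operator: Bochner integrability if `δ = 0`, summability if `δ ≠ 0`. -/
def TransformDefined (C : ℝ → H →L[ℂ] H) (δ : ℝ) : Prop :=
  if δ = 0 then AEStronglyMeasurable C volume ∧ ∫⁻ x : ℝ, traceNorm (C x) < ∞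
  else ∑' k : ℤ, traceNorm (C (k * δ)) < ∞

/-- The folded spectral density `f(θ; δ)`; `f(θ; 0) = f(θ)`. -/
def specDensity (P : Measure Ω) (X : ℝ → Ω → H) (θ δ : ℝ) : H →L[ℂ] H :=
  foldedTransform (statCov P X) θ δ

/-- The folded pseudo-spectral density `f̌(θ; δ)`, with the opposite sign in the exponential;
`f̌(θ; 0) = f̌(θ)`. -/
def pseudoSpecDensity {κ : Type*} (r : HilbertBasis κ ℂ H) (P : Measure Ω) (X : ℝ → Ω → H)
    (θ δ : ℝ) : H →L[ℂ] H :=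
  foldedTransform (statPCov r P X) (-θ) δ

/-- `C_{k,ℓ}(t) = ⟨C(t) e_k, e_ℓ⟩`. -/
def covCoef {ι : Type*} (e : HilbertBasis ι ℂ H) (P : Measure Ω) (X : ℝ → Ω → H) (k l : ι)
    (t : ℝ) : ℂ :=
  inner ℂ (e l) (statCov P X t (e k))

/-- `Č_{k,ℓ}(t) = ⟨Č(t) conj(e_k), e_ℓ⟩`. -/
def pcovCoef {κ ι : Type*} (r : HilbertBasis κ ℂ H) (e : HilbertBasis ι ℂ H) (P : Measure Ω)
    (X : ℝ → Ω → H) (k l : ι) (t : ℝ) : ℂ :=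
  inner ℂ (e l) (statPCov r P X t (conjH r (e k)))

/-! ### The estimator and the assumptions -/

/-- The lag-window estimator based on `X(δ), X(2δ), …, X(nδ)` with kernel `K` and bandwidth
`Δ`. -/
def estimator (X : ℝ → Ω → H) (K : ℝ → ℝ) (n : ℕ) (δ Δ θ : ℝ) (ω : Ω) : HSOperator H :=
  ((δ / (2 * Real.pi * n) : ℝ) : ℂ) • ∑ i ∈ Finset.Icc 1 n, ∑ j ∈ Finset.Icc 1 n,
    (Complex.exp (Complex.I * ((i : ℂ) - (j : ℂ)) * δ * θ) *
      (K (((i : ℝ) - (j : ℝ)) / Δ * δ) : ℂ)) •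
      HSOperator.outer (X (δ * i) ω) (X (δ * j) ω)

/-- `𝒯_n(θ) = √(n δ / Δ) (f̂_n(θ) - E f̂_n(θ))`. -/
def normalizedError (P : Measure Ω) (X : ℝ → Ω → H) (K : ℝ → ℝ) (n : ℕ) (δ Δ θ : ℝ) (ω : Ω) :
    HSOperator H :=
  ((√(n * δ / Δ) : ℝ) : ℂ) •
    (estimator X K n δ Δ θ ω - ∫ ω', estimator X K n δ Δ θ ω' ∂P)

/-- The conditions on the kernel. -/
structure KernelCondition (K : ℝ → ℝ) : Prop where
  nonneg : ∀ x, 0 ≤ K x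
  hasCompactSupport : HasCompactSupport K
  symm : ∀ x, K (-x) = K x
  boundedVariation : BoundedVariationOn K Set.univ

/-- The conditions on the mesh `δ n`, the bandwidth `Δ n` and the second-order structure of the
process at frequency `θ`. -/
structure CLTCondition {κ ι : Type*} (r : HilbertBasis κ ℂ H) (e : HilbertBasis ι ℂ H)
    (P : Measure Ω) (X : ℝ → Ω → H) (δ Δ : ℕ → ℝ) (δlim θ : ℝ) : Prop where
  mesh_pos : ∀ n ≥ 1, 0 < δ n
  bandwidth_pos : ∀ n ≥ 1, 0 < Δ n
  mesh_tendsto : Tendsto δ atTop (𝓝 δlim)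
  ratio_tendsto : Tendsto (fun n : ℕ => n * δ n / Δ n) atTop atTop
  cov_summable : ∃ M : ℝ≥0, ∀ n ≥ 1,
    ENNReal.ofReal (δ n) * ∑' x : ℤ, traceNorm (statCov P X (δ n * x)) ≤ M
  pcov_summable : ∃ M : ℝ≥0, ∀ n ≥ 1,
    ENNReal.ofReal (δ n) * ∑' x : ℤ, traceNorm (statPCov r P X (δ n * x)) ≤ M
  tails : ∃ L : ℕ → ℝ, (∀ n ≥ 1, 0 < L n) ∧
    Tendsto (fun n => L n * δ n) atTop atTop ∧
    Tendsto (fun n => L n / Δ n) atTop (𝓝 0) ∧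
    Tendsto (fun n => ENNReal.ofReal (δ n) *
      ∑' x : {x : ℤ // L n < |(x : ℝ)|}, traceNorm (statCov P X (δ n * (x : ℤ)))) atTop (𝓝 0) ∧
    Tendsto (fun n => ENNReal.ofReal (δ n) *
      ∑' x : {x : ℤ // L n < |(x : ℝ)|}, traceNorm (statPCov r P X (δ n * (x : ℤ)))) atTop (𝓝 0)
  /- the limits in the next two conditions are well defined -/
  spec_defined : TransformDefined (statCov P X) δlim
  pspec_defined : TransformDefined (statPCov r P X) δlim
  spec_tendsto : Tendsto (fun n => traceNorm (specDensity P X θ (δ n) - specDensity P X θ δlim))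
    atTop (𝓝 0)
  pspec_tendsto : Tendsto (fun n => traceNorm
    (pseudoSpecDensity r P X θ (δ n) - pseudoSpecDensity r P X θ δlim)) atTop (𝓝 0)
  cov_coef : ∃ a : ι → ι → ℝ≥0, Summable (fun p : ι × ι => a p.1 p.2) ∧
    ∀ n ≥ 1, ∀ k l, ENNReal.ofReal (δ n ^ 2) * ∑' x₁ : ℤ, ∑' x₂ : ℤ,
      ‖covCoef e P X k k (δ n * x₁)‖ₑ * ‖covCoef e P X l l (δ n * x₂)‖ₑ ≤ a k l
  pcov_coef : ∃ b : ι → ι → ℝ≥0, Summable (fun p : ι × ι => b p.1 p.2) ∧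
    ∀ n ≥ 1, ∀ k l, ENNReal.ofReal (δ n ^ 2) * ∑' x₁ : ℤ, ∑' x₂ : ℤ,
      ‖pcovCoef r e P X k l (δ n * x₁)‖ₑ * ‖pcovCoef r e P X k l (δ n * x₂)‖ₑ ≤ b k l

end Spectral

open Classical in
/-- The indicator `c(θ)`: of `θ = 0` if `δ = 0`, and of `θ ∈ {0, π/δ, -π/δ}` if `δ > 0`. -/
def cInd (θ δ : ℝ) : ℝ :=
  if θ = 0 ∨ (0 < δ ∧ (θ = Real.pi / δ ∨ θ = -(Real.pi / δ))) then 1 else 0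

end SpectralCLT

end

namespace SpectralCLT

/-! ### Hilbert bases and separability -/

/-! Weak convergence in the separable Hilbert space of Hilbert–Schmidt operators is obtained from
tightness together with convergence of characteristic functions along a dense set of real
functionals (`exists_gaussian_limit`).

Tightness. In the basis `e_l ⊗ e_k` the second moments of the coordinates of `𝒯_n` are computed by
the formula of Isserlis and bounded, uniformly in `n`, by a summable family; this is where the
dominations `a` and `b` of conditions (e) and (f) enter (`exists_coordinate_bound`,
`isTightMeasureSet_of_coordinates`).

Functionals. Since `K` is even, `𝒯_n` is self-adjoint, so by polarization `Re ⟪A, 𝒯_n⟫` is, for a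
dense set of `A`, a functional `∑ a_l ⟨𝒯_n g_l, g_l⟩` with real weights (`dense_quadSet`). Such a
functional is a centred quadratic form in a real Gaussian vector, hence has the law of `∑ λ (ξ² -
1)` with independent standard Gaussian `ξ`. The weights satisfy `|λ| ≤ αβ`, where `α` bounds the row
sums of the covariance matrix and `β` those of the form. Here `α` is of order `1/δ_n` and `αβ` of
order `(nδ_n/Δ_n)^{-1/2}`, so no single term matters and the limit is Gaussian once the variance
converges (`tendsto_charFun_quadraticForm`).

Variance. After centring, Isserlis leaves two pairings, that is two quadruple sums over `i, j, i',
j'` with weight `k(i-j) k(i'-j')`: one with covariances, one with pseudo-covariances, the latter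
with an extra phase `z_n^{i-j}`, `z_n = e^{2iδ_nθ}`. Covariances live on lags up to `L_n`,
negligible against the window width `Δ_n/δ_n`, so bounded variation of `K` permits replacing
`k(i'-j')` by `k(i-j)`. The sum then factors into `(δ_n/Δ_n) ∑_d K(dδ_n/Δ_n)² z^d` and two Fourier
sums that converge to (pseudo-)spectral densities (`IsWindow.tendsto_scaled_quadSum`).

The indicator `c(θ)`. For `z = 1` the window factor is a Riemann sum of `K²`. For `z = z_n` it has
the same limit when the phase of `z_n`, modulo `2π`, is `o(δ_n/Δ_n)`, and tends to zero by summation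
by parts when `|1 - z_n|` dominates `δ_n/Δ_n`. The condition `Δ_n(δ_n - δ_∞) → 0` puts the edge
frequencies in the first case (`IsWindow.tendsto_sq_tsum_cInd`). -/

theorem countable_of_orthonormal {ι E : Type*} [NormedAddCommGroup E] [InnerProductSpace ℂ E]
    [TopologicalSpace.SeparableSpace E] {v : ι → E} (hv : Orthonormal ℂ v) : Countable ι := by
  have hd : ∀ i j, i ≠ j → 1 < dist (v i) (v j) := fun i j hij => by
    have h := norm_sub_sq (𝕜 := ℂ) (v i) (v j)
    rw [hv.1 i, hv.1 j, hv.2 hij] at h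
    norm_num at h
    rw [dist_eq_norm]
    nlinarith [norm_nonneg (v i - v j)]
  have hdisj : Set.univ.PairwiseDisjoint (fun i => Metric.ball (v i) (1 / 2)) := by
    intro i _ j _ hij
    refine Metric.ball_disjoint_ball ?_
    linarith [hd i j hij]
  exact Set.countable_univ_iff.1 (hdisj.countable_of_isOpen (fun i _ => Metric.isOpen_ball)
    (fun i _ => ⟨v i, Metric.mem_ball_self (by norm_num)⟩))

theorem separableSpace_of_hilbertBasis {ι E : Type*} [NormedAddCommGroup E]
    [InnerProductSpace ℂ E] [Countable ι] (b : HilbertBasis ι ℂ E) :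
    TopologicalSpace.SeparableSpace E := by
  have h := ((Set.countable_range b).isSeparable.span (R := ℂ)).closure
  have h2 : closure (Submodule.span ℂ (Set.range b) : Set E) = Set.univ := by
    rw [← Submodule.topologicalClosure_coe, b.dense_span]; rfl
  rw [h2] at h
  exact TopologicalSpace.isSeparable_univ_iff.1 h

/-! ### The operator norm and the trace norm -/

section Operators

variable {H : Type*} [NormedAddCommGroup H] [InnerProductSpace ℂ H] [CompleteSpace H]

theorem hsSq_adjoint (T : H →L[ℂ] H) : hsSq (ContinuousLinearMap.adjoint T) = hsSq T := by
  rw [hsSq, hsSq, tsum_enorm_sq_comm (auxBasis H) (auxBasis H) T]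

/-- Parseval for `T x` and Cauchy–Schwarz for `⟨T* eᵢ, x⟩`; the Hilbert–Schmidt norm of `T*` is that
of `T`. -/
theorem enorm_apply_sq_le_hsSq (T : H →L[ℂ] H) (x : H) : ‖T x‖ₑ ^ 2 ≤ hsSq T * ‖x‖ₑ ^ 2 := by
  rw [← hsSq_adjoint, hsSq, ← ENNReal.tsum_mul_right, ← tsum_enorm_inner_sq (auxBasis H) (T x)]
  refine ENNReal.tsum_le_tsum fun i => ?_
  rw [← ContinuousLinearMap.adjoint_inner_left, ← mul_pow]
  gcongr
  rw [← ofReal_norm, ← ofReal_norm, ← ofReal_norm, ← ENNReal.ofReal_mul (norm_nonneg _)]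
  exact ENNReal.ofReal_le_ofReal (norm_inner_le_norm _ _)

theorem traceNorm_eq_hsSq_sqrt (T : H →L[ℂ] H) : traceNorm T = hsSq (CFC.sqrt (CFC.abs T)) := by
  simp only [traceNorm, hsSq, ofReal_re_inner_abs]

/-- The operator norm is bounded by the trace norm. -/
theorem enorm_le_traceNorm (T : H →L[ℂ] H) : ‖T‖ₑ ≤ traceNorm T := by
  set S := CFC.sqrt (CFC.abs T) with hS
  have h2 : IsSelfAdjoint S := (CFC.sqrt_nonneg (CFC.abs T)).isSelfAdjoint
  have h1 : S * S = CFC.abs T := CFC.sqrt_mul_sqrt_self _ (CFC.abs_nonneg T)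
  -- With `S = |T|^{1/2}`, the C*-identity gives `‖T‖ = ‖|T|‖ = ‖S‖²`, and `‖S‖²` is at most the
  -- squared Hilbert–Schmidt norm of `S`, which is the trace norm of `T`.
  have h3 : ‖T‖ = ‖S‖ * ‖S‖ := by
    rw [← CFC.norm_abs (a := T), ← h1, ← CStarRing.norm_star_mul_self, h2.star_eq]
  rcases eq_or_ne (traceNorm T) ∞ with ht | ht
  · rw [ht]; exact le_top
  have h4 : ‖S‖ ≤ √(traceNorm T).toReal := by
    refine ContinuousLinearMap.opNorm_le_bound _ (by positivity) fun x => ?_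
    have h5 := enorm_apply_sq_le_hsSq S x
    rw [← traceNorm_eq_hsSq_sqrt] at h5
    have h6 := ENNReal.toReal_mono (ENNReal.mul_ne_top ht (by simp)) h5
    simp only [ENNReal.toReal_mul, ENNReal.toReal_pow, toReal_enorm] at h6
    rw [← Real.sqrt_sq (norm_nonneg x), ← Real.sqrt_mul (by positivity)]
    exact Real.le_sqrt_of_sq_le h6
  rw [← ofReal_norm, ← ENNReal.ofReal_toReal ht, h3]
  refine ENNReal.ofReal_le_ofReal ?_
  calc ‖S‖ * ‖S‖ ≤ √(traceNorm T).toReal * √(traceNorm T).toReal := by gcongr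
    _ = _ := Real.mul_self_sqrt (by positivity)

/-- The bridge from the trace-norm hypotheses to scalar sequences: afterwards only matrix entries
are estimated. -/
theorem enorm_inner_apply_le_traceNorm (T : H →L[ℂ] H) (x y : H) :
    ‖inner ℂ x (T y)‖ₑ ≤ traceNorm T * (‖x‖ₑ * ‖y‖ₑ) := by
  have h : ‖inner ℂ x (T y)‖ ≤ ‖T‖ * (‖x‖ * ‖y‖) := by
    calc _ ≤ ‖x‖ * ‖T y‖ := norm_inner_le_norm _ _
      _ ≤ ‖x‖ * (‖T‖ * ‖y‖) := by gcongr; exact T.le_opNorm y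
      _ = _ := by ring
  calc ‖inner ℂ x (T y)‖ₑ ≤ ‖T‖ₑ * (‖x‖ₑ * ‖y‖ₑ) := by
        simp only [← ofReal_norm]
        rw [← ENNReal.ofReal_mul (norm_nonneg _), ← ENNReal.ofReal_mul (norm_nonneg _)]
        exact ENNReal.ofReal_le_ofReal h
    _ ≤ _ := by gcongr; exact enorm_le_traceNorm T

end Operators

/-! ### The space of Hilbert–Schmidt operators -/

namespace HSOperator

variable {H : Type*} [NormedAddCommGroup H] [InnerProductSpace ℂ H] [CompleteSpace H]

theorem inner_eq_tsum (S T : HSOperator H) :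
    inner ℂ S T = ∑' i, inner ℂ (toCLM S (auxBasis H i)) (toCLM T (auxBasis H i)) := rfl

/-- Makes every matrix entry `⟨x, T y⟩` a continuous linear functional of `T`. It also serves to
prove identities between outer products, by testing against all `T`. -/
theorem inner_outer (x y : H) (T : HSOperator H) :
    inner ℂ (outer x y) T = inner ℂ x (toCLM T y) := by
  rw [inner_eq_tsum, ← ContinuousLinearMap.adjoint_inner_left,
    ← (auxBasis H).tsum_inner_mul_inner]
  refine tsum_congr fun i => ?_
  rw [toCLM_outer, inner_smul_left, inner_conj_symm, ContinuousLinearMap.adjoint_inner_left,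
    mul_comm]

theorem outer_add_left (x x' y : H) : outer (x + x') y = outer x y + outer x' y := by
  refine ext_inner_right ℂ fun T => ?_
  simp [inner_outer, inner_add_left]

theorem outer_add_right (x y y' : H) : outer x (y + y') = outer x y + outer x y' := by
  refine ext_inner_right ℂ fun T => ?_
  simp [inner_outer, inner_add_left]

theorem outer_smul_left (c : ℂ) (x y : H) : outer (c • x) y = c • outer x y := by
  refine ext_inner_right ℂ fun T => ?_
  simp [inner_outer, inner_smul_left, mul_comm]

theorem norm_outer (x y : H) : ‖outer x y‖ = ‖x‖ * ‖y‖ := by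
  have h := norm_sq_eq_re_inner (𝕜 := ℂ) (outer x y)
  rw [inner_outer, toCLM_outer, inner_smul_right, inner_self_eq_norm_sq_to_K,
    inner_self_eq_norm_sq_to_K] at h
  have h2 : ‖outer x y‖ ^ 2 = (‖x‖ * ‖y‖) ^ 2 := by
    rw [h]; norm_cast; ring
  exact (pow_left_inj₀ (norm_nonneg _) (by positivity) two_ne_zero).1 h2

theorem continuous_outer : Continuous (fun p : H × H => outer p.1 p.2) := by
  -- The scalars are real because `outer` is conjugate-linear in its second argument; real
  -- bilinearity and `norm_outer` suffice for continuity.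
  let B : H →ₗ[ℝ] H →ₗ[ℝ] HSOperator H := LinearMap.mk₂ ℝ outer outer_add_left
    (fun c x y => by
      have := outer_smul_left (c : ℂ) x y
      simpa using this)
    outer_add_right
    (fun c x y => by
      refine ext_inner_right ℂ fun T => ?_
      have h2 : c • outer x y = (c : ℂ) • outer x y := by simp
      have h3 : c • y = (c : ℂ) • y := by simp
      rw [h2, h3, inner_outer, inner_smul_left, inner_outer, map_smul, inner_smul_right,
        Complex.conj_ofReal])
  exact (LinearMap.mkContinuous₂ B 1 fun x y => by
    simpa [B] using (norm_outer x y).le).continuous₂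

theorem orthonormal_outer {ι : Type*} (e : HilbertBasis ι ℂ H) :
    Orthonormal ℂ (fun p : ι × ι => outer (e p.2) (e p.1)) := by
  classical
  rw [orthonormal_iff_ite]
  rintro ⟨k, l⟩ ⟨k', l'⟩
  rw [inner_outer, toCLM_outer, inner_smul_right]
  have h := orthonormal_iff_ite.1 e.orthonormal
  rw [h, h]
  by_cases h1 : k = k' <;> by_cases h2 : l = l' <;> simp [h1, h2, eq_comm]

/-- The Hilbert basis `e_l ⊗ e_k` of the space of Hilbert–Schmidt operators. -/
noncomputable def outerBasis {ι : Type*} (e : HilbertBasis ι ℂ H) :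
    HilbertBasis (ι × ι) ℂ (HSOperator H) :=
  HilbertBasis.mkOfOrthogonalEqBot (orthonormal_outer e) (by
    rw [Submodule.eq_bot_iff]
    intro T hT
    have h0 : ∀ k l, inner ℂ (e l) (toCLM T (e k)) = 0 := fun k l => by
      rw [← inner_outer]
      exact (Submodule.mem_orthogonal _ _).1 hT _ (Submodule.subset_span ⟨(k, l), rfl⟩)
    have h1 : ∀ k, toCLM T (e k) = 0 := fun k => by
      refine e.repr.injective ?_
      ext l
      rw [e.repr_apply_apply, h0]
      simp
    have h2 : ‖T‖ₑ ^ 2 = 0 := by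
      rw [enorm_sq_eq e]
      simp [h1]
    simpa using h2)

theorem outerBasis_apply {ι : Type*} (e : HilbertBasis ι ℂ H) (p : ι × ι) :
    outerBasis e p = outer (e p.2) (e p.1) := by
  rw [outerBasis, HilbertBasis.coe_mkOfOrthogonalEqBot]

instance instSeparableSpace [TopologicalSpace.SeparableSpace H] :
    TopologicalSpace.SeparableSpace (HSOperator H) := by
  have := countable_of_orthonormal (auxBasis H).orthonormal
  exact separableSpace_of_hilbertBasis (outerBasis (auxBasis H))

instance instSecondCountableTopology [TopologicalSpace.SeparableSpace H] :
    SecondCountableTopology (HSOperator H) :=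
  UniformSpace.secondCountable_of_separable _

end HSOperator

/-! ### The conjugation -/

section Conj

variable {κ H : Type*} [NormedAddCommGroup H] [InnerProductSpace ℂ H] (r : HilbertBasis κ ℂ H)

theorem inner_conjH_conjH (x y : H) : inner ℂ (conjH r x) (conjH r y) = inner ℂ y x := by
  have h : ∀ z, r.repr (conjH r z) = star (r.repr z) := fun z => by
    rw [conjH, LinearIsometryEquiv.apply_symm_apply]
  rw [← r.repr.inner_map_map, ← r.repr.inner_map_map y x, h, h, lp.inner_eq_tsum,
    lp.inner_eq_tsum]
  refine tsum_congr fun i => ?_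
  simp [mul_comm]

theorem norm_conjH (x : H) : ‖conjH r x‖ = ‖x‖ := by
  rw [conjH, LinearIsometryEquiv.norm_map, norm_star, LinearIsometryEquiv.norm_map]

theorem conjH_sub (x y : H) : conjH r (x - y) = conjH r x - conjH r y := by
  simp [conjH, map_sub, star_sub]

theorem continuous_conjH : Continuous (conjH r) :=
  (Isometry.of_dist_eq fun x y => by
    rw [dist_eq_norm, dist_eq_norm, ← conjH_sub, norm_conjH]).continuous

end Conj

end SpectralCLT

namespace SpectralCLT

/-! ### Tightness in a Hilbert space -/

theorem tsum_subtype_notMem {ι : Type*} (F : Finset ι) (f : ι → ℝ≥0∞) :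
    ∑' i : {i // i ∉ F}, f i = ∑' i, Set.indicator {i | i ∉ F} f i :=
  tsum_subtype {i | i ∉ F} f

section Tight

variable {ι E : Type*} [NormedAddCommGroup E] [InnerProductSpace ℂ E] (b : HilbertBasis ι ℂ E)

theorem enorm_sub_sum_sq (F : Finset ι) (x : E) :
    ‖x - ∑ i ∈ F, inner ℂ (b i) x • b i‖ₑ ^ 2
      = ∑' i : {i // i ∉ F}, ‖inner ℂ (b i) x‖ₑ ^ 2 := by
  classical
  rw [← tsum_enorm_inner_sq b]
  rw [tsum_subtype_notMem F fun i => ‖inner ℂ (b i) x‖ₑ ^ 2]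
  refine tsum_congr fun j => ?_
  have h := orthonormal_iff_ite.1 b.orthonormal
  have h2 : inner ℂ (b j) (x - ∑ i ∈ F, inner ℂ (b i) x • b i)
      = if j ∈ F then 0 else inner ℂ (b j) x := by
    rw [inner_sub_right, inner_sum]
    simp_rw [inner_smul_right, h]
    by_cases hj : j ∈ F <;> simp [hj]
  rw [h2]
  by_cases hj : j ∈ F <;> simp [hj]

/-- Up to a uniformly small error each point of `K` is a partial sum over a finite index set with
coefficients of modulus at most `ρ`. These sums lie in the continuous image of a compact polydisc.
-/
theorem totallyBounded_of_coordinates {K : Set E} {ρ : ℝ} (hρ : ∀ x ∈ K, ‖x‖ ≤ ρ)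
    (h : ∀ ε : ℝ≥0∞, 0 < ε → ∃ F : Finset ι, ∀ x ∈ K,
      ∑' i : {i // i ∉ F}, ‖inner ℂ (b i) x‖ₑ ^ 2 ≤ ε) :
    TotallyBounded K := by
  rw [Metric.totallyBounded_iff]
  intro ε hε
  obtain ⟨F, hF⟩ := h (ENNReal.ofReal ((ε / 2 / 2) ^ 2)) (by positivity)
  let C : Set E := (fun c : F → ℂ => ∑ i : F, c i • b i) ''
    (Set.univ.pi fun _ => Metric.closedBall 0 ρ)
  have hC : IsCompact C :=
    (isCompact_univ_pi fun _ => isCompact_closedBall (0 : ℂ) ρ).image (by fun_prop)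
  obtain ⟨t, ht, htC⟩ := Metric.totallyBounded_iff.1 hC.totallyBounded (ε / 2) (half_pos hε)
  refine ⟨t, ht, fun x hx => ?_⟩
  have hy : ∑ i ∈ F, inner ℂ (b i) x • b i ∈ C := by
    refine ⟨fun i => inner ℂ (b i) x, fun i _ => ?_, ?_⟩
    · rw [mem_closedBall_zero_iff]
      refine (norm_inner_le_norm _ _).trans ?_
      rw [b.orthonormal.1, one_mul]
      exact hρ x hx
    · exact Finset.sum_coe_sort F (fun i => inner ℂ (b i) x • b i)
  obtain ⟨z, hz, hyz⟩ := Set.mem_iUnion₂.1 (htC hy)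
  refine Set.mem_iUnion₂.2 ⟨z, hz, ?_⟩
  have h1 := hF x hx
  rw [← enorm_sub_sum_sq, ENNReal.ofReal_pow (by positivity)] at h1
  have h2 := (ENNReal.pow_le_pow_left_iff two_ne_zero).1 h1
  rw [← ofReal_norm, ENNReal.ofReal_le_ofReal_iff (by positivity), ← dist_eq_norm] at h2
  rw [Metric.mem_ball] at hyz ⊢
  linarith [dist_triangle x (∑ i ∈ F, inner ℂ (b i) x • b i) z]

/-- A family of laws whose coordinates have second moments dominated by a summable sequence is
tight. -/
theorem isTightMeasureSet_of_coordinates [CompleteSpace E] [MeasurableSpace E] [BorelSpace E]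
    [Countable ι] {S : Set (Measure E)} {s : ι → ℝ≥0∞} (hs : ∑' i, s i ≠ ∞)
    (h : ∀ μ ∈ S, ∀ i, ∫⁻ x, ‖inner ℂ (b i) x‖ₑ ^ 2 ∂μ ≤ s i) : IsTightMeasureSet S := by
  rw [isTightMeasureSet_iff_exists_isCompact_measure_compl_le]
  intro ε hε
  have hmeas : ∀ i, Measurable fun x : E => ‖inner ℂ (b i) x‖ₑ ^ 2 := fun i =>
    ((continuous_const.inner continuous_id).enorm.measurable.pow_const 2)
  have hint : ∀ μ ∈ S, ∀ F : Finset ι, ∫⁻ x, ∑' i : {i // i ∉ F}, ‖inner ℂ (b i) x‖ₑ ^ 2 ∂μ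
      ≤ ∑' i : {i // i ∉ F}, s i := fun μ hμ F => by
    rw [lintegral_tsum fun i : {i // i ∉ F} => (hmeas i).aemeasurable]
    exact ENNReal.tsum_le_tsum fun i => h μ hμ i
  have hε2 : ε / 2 ≠ 0 := (ENNReal.half_pos hε.ne').ne'
  -- Levels `η m → 0` and probabilities `d m` with sum below `ε / 2`. The finite set `F m` makes the
  -- expected squared tail at most `η m * d m`, so by Markov the tail exceeds `η m` with probability
  -- at most `d m`.
  obtain ⟨d, hd, hdsum⟩ := ENNReal.exists_pos_sum_of_countable' hε2 ℕ
  let η : ℕ → ℝ≥0∞ := fun m => (m + 1 : ℝ≥0∞)⁻¹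
  have hη : ∀ m, 0 < η m := fun m => ENNReal.inv_pos.2 (by finiteness)
  have hη' : ∀ m, η m ≠ ∞ := fun m => by simp [η]
  have hF : ∀ m, ∃ F : Finset ι, ∑' i : {i // i ∉ F}, s i ≤ η m * d m := fun m => by
    have hpos : 0 < η m * d m := ENNReal.mul_pos (hη m).ne' (hd m).ne'
    exact ((ENNReal.tendsto_tsum_compl_atTop_zero hs).eventually_le_const hpos).exists
  choose F hF using hF
  -- Markov for the squared norm, whose expectation is at most `∑ s`; the summand `1` in the witness
  -- only makes `R` positive.
  obtain ⟨R, hR0, hR⟩ : ∃ R : ℝ≥0, 0 < R ∧ (∑' i, s i) / R ≤ ε / 2 := by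
    rcases eq_or_ne ε ∞ with rfl | hε'
    · exact ⟨1, one_pos, by simp [ENNReal.top_div]⟩
    have hne : (∑' i, s i) / (ε / 2) ≠ ∞ := ENNReal.div_ne_top hs hε2
    refine ⟨((∑' i, s i) / (ε / 2)).toNNReal + 1, by positivity, ?_⟩
    refine ENNReal.div_le_of_le_mul' ?_
    rw [ENNReal.coe_add, ENNReal.coe_toNNReal hne, add_mul]
    rw [ENNReal.div_mul_cancel hε2 (by finiteness)]
    exact le_self_add
  let K : Set E := {x | ‖x‖ₑ ^ 2 ≤ R ∧ ∀ m, ∑' i : {i // i ∉ F m}, ‖inner ℂ (b i) x‖ₑ ^ 2 ≤ η m}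
  have hK : TotallyBounded K := by
    refine totallyBounded_of_coordinates b (ρ := √R) ?_ ?_
    · intro x hx
      refine Real.le_sqrt_of_sq_le ?_
      have := ENNReal.toReal_mono (by finiteness) hx.1
      simpa using this
    · intro ε' hε'
      obtain ⟨m, hm⟩ : ∃ m : ℕ, η m ≤ ε' := by
        obtain ⟨m, hm⟩ := ENNReal.exists_inv_nat_lt hε'.ne'
        refine ⟨m, le_trans ?_ hm.le⟩
        exact ENNReal.inv_le_inv.2 le_self_add
      exact ⟨F m, fun x hx => (hx.2 m).trans hm⟩
  refine ⟨closure K, isCompact_iff_totallyBounded_isComplete.2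
    ⟨hK.closure, isClosed_closure.isComplete⟩,
    fun μ hμ => ?_⟩
  have hsub : (closure K)ᶜ ⊆ {x | (R : ℝ≥0∞) ≤ ‖x‖ₑ ^ 2} ∪
      ⋃ m, {x | η m ≤ ∑' i : {i // i ∉ F m}, ‖inner ℂ (b i) x‖ₑ ^ 2} := by
    intro x hx
    by_contra hcon
    simp only [Set.mem_union, Set.mem_ofPred_eq, Set.mem_iUnion, not_or, not_exists, not_le] at hcon
    exact hx (subset_closure ⟨hcon.1.le, fun m => (hcon.2 m).le⟩)
  calc μ (closure K)ᶜ ≤ μ {x | (R : ℝ≥0∞) ≤ ‖x‖ₑ ^ 2} +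
        ∑' m, μ {x | η m ≤ ∑' i : {i // i ∉ F m}, ‖inner ℂ (b i) x‖ₑ ^ 2} :=
      (measure_mono hsub).trans ((measure_union_le _ _).trans
        (by gcongr; exact measure_iUnion_le _))
    _ ≤ ε / 2 + ∑' m, d m := by
      gcongr with m
      · refine (meas_ge_le_lintegral_div (by fun_prop) (by positivity) (by simp)).trans
          (le_trans ?_ hR)
        gcongr
        have h1 := hint μ hμ ∅
        have h2 : ∀ f : ι → ℝ≥0∞, ∑' i : {i // i ∉ (∅ : Finset ι)}, f i = ∑' i, f i := fun f => by
          rw [tsum_subtype_notMem]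
          simp
        have h3 : ∀ x : E, ∑' i : {i // i ∉ (∅ : Finset ι)}, ‖inner ℂ (b i) x‖ₑ ^ 2
            = ‖x‖ₑ ^ 2 := fun x => by
          rw [h2 fun i => ‖inner ℂ (b i) x‖ₑ ^ 2, tsum_enorm_inner_sq]
        rwa [h2, lintegral_congr h3] at h1
      · refine (meas_ge_le_lintegral_div
          (Measurable.tsum fun i : {i // i ∉ F m} => hmeas i).aemeasurable
          (hη m).ne' (hη' m)).trans ?_
        refine ENNReal.div_le_of_le_mul' ?_
        exact (hint μ hμ (F m)).trans (hF m)
    _ ≤ ε / 2 + ε / 2 := by gcongr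
    _ = ε := ENNReal.add_halves ε

end Tight

/-! ### Weak convergence to a Gaussian limit -/

section Limit

variable {E : Type*} [NormedAddCommGroup E] [NormedSpace ℝ E] [MeasurableSpace E] [BorelSpace E]

theorem tendsto_charFunDual {ι : Type*} {l : Filter ι} {P : ι → ProbabilityMeasure E}
    {μ : ProbabilityMeasure E} (h : Tendsto P l (𝓝 μ)) (L : StrongDual ℝ E) :
    Tendsto (fun n => charFunDual (P n : Measure E) L) l (𝓝 (charFunDual (μ : Measure E) L)) :=
  (ProbabilityMeasure.tendsto_iff_forall_integral_rclike_tendsto ℂ).1 h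
    (BoundedContinuousFunction.probCharDual L)

theorem continuous_charFunDual (μ : Measure E) [IsFiniteMeasure μ] :
    Continuous (charFunDual μ) := by
  refine continuous_iff_continuousAt.2 fun L => ?_
  refine tendsto_integral_filter_of_dominated_convergence (fun _ => 1) ?_ ?_
    (integrable_const _) ?_
  · exact Eventually.of_forall fun L =>
      (BoundedContinuousFunction.probCharDual L).continuous.aestronglyMeasurable
  · exact Eventually.of_forall fun L => ae_of_all _ fun x => by
      rw [BoundedContinuousFunction.probCharDual_apply, Complex.norm_exp_ofReal_mul_I]
  · refine ae_of_all _ fun x => ?_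
    have : Continuous fun L : StrongDual ℝ E => Complex.exp (L x * Complex.I) := by fun_prop
    exact this.tendsto L

/-- A limit of centred Gaussian characteristic functions along a dense set of functionals is
Gaussian. -/
theorem map_eq_gaussianReal_of_dense (μ : Measure E) [IsProbabilityMeasure μ]
    {D : Set (StrongDual ℝ E)} (hD : Dense D) {q : StrongDual ℝ E → ℝ} {C : ℝ}
    (hq : ∀ L ∈ D, 0 ≤ q L ∧ q L ≤ C * ‖L‖ ^ 2)
    (h : ∀ L ∈ D, ∀ t : ℝ, charFunDual μ (t • L) = Complex.exp (-(t ^ 2 * q L / 2 : ℝ)))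
    (L : StrongDual ℝ E) : ∃ v : ℝ≥0, μ.map L = gaussianReal 0 v := by
  obtain ⟨u, huD, hu⟩ := mem_closure_iff_seq_limit.1 (hD L)
  obtain ⟨M, hM⟩ := hu.norm.bddAbove_range
  have hb : ∀ n, q (u n) ∈ Set.Icc 0 (|C| * M ^ 2) := fun n => by
    refine ⟨(hq _ (huD n)).1, (hq _ (huD n)).2.trans ?_⟩
    have : ‖u n‖ ≤ M := hM ⟨n, rfl⟩
    gcongr
    exact le_abs_self C
  obtain ⟨v, hv, φ, hφ, hlim⟩ := isCompact_Icc.tendsto_subseq hb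
  lift v to ℝ≥0 using hv.1
  refine ⟨v, ?_⟩
  have := Measure.isProbabilityMeasure_map (μ := μ) L.continuous.aemeasurable
  refine Measure.ext_of_charFun ?_
  ext t
  rw [charFun_map_eq_charFunDual_smul, charFun_gaussianReal]
  have h1 : Tendsto (fun n => charFunDual μ (t • u (φ n))) atTop (𝓝 (charFunDual μ (t • L))) :=
    ((continuous_charFunDual μ).tendsto _).comp ((hu.comp hφ.tendsto_atTop).const_smul t)
  have h2 : Tendsto (fun n => charFunDual μ (t • u (φ n))) atTop
      (𝓝 (Complex.exp (-(t ^ 2 * v / 2 : ℝ)))) := by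
    simp_rw [fun n => h _ (huD (φ n)) t]
    have hc : Continuous fun y : ℝ => Complex.exp (-(t ^ 2 * y / 2 : ℝ)) := by fun_prop
    exact (hc.tendsto v).comp hlim
  rw [tendsto_nhds_unique h1 h2]
  congr 1
  push_cast
  ring

/-- A tight sequence of laws whose characteristic functions converge to centred Gaussian ones
along a dense set of functionals converges to a centred Gaussian law. -/
theorem exists_gaussian_limit [CompleteSpace E] [SecondCountableTopology E]
    {P : ℕ → ProbabilityMeasure E} (ht : IsTightMeasureSet {(P n : Measure E) | n})
    {D : Set (StrongDual ℝ E)} (hD : Dense D) {q : StrongDual ℝ E → ℝ} {C : ℝ}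
    (hq : ∀ L ∈ D, 0 ≤ q L ∧ q L ≤ C * ‖L‖ ^ 2)
    (h : ∀ L ∈ D, ∀ t : ℝ, Tendsto (fun n => charFunDual (P n : Measure E) (t • L)) atTop
      (𝓝 (Complex.exp (-(t ^ 2 * q L / 2 : ℝ))))) :
    ∃ μ : ProbabilityMeasure E, Tendsto P atTop (𝓝 μ) ∧
      ∀ L : StrongDual ℝ E, ∃ v : ℝ≥0, (μ : Measure E).map L = gaussianReal 0 v := by
  -- Prokhorov: the laws converge along every ultrafilter finer than `atTop`. Any two such limits
  -- have equal characteristic functions on the dense set, hence everywhere by continuity, so the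
  -- whole sequence converges.
  have hcompact : IsCompact (closure {P n | n}) :=
    isCompact_closure_of_isTightMeasureSet (by simpa using ht)
  have hlim : ∀ U : Ultrafilter ℕ, ∃ μ : ProbabilityMeasure E, Tendsto P U (𝓝 μ) := fun U => by
    obtain ⟨μ, -, hμ⟩ := hcompact.ultrafilter_le_nhds (U.map P)
      (.trans (by simp) (Filter.monotone_principal subset_closure))
    exact ⟨μ, hμ⟩
  have hchar : ∀ U : Ultrafilter ℕ, (U : Filter ℕ) ≤ atTop → ∀ μ : ProbabilityMeasure E,
      Tendsto P U (𝓝 μ) → ∀ L ∈ D, ∀ t : ℝ,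
      charFunDual (μ : Measure E) (t • L) = Complex.exp (-(t ^ 2 * q L / 2 : ℝ)) :=
    fun U hU μ hμ L hL t =>
      tendsto_nhds_unique (tendsto_charFunDual hμ _) ((h L hL t).mono_left hU)
  obtain ⟨μ, hμ⟩ := hlim (Ultrafilter.of atTop)
  have hμ' := hchar _ (Ultrafilter.of_le atTop) μ hμ
  refine ⟨μ, ?_, map_eq_gaussianReal_of_dense _ hD hq hμ'⟩
  refine (Filter.tendsto_iff_ultrafilter _ _ _).2 fun U hU => ?_
  obtain ⟨ν, hν⟩ := hlim U
  have heq : ν = μ := by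
    have := ν.2
    have := μ.2
    refine Subtype.ext (Measure.ext_of_charFunDual ?_)
    refine Continuous.ext_on hD (continuous_charFunDual _) (continuous_charFunDual _) ?_
    intro L hL
    have h1 := hchar U hU ν hν L hL 1
    have h2 := hμ' L hL 1
    rw [one_smul] at h1 h2
    exact h1.trans h2.symm
  rw [heq] at hν
  exact hν

end Limit

end SpectralCLT

namespace SpectralCLT

/-! ### Fourth moments of Gaussian variables -/

/-- Moments are derivatives at `0` of the moment generating function `exp (v t² / 2)`. -/
theorem integral_pow_gaussianReal (v : ℝ≥0) :
    ∫ x, x ^ 2 ∂(gaussianReal 0 v) = v ∧ ∫ x, x ^ 4 ∂(gaussianReal 0 v) = 3 * (v : ℝ) ^ 2 := by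
  have h0 : (0 : ℝ) ∈ interior (integrableExpSet id (gaussianReal 0 v)) := by
    rw [integrableExpSet_id_gaussianReal]; simp
  have hm : ∀ n, ∫ x, x ^ n ∂(gaussianReal 0 v)
      = iteratedDeriv n (fun t : ℝ => Real.exp (v * t ^ 2 / 2)) 0 := fun n => by
    have h := iteratedDeriv_mgf_zero h0 n
    rw [mgf_id_gaussianReal] at h
    simpa using h.symm
  set E : ℝ → ℝ := fun t => Real.exp (v * t ^ 2 / 2) with hE
  have hE' : ∀ t, HasDerivAt E (v * t * E t) t := fun t => by
    have h1 : HasDerivAt (fun t : ℝ => (v : ℝ) * t ^ 2 / 2) (v * t) t := by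
      have := ((hasDerivAt_pow 2 t).const_mul (v : ℝ)).div_const 2
      convert! this using 1
      push_cast
      ring
    convert! h1.exp using 1
    simp only [hE]
    ring
  have d1 : deriv E = fun t => (v : ℝ) * t * E t := funext fun t => (hE' t).deriv
  have d2 : deriv (fun t => (v : ℝ) * t * E t) = fun t => (v + (v : ℝ) ^ 2 * t ^ 2) * E t := by
    funext t
    have h1 := ((hasDerivAt_id t).const_mul (v : ℝ)).mul (hE' t)
    refine (h1.congr_deriv ?_).deriv
    simp
    ring
  have d3 : deriv (fun t => (v + (v : ℝ) ^ 2 * t ^ 2) * E t)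
      = fun t => (3 * (v : ℝ) ^ 2 * t + (v : ℝ) ^ 3 * t ^ 3) * E t := by
    funext t
    have h1 := (((hasDerivAt_pow 2 t).const_mul ((v : ℝ) ^ 2)).const_add (v : ℝ)).mul (hE' t)
    refine (h1.congr_deriv ?_).deriv
    simp
    ring
  have d4 : deriv (fun t => (3 * (v : ℝ) ^ 2 * t + (v : ℝ) ^ 3 * t ^ 3) * E t) 0
      = 3 * (v : ℝ) ^ 2 := by
    have h1 := (((hasDerivAt_id (0 : ℝ)).const_mul (3 * (v : ℝ) ^ 2)).add
      ((hasDerivAt_pow 3 (0 : ℝ)).const_mul ((v : ℝ) ^ 3))).mul (hE' 0)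
    refine (h1.congr_deriv ?_).deriv
    simp [hE]
  constructor
  · rw [hm, iteratedDeriv_succ, iteratedDeriv_one, d1, d2]
    simp [hE]
  · rw [hm, iteratedDeriv_succ, iteratedDeriv_succ, iteratedDeriv_succ, iteratedDeriv_one, d1, d2,
      d3, d4]

/-- Random variables with moments of all orders. -/
def HasAllMoments {Ω : Type*} [MeasurableSpace Ω] {F : Type*} [NormedAddCommGroup F] (Y : Ω → F)
    (P : Measure Ω) : Prop := ∀ p : ℝ≥0∞, p ≠ ∞ → MemLp Y p P

namespace HasAllMoments

variable {Ω : Type*} [MeasurableSpace Ω] {P : Measure Ω}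

theorem integrable {F : Type*} [NormedAddCommGroup F] {Y : Ω → F} (hY : HasAllMoments Y P) :
    Integrable Y P := memLp_one_iff_integrable.1 (hY 1 (by simp))

theorem mul {A : Type*} [NormedRing A] {X Y : Ω → A} (hX : HasAllMoments X P)
    (hY : HasAllMoments Y P) : HasAllMoments (fun ω => X ω * Y ω) P := by
  intro p hp
  -- Hölder with exponents `2p, 2p` for a product in `L^p`, so that having all moments is stable
  -- under products.
  have : ENNReal.HolderTriple (p * 2) (p * 2) p := ⟨by
    rcases eq_or_ne p 0 with rfl | h0
    · simp
    rw [ENNReal.mul_inv (Or.inl h0) (Or.inl hp), ← mul_add, ENNReal.inv_two_add_inv_two, mul_one]⟩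
  exact (hY (p * 2) (by finiteness)).mul (hX (p * 2) (by finiteness))

theorem const_mul {A : Type*} [NormedRing A] {X : Ω → A} (hX : HasAllMoments X P) (c : A) :
    HasAllMoments (fun ω => c * X ω) P := fun p hp => (hX p hp).const_mul c

theorem pow [IsProbabilityMeasure P] {A : Type*} [NormedRing A] {X : Ω → A} (hX : HasAllMoments X P) (n : ℕ) :
    HasAllMoments (fun ω => X ω ^ n) P := by
  induction n with
  | zero => exact fun p _ => by simpa using memLp_const (1 : A)
  | succ n ih => simpa [pow_succ] using ih.mul hX

theorem add {F : Type*} [NormedAddCommGroup F] {X Y : Ω → F} (hX : HasAllMoments X P)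
    (hY : HasAllMoments Y P) : HasAllMoments (fun ω => X ω + Y ω) P :=
  fun p hp => (hX p hp).add (hY p hp)

theorem sub_const [IsProbabilityMeasure P] {F : Type*} [NormedAddCommGroup F] {X : Ω → F} (hX : HasAllMoments X P) (c : F) :
    HasAllMoments (fun ω => X ω - c) P :=
  fun p hp => (hX p hp).sub (memLp_const c)

theorem finset_sum {ι F : Type*} [NormedAddCommGroup F] {s : Finset ι} {X : ι → Ω → F}
    (hX : ∀ i ∈ s, HasAllMoments (X i) P) : HasAllMoments (fun ω => ∑ i ∈ s, X i ω) P :=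
  fun p hp => memLp_finsetSum s fun i hi => hX i hi p hp

theorem star {X : Ω → ℂ} (hX : HasAllMoments X P) :
    HasAllMoments (fun ω => (starRingEnd ℂ) (X ω)) P := fun p hp => (hX p hp).star

theorem ofReal {X : Ω → ℝ} (hX : HasAllMoments X P) :
    HasAllMoments (fun ω => (X ω : ℂ)) P := fun p hp => (hX p hp).ofReal

theorem re {X : Ω → ℂ} (hX : HasAllMoments X P) :
    HasAllMoments (fun ω => (X ω).re) P := fun p hp => (hX p hp).re

theorem im {X : Ω → ℂ} (hX : HasAllMoments X P) :
    HasAllMoments (fun ω => (X ω).im) P := fun p hp => (hX p hp).im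

theorem of_map_eq_gaussianReal {X : Ω → ℝ} {v : ℝ≥0} (h : P.map X = gaussianReal 0 v) :
    HasAllMoments X P := by
  intro p hp
  have hX : AEMeasurable X P := by
    by_contra hn
    rw [Measure.map_of_not_aemeasurable hn] at h
    exact IsProbabilityMeasure.ne_zero (gaussianReal 0 v) h.symm
  have := memLp_id_gaussianReal' (μ := 0) (v := v) p hp
  rw [← h] at this
  exact this.comp_of_map hX

end HasAllMoments

/-! ### The formula of Isserlis for complex variables that are jointly Gaussian in the real sense.
-/

section Isserlis

variable {Ω : Type*} [MeasurableSpace Ω] {P : Measure Ω}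

theorem integral_pow_four_of_map_eq {W : Ω → ℝ} {v : ℝ≥0} (h : P.map W = gaussianReal 0 v) :
    ∫ ω, W ω ^ 4 ∂P = 3 * (∫ ω, W ω ^ 2 ∂P) ^ 2 := by
  have hW : AEMeasurable W P :=
    ((HasAllMoments.of_map_eq_gaussianReal h) 1 (by simp)).1.aemeasurable
  have h2 : ∀ n : ℕ, ∫ ω, W ω ^ n ∂P = ∫ x, x ^ n ∂(gaussianReal 0 v) := fun n => by
    rw [← h, integral_map hW (by fun_prop)]
  rw [h2, h2, (integral_pow_gaussianReal v).1, (integral_pow_gaussianReal v).2]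

/-- The complex variables `Y k` are jointly Gaussian, in the real sense, and centred. -/
def IsCentredGaussianFamily {κ : Type*} [Fintype κ] (Y : κ → Ω → ℂ) (P : Measure Ω) : Prop :=
  ∀ s : κ → ℂ, ∃ v : ℝ≥0, P.map (fun ω => (∑ k, s k * Y k ω).re) = gaussianReal 0 v

theorem IsCentredGaussianFamily.hasAllMoments {κ : Type*} [Fintype κ] {Y : κ → Ω → ℂ}
    (hY : IsCentredGaussianFamily Y P) (k : κ) : HasAllMoments (Y k) P := by
  classical
  have h : ∀ c : ℂ, HasAllMoments (fun ω => (c * Y k ω).re) P := fun c => by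
    obtain ⟨v, hv⟩ := hY (fun j => if j = k then c else 0)
    simp only [ite_mul, zero_mul, Finset.sum_ite_eq', Finset.mem_univ, if_true] at hv
    exact .of_map_eq_gaussianReal hv
  have h1 := (h 1).ofReal.add ((h (-Complex.I)).ofReal.const_mul Complex.I)
  convert! h1 using 2 with ω
  apply Complex.ext <;> simp

/-- Write the sum as `U + iV`. For real `t` the variable `U + tV` is a real Gaussian, so its fourth
moment is three times the square of its second moment. Both sides are polynomials in `t`, hence the
identity persists at `t = i`. -/
theorem IsCentredGaussianFamily.integral_pow_four [IsProbabilityMeasure P] {κ : Type*} [Fintype κ] {Y : κ → Ω → ℂ}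
    (hY : IsCentredGaussianFamily Y P) (s : κ → ℂ) :
    ∫ ω, (∑ k, s k * Y k ω) ^ 4 ∂P = 3 * (∫ ω, (∑ k, s k * Y k ω) ^ 2 ∂P) ^ 2 := by
  set U : Ω → ℝ := fun ω => (∑ k, s k * Y k ω).re with hU
  set V : Ω → ℝ := fun ω => (∑ k, s k * Y k ω).im with hV
  have hS : HasAllMoments (fun ω => ∑ k, s k * Y k ω) P :=
    .finset_sum fun k _ => (hY.hasAllMoments k).const_mul _
  have hUm : HasAllMoments U P := hS.re
  have hVm : HasAllMoments V P := hS.im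
  set m : ℕ → ℕ → ℝ := fun a b => ∫ ω, U ω ^ a * V ω ^ b ∂P with hmdef
  have hmC : ∀ a b : ℕ, Integrable (fun ω => (U ω : ℂ) ^ a * (V ω : ℂ) ^ b) P := fun a b => by
    simpa using ((hUm.pow a).mul (hVm.pow b)).integrable.ofReal (𝕜 := ℂ)
  have hmI : ∀ a b : ℕ, ∫ ω, (U ω : ℂ) ^ a * (V ω : ℂ) ^ b ∂P = m a b := fun a b => by
    rw [hmdef]
    simp only
    rw [← integral_complex_ofReal]
    simp
  have hexp : ∀ (c : ℂ) (n : ℕ), ∫ ω, (U ω + c * V ω : ℂ) ^ n ∂P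
      = ∑ j ∈ Finset.range (n + 1), c ^ (n - j) * n.choose j * m j (n - j) := fun c n => by
    have h : ∀ ω, (U ω + c * V ω : ℂ) ^ n = ∑ j ∈ Finset.range (n + 1),
        c ^ (n - j) * n.choose j * ((U ω : ℂ) ^ j * (V ω : ℂ) ^ (n - j)) := fun ω => by
      rw [add_pow]
      exact Finset.sum_congr rfl fun j _ => by rw [mul_pow]; ring
    simp_rw [h]
    rw [integral_finsetSum _ fun j _ => (hmC _ _).const_mul _]
    simp_rw [integral_const_mul, hmI]
  have key : ∀ t : ℝ, m 4 0 + 4 * t * m 3 1 + 6 * t ^ 2 * m 2 2 + 4 * t ^ 3 * m 1 3 + t ^ 4 * m 0 4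
      = 3 * (m 2 0 + 2 * t * m 1 1 + t ^ 2 * m 0 2) ^ 2 := fun t => by
    obtain ⟨v, hv⟩ : ∃ v : ℝ≥0, P.map (fun ω => U ω + t * V ω) = gaussianReal 0 v := by
      -- The coefficient `1 - ti` is chosen because `Re ((1 - ti)(U + iV)) = U + tV`.
      obtain ⟨v, hv⟩ := hY (fun k => (1 - t * Complex.I) * s k)
      refine ⟨v, hv ▸ ?_⟩
      congr 1
      funext ω
      simp only [mul_assoc]
      rw [← Finset.mul_sum]
      simp [hU, hV]
    have h4 := congrArg ((↑) : ℝ → ℂ) (integral_pow_four_of_map_eq hv)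
    push_cast [← integral_complex_ofReal] at h4
    rw [hexp t 4, hexp t 2] at h4
    norm_num [Finset.sum_range_succ, Nat.choose] at h4
    have h5 : ((m 4 0 + 4 * t * m 3 1 + 6 * t ^ 2 * m 2 2 + 4 * t ^ 3 * m 1 3 + t ^ 4 * m 0 4 : ℝ)
        : ℂ) = (3 * (m 2 0 + 2 * t * m 1 1 + t ^ 2 * m 0 2) ^ 2 : ℝ) := by
      push_cast
      linear_combination h4
    exact_mod_cast h5
  have hY' : ∀ ω, ∑ k, s k * Y k ω = U ω + Complex.I * V ω := fun ω => by
    rw [mul_comm]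
    exact (Complex.re_add_im _).symm
  simp_rw [hY']
  rw [hexp, hexp]
  norm_num [Finset.sum_range_succ, Nat.choose, Complex.I_pow_four, Complex.I_pow_three]
  -- Five values of `t` determine the coefficients of a polynomial of degree four.
  have k0 := key 0
  have k1 := key 1
  have k1' := key (-1)
  have k2 := key 2
  have k2' := key (-2)
  norm_num at k0 k1 k1' k2 k2'
  have r04 : m 0 4 = 3 * m 0 2 ^ 2 := by linarith
  have r31 : m 3 1 = 3 * m 2 0 * m 1 1 := by linarith
  have r13 : m 1 3 = 3 * m 0 2 * m 1 1 := by linarith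
  have r22 : 6 * m 2 2 = 6 * m 2 0 * m 0 2 + 12 * m 1 1 ^ 2 := by linarith
  have r22' : 6 * (m 2 2 : ℂ) = 6 * m 2 0 * m 0 2 + 12 * m 1 1 ^ 2 := by exact_mod_cast r22
  rw [k0, r04, r31, r13]
  push_cast
  linear_combination (-1) * r22' - 12 * (m 1 1 : ℂ) ^ 2 * Complex.I_sq

/-- The formula of Isserlis for the moment of order four of centred jointly Gaussian variables. -/
theorem IsCentredGaussianFamily.integral_mul_four [IsProbabilityMeasure P] {Y : Fin 4 → Ω → ℂ}
    (hY : IsCentredGaussianFamily Y P) :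
    ∫ ω, Y 0 ω * Y 1 ω * Y 2 ω * Y 3 ω ∂P =
      (∫ ω, Y 0 ω * Y 1 ω ∂P) * (∫ ω, Y 2 ω * Y 3 ω ∂P) +
      (∫ ω, Y 0 ω * Y 2 ω ∂P) * (∫ ω, Y 1 ω * Y 3 ω ∂P) +
      (∫ ω, Y 0 ω * Y 3 ω ∂P) * (∫ ω, Y 1 ω * Y 2 ω ∂P) := by
  have hmul : ∀ k l, Integrable (fun ω => Y k ω * Y l ω) P := fun k l =>
    ((hY.hasAllMoments k).mul (hY.hasAllMoments l)).integrable
  set m : Fin 4 → Fin 4 → ℂ := fun k l => ∫ ω, Y k ω * Y l ω ∂P with hm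
  have hsymm : ∀ k l, m k l = m l k := fun k l => by simp only [hm, mul_comm]
  have h2 : ∀ s : Fin 4 → ℂ, ∫ ω, (∑ k, s k * Y k ω) ^ 2 ∂P = ∑ k, ∑ l, s k * s l * m k l :=
    fun s => by
      have : ∀ ω, (∑ k, s k * Y k ω) ^ 2 = ∑ k, ∑ l, s k * s l * (Y k ω * Y l ω) := fun ω => by
        rw [pow_two, Finset.sum_mul_sum]
        exact Finset.sum_congr rfl fun k _ => Finset.sum_congr rfl fun l _ => by ring
      simp_rw [this]
      rw [integral_finsetSum _ fun k _ => integrable_finsetSum _ fun l _ => (hmul k l).const_mul _]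
      refine Finset.sum_congr rfl fun k _ => ?_
      rw [integral_finsetSum _ fun l _ => (hmul k l).const_mul _]
      simp_rw [integral_const_mul]
      rfl
  have h4 : ∀ s : Fin 4 → ℂ, ∫ ω, (∑ k, s k * Y k ω) ^ 4 ∂P
      = 3 * (∑ k, ∑ l, s k * s l * m k l) ^ 2 := fun s => by rw [hY.integral_pow_four, h2]
  have hint : ∀ s : Fin 4 → ℂ, Integrable (fun ω => (∑ k, s k * Y k ω) ^ 4) P := fun s =>
    (HasAllMoments.pow (.finset_sum fun k _ => (hY.hasAllMoments k).const_mul _) 4).integrable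
  -- Polarization: with the first sign fixed to `+`, the eight signed fourth powers weighted by the
  -- product of signs sum to `8 · 4! = 192` times the product of the four variables.
  let σ : Fin 8 → Fin 4 → ℂ := ![![1, 1, 1, 1], ![1, 1, 1, -1], ![1, 1, -1, 1], ![1, 1, -1, -1],
    ![1, -1, 1, 1], ![1, -1, 1, -1], ![1, -1, -1, 1], ![1, -1, -1, -1]]
  let τ : Fin 8 → ℂ := ![1, -1, -1, 1, -1, 1, 1, -1]
  have hpt : ∀ ω, Y 0 ω * Y 1 ω * Y 2 ω * Y 3 ω
      = ∑ j, (τ j / 192) * (∑ k, σ j k * Y k ω) ^ 4 := fun ω => by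
    simp only [Fin.sum_univ_eight, Fin.sum_univ_four, τ, σ]
    simp
    ring
  simp_rw [hpt]
  rw [integral_finsetSum _ fun j _ => (hint _).const_mul _]
  simp_rw [integral_const_mul, h4]
  simp only [Fin.sum_univ_eight, Fin.sum_univ_four, τ, σ, hsymm 1 0, hsymm 2 0, hsymm 3 0,
    hsymm 2 1, hsymm 3 1, hsymm 3 2]
  simp
  ring

end Isserlis

end SpectralCLT

namespace SpectralCLT

/-! ### Quadratic forms in Gaussian vectors -/

section QuadraticForm

variable {Ω : Type*} [MeasurableSpace Ω] {P : Measure Ω}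
variable {J : Type*} [Fintype J]

/-- The real variables `Z j` are jointly Gaussian and centred. -/
def IsCentredGaussianVector (Z : J → Ω → ℝ) (P : Measure Ω) : Prop :=
  ∀ t : J → ℝ, ∃ v : ℝ≥0, P.map (fun ω => ∑ j, t j * Z j ω) = gaussianReal 0 v

/-- The matrix of second moments. -/
noncomputable def momentMatrix (Z : J → Ω → ℝ) (P : Measure Ω) : Matrix J J ℝ :=
  Matrix.of fun i j => ∫ ω, Z i ω * Z j ω ∂P

theorem IsCentredGaussianVector.hasAllMoments {Z : J → Ω → ℝ} (hZ : IsCentredGaussianVector Z P)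
    (j : J) : HasAllMoments (Z j) P := by
  classical
  obtain ⟨v, hv⟩ := hZ (Pi.single j 1)
  simp [Pi.single_apply] at hv
  exact .of_map_eq_gaussianReal hv

theorem integral_sq_sum_eq {Z : J → Ω → ℝ} (hZ : IsCentredGaussianVector Z P) (t : J → ℝ) :
    ∫ ω, (∑ j, t j * Z j ω) ^ 2 ∂P = t ⬝ᵥ (momentMatrix Z P).mulVec t := by
  have hmul : ∀ k l, Integrable (fun ω => Z k ω * Z l ω) P := fun k l =>
    ((hZ.hasAllMoments k).mul (hZ.hasAllMoments l)).integrable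
  have : ∀ ω, (∑ k, t k * Z k ω) ^ 2 = ∑ k, ∑ l, t k * t l * (Z k ω * Z l ω) := fun ω => by
    rw [pow_two, Finset.sum_mul_sum]
    exact Finset.sum_congr rfl fun k _ => Finset.sum_congr rfl fun l _ => by ring
  simp_rw [this]
  rw [integral_finsetSum _ fun k _ => integrable_finsetSum _ fun l _ => (hmul k l).const_mul _]
  refine Finset.sum_congr rfl fun k _ => ?_
  rw [integral_finsetSum _ fun l _ => (hmul k l).const_mul _, Matrix.mulVec, dotProduct,
    Finset.mul_sum]
  refine Finset.sum_congr rfl fun l _ => ?_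
  rw [integral_const_mul, momentMatrix, Matrix.of_apply]
  ring

theorem posSemidef_momentMatrix {Z : J → Ω → ℝ} (hZ : IsCentredGaussianVector Z P) :
    (momentMatrix Z P).PosSemidef := by
  refine Matrix.posSemidef_iff_dotProduct_mulVec.2 ⟨?_, fun t => ?_⟩
  · ext i j
    simp [momentMatrix, mul_comm]
  · rw [star_trivial, ← integral_sq_sum_eq hZ]
    exact integral_nonneg fun ω => sq_nonneg _

/-- Comparison of characteristic functions at each `t`: the variance of the Gaussian variable `∑ t_j
Z_j` is the quadratic form of the moment matrix, which may be singular. -/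
theorem map_eq_multivariateGaussian [IsProbabilityMeasure P] [DecidableEq J] {Z : J → Ω → ℝ}
    (hZ : IsCentredGaussianVector Z P) :
    P.map (fun ω => WithLp.toLp 2 fun j => Z j ω)
      = multivariateGaussian 0 (momentMatrix Z P) := by
  have hm : AEMeasurable (fun ω => WithLp.toLp 2 fun j => Z j ω) P :=
    (WithLp.measurable_toLp 2 (J → ℝ)).comp_aemeasurable
      (aemeasurable_pi_lambda _ fun j => ((hZ.hasAllMoments j) 1 (by simp)).1.aemeasurable)
  have := Measure.isProbabilityMeasure_map hm
  refine Measure.ext_of_charFun ?_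
  ext t
  rw [charFun_multivariateGaussian (posSemidef_momentMatrix hZ), charFun_apply,
    integral_map hm (by fun_prop), ← integral_sq_sum_eq hZ]
  obtain ⟨v, hv⟩ := hZ t
  have hW : AEMeasurable (fun ω => ∑ j, t j * Z j ω) P :=
    ((HasAllMoments.of_map_eq_gaussianReal hv) 1 (by simp)).1.aemeasurable
  have h1 : ∫ ω, (∑ j, t j * Z j ω) ^ 2 ∂P = v := by
    rw [← (integral_pow_gaussianReal v).1, ← hv, integral_map hW (by fun_prop)]
  have h2 := charFun_gaussianReal (μ := 0) (v := v) 1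
  rw [← hv, charFun_apply_real, integral_map hW (by fun_prop)] at h2
  rw [h1, inner_zero_right]
  simp only [EuclideanSpace.inner_eq_star_dotProduct, dotProduct, star_trivial]
  simpa [neg_div] using h2

open scoped MatrixOrder in
/-- A quadratic form in a centred Gaussian vector has the law of a weighted sum of squares of
independent standard Gaussian variables, and the weights are bounded by the product of the
row sum norms of the covariance matrix and of the matrix of the form. -/
theorem exists_law_quadraticForm [IsProbabilityMeasure P] {Z : J → Ω → ℝ} (hZ : IsCentredGaussianVector Z P)
    {A : Matrix J J ℝ} (hA : A.IsHermitian) :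
    ∃ lam : J → ℝ, P.map (fun ω => ∑ i, ∑ j, A i j * (Z i ω * Z j ω))
        = (Measure.pi fun _ : J => gaussianReal 0 1).map (fun x => ∑ i, lam i * x i ^ 2) ∧
      ∀ α β : ℝ, 0 ≤ α → (∀ i, ∑ j, |∫ ω, Z i ω * Z j ω ∂P| ≤ α) → (∀ i, ∑ j, |A i j| ≤ β) →
        ∀ k, |lam k| ≤ α * β := by
  classical
  -- The vector has the law of `Bξ`, with `B = S^{1/2}` and `ξ` standard, so the form becomes
  -- `ξᵀ(BAB)ξ`. Rotation invariance of `ξ` diagonalizes it, with the eigenvalues of `BAB` as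
  -- weights.
  set S := momentMatrix Z P with hS
  set B := CFC.sqrt S with hB
  have hBB : B * B = S := CFC.sqrt_mul_sqrt_self _ (posSemidef_momentMatrix hZ).nonneg
  have hBH : B.IsHermitian := (CFC.sqrt_nonneg S).isSelfAdjoint
  have hM : (B * A * B).IsHermitian := by
    have h := Matrix.isHermitian_conjTranspose_mul_mul B hA
    rwa [hBH.eq] at h
  set b := hM.eigenvectorBasis
  set lam := hM.eigenvalues
  have hb : ∀ k, Matrix.toEuclideanCLM (𝕜 := ℝ) (B * A * B) (b k) = lam k • b k := fun k => by
    have h := hM.mulVec_eigenvectorBasis k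
    ext i
    rw [Matrix.ofLp_toEuclideanCLM, h]
    rfl
  have hm : AEMeasurable (fun ω => WithLp.toLp 2 fun j => Z j ω) P :=
    (WithLp.measurable_toLp 2 (J → ℝ)).comp_aemeasurable
      (aemeasurable_pi_lambda _ fun j => ((hZ.hasAllMoments j) 1 (by simp)).1.aemeasurable)
  refine ⟨lam, ?_, ?_⟩
  · let f : EuclideanSpace ℝ J → ℝ := fun y => inner ℝ y (Matrix.toEuclideanCLM (𝕜 := ℝ) A y)
    have hf : Continuous f := by fun_prop
    have h1 : (fun ω => ∑ i, ∑ j, A i j * (Z i ω * Z j ω))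
        = f ∘ fun ω => WithLp.toLp 2 fun j => Z j ω := by
      funext ω
      simp only [f, Function.comp, Matrix.inner_toEuclideanCLM, dotProduct, Matrix.mulVec,
        Finset.mul_sum]
      exact Finset.sum_congr rfl fun i _ => Finset.sum_congr rfl fun j _ => by ring
    rw [h1, ← AEMeasurable.map_map_of_aemeasurable hf.aemeasurable hm,
      map_eq_multivariateGaussian hZ, multivariateGaussian,
      stdGaussian_eq_map_pi_orthonormalBasis b, Measure.map_map (by fun_prop) (by fun_prop),
      Measure.map_map (hf.measurable.comp (by fun_prop)) (by fun_prop)]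
    congr 1
    funext x
    set u := ∑ i, x i • b i with hu
    have h2 : f (0 + Matrix.toEuclideanCLM (𝕜 := ℝ) B u)
        = inner ℝ u (Matrix.toEuclideanCLM (𝕜 := ℝ) (B * A * B) u) := by
      simp only [f, zero_add]
      rw [map_mul, map_mul, mul_assoc]
      simp only [mul_apply_eq_comp]
      rw [← ContinuousLinearMap.adjoint_inner_right, ← ContinuousLinearMap.star_eq_adjoint,
        ← map_star]
      rw [show star B = B from hBH]
    change f (0 + Matrix.toEuclideanCLM (𝕜 := ℝ) B u) = _
    rw [h2, hu, map_sum]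
    simp_rw [map_smul, hb, smul_smul]
    rw [b.orthonormal.inner_sum]
    exact Finset.sum_congr rfl fun i _ => by simp; ring
  · intro α β hα hSα hAβ k
    -- `w = B b_k` satisfies `S A w = B (BAB) b_k = λ w`. At a coordinate where `|w|` is largest the
    -- row sums give `|λ| ≤ αβ`; if `w = 0`, then `λ b_k = BAw = 0` and `λ = 0`.
    set w := B.mulVec (b k) with hw
    have hwe : S.mulVec (A.mulVec w) = lam k • w := by
      have hb' : (B * A * B).mulVec (b k) = lam k • (b k).ofLp := hM.mulVec_eigenvectorBasis k
      rw [hw, ← Matrix.mulVec_smul, ← hb']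
      simp only [← hBB, Matrix.mulVec_mulVec, Matrix.mul_assoc]
    by_cases hJ : Nonempty J
    swap
    · exact absurd ⟨k⟩ hJ
    obtain ⟨j, hj⟩ := Finite.exists_max fun i => |w i|
    have hβ : 0 ≤ β := (Finset.sum_nonneg fun _ _ => abs_nonneg _).trans (hAβ k)
    rcases (abs_nonneg (w j)).eq_or_lt with h0 | h0
    · have hw0 : w = 0 := funext fun i => abs_eq_zero.1 (le_antisymm (h0 ▸ hj i) (abs_nonneg _))
      have h3 : lam k • b k = 0 := by
        rw [← hb k]
        ext i
        rw [Matrix.ofLp_toEuclideanCLM, ← Matrix.mulVec_mulVec, ← hw, hw0]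
        simp
      have h4 : lam k = 0 := by
        rcases smul_eq_zero.1 h3 with h | h
        · exact h
        · exact absurd h (b.orthonormal.ne_zero k)
      rw [h4, abs_zero]
      positivity
    · have hAw : ∀ i, |A.mulVec w i| ≤ β * |w j| := fun i => by
        calc |A.mulVec w i| ≤ ∑ l, |A i l * w l| := Finset.abs_sum_le_sum_abs _ _
          _ ≤ ∑ l, |A i l| * |w j| := by
            refine Finset.sum_le_sum fun l _ => ?_
            rw [abs_mul]
            exact mul_le_mul_of_nonneg_left (hj l) (abs_nonneg _)
          _ ≤ β * |w j| := by
            rw [← Finset.sum_mul]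
            exact mul_le_mul_of_nonneg_right (hAβ i) (abs_nonneg _)
      have h5 : |lam k| * |w j| ≤ α * β * |w j| := by
        calc |lam k| * |w j| = |S.mulVec (A.mulVec w) j| := by
              rw [hwe, Pi.smul_apply, smul_eq_mul, abs_mul]
          _ ≤ ∑ l, |S j l * A.mulVec w l| := Finset.abs_sum_le_sum_abs _ _
          _ ≤ ∑ l, |S j l| * (β * |w j|) := by
            refine Finset.sum_le_sum fun l _ => ?_
            rw [abs_mul]
            exact mul_le_mul_of_nonneg_left (hAw l) (abs_nonneg _)
          _ ≤ α * (β * |w j|) := by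
            rw [← Finset.sum_mul]
            exact mul_le_mul_of_nonneg_right (hSα j) (by positivity)
          _ = _ := by ring
      exact le_of_mul_le_mul_right h5 h0

end QuadraticForm

/-! ### A central limit theorem for quadratic forms -/

section CLT

/-- The law of `ξ² - 1` for a standard Gaussian variable `ξ`. -/
noncomputable def centredChiSq : Measure ℝ := (gaussianReal 0 1).map (fun x => x ^ 2 - 1)

instance : IsProbabilityMeasure centredChiSq :=
  Measure.isProbabilityMeasure_map (by fun_prop)

theorem memLp_sq_gaussianReal : MemLp (fun x : ℝ => x ^ 2) 2 (gaussianReal 0 1) :=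
  (HasAllMoments.pow (fun p hp => memLp_id_gaussianReal' p hp :
    HasAllMoments (id : ℝ → ℝ) (gaussianReal 0 1)) 2) 2 (by simp)

theorem integral_sq_gaussianReal_one : ∫ x, x ^ 2 ∂(gaussianReal 0 1) = 1 := by
  simpa using (integral_pow_gaussianReal 1).1

theorem variance_sq_gaussianReal_one : Var[fun x => x ^ 2; gaussianReal 0 1] = 2 := by
  rw [variance_eq_sub memLp_sq_gaussianReal]
  have h4 := (integral_pow_gaussianReal 1).2
  simp only [Pi.pow_apply, ← pow_mul]
  norm_num at h4 ⊢
  rw [h4, integral_sq_gaussianReal_one]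
  norm_num

/-- The variable `(ξ² - 1)/√2` is standardized, so the second-order Taylor expansion of its
characteristic function at `√2 s` gives `1 - s² + o(s²)`, as for `exp (-s²)`. -/
theorem isLittleO_charFun_centredChiSq :
    (fun s : ℝ => charFun centredChiSq s - Complex.exp (-(s ^ 2 : ℝ))) =o[𝓝 0] fun s => s ^ 2 := by
  have hX : AEMeasurable (fun x : ℝ => (x ^ 2 - 1) / √2) (gaussianReal 0 1) := by fun_prop
  have hi : Integrable (fun x : ℝ => x ^ 2) (gaussianReal 0 1) :=
    memLp_sq_gaussianReal.integrable (by norm_num)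
  have h0 : ∫ x, (x ^ 2 - 1) / √2 ∂(gaussianReal 0 1) = 0 := by
    rw [integral_div, integral_sub hi (by simp), integral_sq_gaussianReal_one]
    simp
  have h1 : ∫ x, ((fun x : ℝ => (x ^ 2 - 1) / √2) ^ 2) x ∂(gaussianReal 0 1) = 1 := by
    have h2 := variance_eq_integral (X := fun x : ℝ => x ^ 2) (μ := gaussianReal 0 1) (by fun_prop)
    rw [variance_sq_gaussianReal_one, integral_sq_gaussianReal_one] at h2
    simp only [Pi.pow_apply, div_pow]
    rw [integral_div, ← h2]
    norm_num
  have h := taylor_charFun_two hX h0 h1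
  have hs : Tendsto (fun s : ℝ => √2 * s) (𝓝 0) (𝓝 0) := by
    have : Continuous fun s : ℝ => √2 * s := by fun_prop
    simpa using this.tendsto 0
  have h3 := h.comp_tendsto hs
  have e1 : ∀ s : ℝ, charFun ((gaussianReal 0 1).map fun x : ℝ => (x ^ 2 - 1) / √2) (√2 * s)
      = charFun centredChiSq s := fun s => by
    rw [centredChiSq, charFun_apply_real, charFun_apply_real, integral_map hX (by fun_prop),
      integral_map (by fun_prop) (by fun_prop)]
    refine integral_congr_ae (ae_of_all _ fun x => ?_)
    have : (√2 : ℂ) ≠ 0 := by simp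
    simp only
    push_cast
    congr 2
    field_simp
  have h4 : (fun s : ℝ => charFun centredChiSq s - (1 - (s : ℂ) ^ 2)) =o[𝓝 0] fun s => s ^ 2 := by
    have h5 : (fun s : ℝ => 2 * s ^ 2) =O[𝓝 0] fun s => s ^ 2 :=
      Asymptotics.isBigO_const_mul_self _ _ _
    refine (h3.trans_isBigO ?_).congr_left ?_
    · refine h5.congr_left fun s => ?_
      simp [mul_pow]
    · intro s
      have h6 : ((√2 : ℝ) : ℂ) ^ 2 = 2 := by norm_cast; simp
      simp only [Function.comp, e1]
      push_cast
      rw [mul_pow, h6]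
      ring
  have h7 : (fun s : ℝ => Complex.exp (-(s ^ 2 : ℝ)) - (1 - (s : ℂ) ^ 2)) =o[𝓝 0]
      fun s => s ^ 2 := by
    have hexp : (fun z : ℂ => Complex.exp z - Complex.exp 0 - (z - 0) • Complex.exp 0) =o[𝓝 0]
        fun z => z - 0 := (Complex.hasDerivAt_exp 0).isLittleO
    have ht : Tendsto (fun s : ℝ => -((s ^ 2 : ℝ) : ℂ)) (𝓝 0) (𝓝 0) := by
      have : Continuous fun s : ℝ => -((s ^ 2 : ℝ) : ℂ) := by fun_prop
      simpa using this.tendsto 0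
    have h8 := hexp.comp_tendsto ht
    refine (h8.congr_left ?_).trans_isBigO ?_
    · intro s
      simp [Function.comp]
      ring
    · refine Asymptotics.IsBigO.of_bound 1 (Eventually.of_forall fun s => ?_)
      simp
  exact (h4.sub h7).congr_left fun s => by ring

/-- Factors are exchanged one at a time; all the others have modulus at most one. -/
theorem norm_prod_sub_prod_le {J : Type*} (s : Finset J) {a b : J → ℂ} (ha : ∀ i, ‖a i‖ ≤ 1)
    (hb : ∀ i, ‖b i‖ ≤ 1) : ‖∏ i ∈ s, a i - ∏ i ∈ s, b i‖ ≤ ∑ i ∈ s, ‖a i - b i‖ := by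
  classical
  induction s using Finset.induction_on with
  | empty => simp
  | insert i s hi ih =>
    rw [Finset.prod_insert hi, Finset.prod_insert hi, Finset.sum_insert hi]
    have h1 : ‖∏ j ∈ s, a j‖ ≤ 1 := by
      rw [norm_prod]
      exact Finset.prod_le_one (fun _ _ => norm_nonneg _) fun j _ => ha j
    calc ‖a i * ∏ j ∈ s, a j - b i * ∏ j ∈ s, b j‖
        = ‖(a i - b i) * ∏ j ∈ s, a j + b i * (∏ j ∈ s, a j - ∏ j ∈ s, b j)‖ := by ring_nf
      _ ≤ ‖a i - b i‖ * ‖∏ j ∈ s, a j‖ + ‖b i‖ * ‖∏ j ∈ s, a j - ∏ j ∈ s, b j‖ := by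
        refine (norm_add_le _ _).trans ?_
        rw [norm_mul, norm_mul]
      _ ≤ ‖a i - b i‖ * 1 + 1 * ∑ j ∈ s, ‖a j - b j‖ := by
        gcongr
        exact hb i
      _ = _ := by ring

/-- A Lindeberg argument: since the weights are uniformly small, replacing each factor by `exp
(-(tλ)²)` costs an arbitrarily small multiple of `∑ (tλ)²`, which stays bounded. The product of the
exponentials is exactly Gaussian with variance `2 ∑ λ²`. -/
theorem tendsto_prod_charFun_centredChiSq {J : ℕ → Type*} [∀ n, Fintype (J n)]
    {lam : ∀ n, J n → ℝ} {ε : ℕ → ℝ} {V : ℝ} (hε : Tendsto ε atTop (𝓝 0))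
    (hlam : ∀ᶠ n in atTop, ∀ k, |lam n k| ≤ ε n)
    (hV : Tendsto (fun n => 2 * ∑ k, lam n k ^ 2) atTop (𝓝 V)) (t : ℝ) :
    Tendsto (fun n => ∏ k, charFun centredChiSq (t * lam n k)) atTop
      (𝓝 (Complex.exp (-(t ^ 2 * V / 2 : ℝ)))) := by
  have hexp : Tendsto (fun n => ∏ k, Complex.exp (-((t * lam n k) ^ 2 : ℝ))) atTop
      (𝓝 (Complex.exp (-(t ^ 2 * V / 2 : ℝ)))) := by
    have h1 : ∀ n, ∏ k, Complex.exp (-((t * lam n k) ^ 2 : ℝ))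
        = Complex.exp (-(t ^ 2 * (2 * ∑ k, lam n k ^ 2) / 2 : ℝ)) := fun n => by
      rw [← Complex.exp_sum]
      congr 1
      push_cast
      rw [Finset.sum_neg_distrib, Finset.mul_sum, Finset.mul_sum, Finset.sum_div]
      congr 1
      exact Finset.sum_congr rfl fun k _ => by ring
    simp_rw [h1]
    have hc : Continuous fun y : ℝ => Complex.exp (-(t ^ 2 * y / 2 : ℝ)) := by fun_prop
    exact (hc.tendsto V).comp hV
  have hdiff : Tendsto (fun n => ∏ k, charFun centredChiSq (t * lam n k)
      - ∏ k, Complex.exp (-((t * lam n k) ^ 2 : ℝ))) atTop (𝓝 0) := by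
    rw [Metric.tendsto_nhds]
    intro η hη
    -- Eventually `2 ∑ λ² < |V| + 1`, so `M` dominates `∑ (tλ)²`; the last `1` makes `M` positive
    -- and the final inequality strict.
    set M := t ^ 2 * (|V| + 1) + 1 with hM
    have hMpos : 0 < M := by positivity
    obtain ⟨ρ, hρ, hρ'⟩ := Metric.eventually_nhds_iff.1
      (isLittleO_charFun_centredChiSq.bound (div_pos hη hMpos))
    have htε : Tendsto (fun n => |t| * ε n) atTop (𝓝 0) := by simpa using hε.const_mul |t|
    filter_upwards [hlam, htε.eventually_lt_const hρ,
      hV.eventually_lt_const (lt_of_le_of_lt (le_abs_self V) (lt_add_one |V|))] with n h1 h2 h3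
    rw [dist_zero_right]
    calc _ ≤ ∑ k, ‖charFun centredChiSq (t * lam n k)
            - Complex.exp (-((t * lam n k) ^ 2 : ℝ))‖ := by
          refine norm_prod_sub_prod_le _ (fun k => norm_charFun_le_one _) fun k => ?_
          rw [← Complex.ofReal_neg, Complex.norm_exp_ofReal, Real.exp_le_one_iff, neg_nonpos]
          positivity
      _ ≤ ∑ k, η / M * (t * lam n k) ^ 2 := by
          refine Finset.sum_le_sum fun k _ => ?_
          have h4 : dist (t * lam n k) 0 < ρ := by
            rw [dist_zero_right, norm_mul, Real.norm_eq_abs, Real.norm_eq_abs]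
            exact (mul_le_mul_of_nonneg_left (h1 k) (abs_nonneg t)).trans_lt h2
          have h5 := hρ' h4
          rwa [Real.norm_of_nonneg (sq_nonneg (t * lam n k))] at h5
      _ = η / M * (t ^ 2 * ∑ k, lam n k ^ 2) := by
          rw [Finset.mul_sum, Finset.mul_sum]
          exact Finset.sum_congr rfl fun k _ => by ring
      _ ≤ η / M * (t ^ 2 * (|V| + 1)) := by
          have h6 : 0 ≤ ∑ k, lam n k ^ 2 := Finset.sum_nonneg fun _ _ => sq_nonneg _
          gcongr
          linarith
      _ < η := by
          rw [div_mul_eq_mul_div, div_lt_iff₀ hMpos]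
          exact mul_lt_mul_of_pos_left (lt_add_one _) hη
  simpa using hdiff.add hexp

variable {Ω : Type*} [MeasurableSpace Ω] {P : Measure Ω} [IsProbabilityMeasure P]

/-- Centred quadratic forms in Gaussian vectors are asymptotically Gaussian if their variances
converge and the row sum norms of the covariance matrix and of the matrix of the form have
product tending to zero. -/
theorem tendsto_charFun_quadraticForm {J : ℕ → Type*} [∀ n, Fintype (J n)]
    {Z : ∀ n, J n → Ω → ℝ} (hZ : ∀ n, IsCentredGaussianVector (Z n) P)
    {A : ∀ n, Matrix (J n) (J n) ℝ} (hA : ∀ n, (A n).IsHermitian) {α β : ℕ → ℝ}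
    (hα0 : ∀ᶠ n in atTop, 0 ≤ α n)
    (hα : ∀ᶠ n in atTop, ∀ i, ∑ j, |∫ ω, Z n i ω * Z n j ω ∂P| ≤ α n)
    (hβ : ∀ᶠ n in atTop, ∀ i, ∑ j, |A n i j| ≤ β n)
    (hαβ : Tendsto (fun n => α n * β n) atTop (𝓝 0)) {Q : ℕ → Ω → ℝ} {c : ℕ → ℝ}
    (hQ : ∀ n ω, Q n ω = ∑ i, ∑ j, A n i j * (Z n i ω * Z n j ω) - c n)
    (hmean : ∀ n, ∫ ω, Q n ω ∂P = 0) {V : ℝ}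
    (hV : Tendsto (fun n => ∫ ω, Q n ω ^ 2 ∂P) atTop (𝓝 V)) (t : ℝ) :
    Tendsto (fun n => charFun (P.map (Q n)) t) atTop
      (𝓝 (Complex.exp (-(t ^ 2 * V / 2 : ℝ)))) := by
  choose lam hlaw hbound using fun n => exists_law_quadraticForm (hZ n) (hA n)
  have hQm : ∀ n, AEMeasurable (fun ω => ∑ i, ∑ j, A n i j * (Z n i ω * Z n j ω)) P := fun n =>
    (HasAllMoments.finset_sum (fun i _ => HasAllMoments.finset_sum fun j _ =>
      (((hZ n).hasAllMoments i).mul ((hZ n).hasAllMoments j)).const_mul (A n i j))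
      1 (by simp)).1.aemeasurable
  have hms : ∀ n, Measurable fun x : J n → ℝ => ∑ i, lam n i * x i ^ 2 := fun n =>
    Finset.measurable_fun_sum _ fun i _ => ((measurable_pi_apply i).pow_const 2).const_mul _
  have hlawQ : ∀ n, ∀ f : ℝ → ℂ, Continuous f → ∫ ω, f (Q n ω) ∂P
      = ∫ x, f (∑ i, lam n i * x i ^ 2 - c n) ∂(Measure.pi fun _ : J n => gaussianReal 0 1) :=
    fun n f hf => by
      have h1 : ∫ y, f (y - c n) ∂(P.map fun ω => ∑ i, ∑ j, A n i j * (Z n i ω * Z n j ω))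
          = ∫ ω, f (Q n ω) ∂P := by
        rw [integral_map (hQm n) (by fun_prop)]
        simp_rw [hQ]
      rw [← h1, hlaw, integral_map (hms n).aemeasurable (by fun_prop)]
  have hsq : ∀ n, ∀ i, MemLp (fun x : ℝ => lam n i * x ^ 2) 2 (gaussianReal 0 1) := fun n i =>
    memLp_sq_gaussianReal.const_mul _
  have hint : ∀ n, ∀ i, Integrable (fun x : J n → ℝ => lam n i * x i ^ 2)
      (Measure.pi fun _ : J n => gaussianReal 0 1) := fun n i =>
    integrable_comp_eval (μ := fun _ : J n => gaussianReal 0 1) (i := i)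
      ((hsq n i).integrable (by norm_num))
  -- The centring constant is forced by `E Q = 0`, because every `ξ²` has mean one. Thus `Q` has the
  -- law of `∑ λ (ξ² - 1)`.
  have hc : ∀ n, c n = ∑ i, lam n i := fun n => by
    have h1 := hlawQ n (fun y => (y : ℂ)) Complex.continuous_ofReal
    rw [integral_complex_ofReal, integral_complex_ofReal, hmean,
      integral_sub (integrable_finsetSum _ fun i _ => hint n i) (integrable_const _),
      integral_finsetSum _ fun i _ => hint n i] at h1
    have h2 : ∀ i, ∫ x : J n → ℝ, lam n i * x i ^ 2 ∂(Measure.pi fun _ => gaussianReal 0 1)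
        = lam n i := fun i => by
      rw [integral_const_mul, integral_comp_eval (μ := fun _ : J n => gaussianReal 0 1) (i := i)
        (f := fun y : ℝ => y ^ 2) (by fun_prop), integral_sq_gaussianReal_one, mul_one]
    simp_rw [h2] at h1
    simp only [integral_const, probReal_univ, one_smul] at h1
    have h3 : (0 : ℝ) = ∑ i, lam n i - c n := by exact_mod_cast h1
    linarith
  have hvar : ∀ n, ∫ ω, Q n ω ^ 2 ∂P = 2 * ∑ k, lam n k ^ 2 := fun n => by
    have h1 := hlawQ n (fun y => ((y ^ 2 : ℝ) : ℂ)) (by fun_prop)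
    rw [integral_complex_ofReal, integral_complex_ofReal] at h1
    have h2 := variance_sum_pi (hsq n)
    rw [Finset.sum_fn, variance_eq_integral (hms n).aemeasurable] at h2
    simp only [variance_const_mul, variance_sq_gaussianReal_one] at h2
    have h3 : ∫ x : J n → ℝ, ∑ i, lam n i * x i ^ 2 ∂(Measure.pi fun _ => gaussianReal 0 1)
        = c n := by
      rw [integral_finsetSum _ fun i _ => hint n i, hc]
      refine Finset.sum_congr rfl fun i _ => ?_
      rw [integral_const_mul, integral_comp_eval (μ := fun _ : J n => gaussianReal 0 1) (i := i)
        (f := fun y : ℝ => y ^ 2) (by fun_prop), integral_sq_gaussianReal_one, mul_one]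
    simp_rw [h3] at h2
    rw [Complex.ofReal_inj.1 h1, h2, ← Finset.sum_mul, mul_comm]
  have hchar : ∀ n, charFun (P.map (Q n)) t = ∏ k, charFun centredChiSq (t * lam n k) :=
    fun n => by
      have hQm' : AEMeasurable (Q n) P := by
        rw [funext (hQ n)]
        exact (hQm n).sub_const _
      rw [charFun_apply_real, integral_map hQm' (by fun_prop),
        hlawQ n (fun y => Complex.exp (t * y * Complex.I)) (by fun_prop)]
      have h1 : ∀ k, charFun centredChiSq (t * lam n k)
          = ∫ y, Complex.exp (t * (lam n k * (y ^ 2 - 1)) * Complex.I) ∂(gaussianReal 0 1) :=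
        fun k => by
          rw [centredChiSq, charFun_apply_real, integral_map (by fun_prop) (by fun_prop)]
          refine integral_congr_ae (ae_of_all _ fun y => ?_)
          simp only
          push_cast
          congr 2
          ring
      simp_rw [h1]
      rw [← integral_fintype_prod_eq_prod (μ := fun _ : J n => gaussianReal 0 1)
        (f := fun k (y : ℝ) => Complex.exp (t * (lam n k * (y ^ 2 - 1)) * Complex.I))]
      refine integral_congr_ae (ae_of_all _ fun x => ?_)
      simp only
      rw [← Complex.exp_sum, hc, ← Finset.sum_sub_distrib]
      congr 1
      push_cast
      rw [Finset.mul_sum, Finset.sum_mul]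
      exact Finset.sum_congr rfl fun k _ => by ring
  simp_rw [hchar]
  refine tendsto_prod_charFun_centredChiSq hαβ ?_ (by simpa only [← hvar] using hV) t
  filter_upwards [hα0, hα, hβ] with n h0 h1 h2
  exact hbound n _ _ h0 h1 h2

end CLT

end SpectralCLT

namespace SpectralCLT

/-! ### Sums over a window of a sequence indexed by the integers -/

section Window

theorem sum_sub_le {w : ℤ → ℝ} (hw : ∀ d, 0 ≤ w d) {n : ℕ} {j : ℕ} (hj : j ∈ Finset.Icc 1 n) :
    ∑ j' ∈ Finset.Icc 1 n, w ((j : ℤ) - j') ≤ ∑ r ∈ Finset.Icc (-(n : ℤ)) n, w r := by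
  rw [← Finset.sum_image (f := w) (g := fun j' : ℕ => (j : ℤ) - j') (s := Finset.Icc 1 n)]
  · refine Finset.sum_le_sum_of_subset_of_nonneg ?_ fun d _ _ => hw d
    intro d hd
    obtain ⟨j', hj', rfl⟩ := Finset.mem_image.1 hd
    rw [Finset.mem_Icc] at *
    omega
  · intro a _ b _ hab
    simpa using hab

theorem sum_sub_le_of_bound {w : ℤ → ℝ} {M : ℝ}
    (hM : ∀ s : Finset ℤ, ∑ d ∈ s, w d ≤ M) (n : ℕ) (j : ℤ) :
    ∑ j' ∈ Finset.Icc 1 n, w (j - (j' : ℤ)) ≤ M := by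
  rw [← Finset.sum_image (f := w) (g := fun j' : ℕ => j - (j' : ℤ)) (s := Finset.Icc 1 n)]
  · exact hM _
  · intro a _ b _ hab
    simpa using hab

theorem sum_sub_le_of_bound' {w : ℤ → ℝ} {M : ℝ}
    (hM : ∀ s : Finset ℤ, ∑ d ∈ s, w d ≤ M) (n : ℕ) (j : ℤ) :
    ∑ i ∈ Finset.Icc 1 n, w ((i : ℤ) - j) ≤ M := by
  rw [← Finset.sum_image (f := w) (g := fun i : ℕ => (i : ℤ) - j) (s := Finset.Icc 1 n)]
  · exact hM _
  · intro a _ b _ hab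
    simpa using hab

theorem norm_sum_sub_le {γ : ℤ → ℂ} {Γ : ℂ} (hγ : HasSum γ Γ) {s : Finset ℤ} {b : ℝ}
    (hb : ∀ t : Finset ℤ, Disjoint t s → ∑ d ∈ t, ‖γ d‖ ≤ b) : ‖∑ d ∈ s, γ d - Γ‖ ≤ b := by
  have h1 : Tendsto (fun t : Finset ℤ => ‖∑ d ∈ s, γ d - ∑ d ∈ t, γ d‖) atTop
      (𝓝 ‖∑ d ∈ s, γ d - Γ‖) := (tendsto_const_nhds.sub hγ).norm
  refine le_of_tendsto h1 ?_
  filter_upwards [eventually_ge_atTop s] with t ht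
  rw [norm_sub_rev, ← Finset.sum_sdiff ht, add_sub_cancel_right]
  exact (norm_sum_le _ _).trans (hb _ Finset.sdiff_disjoint)

/-- Truncated convolution sums are close to the full sum away from the edges. -/
theorem sum_norm_window_sub_le {γ : ℤ → ℂ} {Γ : ℂ} (hγ : HasSum γ Γ) {M τ L : ℝ} (hL : 0 ≤ L)
    (hM : ∀ s : Finset ℤ, ∑ d ∈ s, ‖γ d‖ ≤ M)
    (hτ : ∀ s : Finset ℤ, (∀ d ∈ s, L < |(d : ℝ)|) → ∑ d ∈ s, ‖γ d‖ ≤ τ) (n : ℕ) :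
    ∑ i ∈ Finset.Icc 1 n, ‖∑ j ∈ Finset.Icc 1 n, γ ((i : ℤ) - j) - Γ‖ ≤ n * τ + (2 * L + 1) * M := by
  classical
  have hM0 : 0 ≤ M := by simpa using hM ∅
  have hτ0 : 0 ≤ τ := by simpa using hτ ∅ (by simp)
  have himg : ∀ i : ℕ, ∑ j ∈ Finset.Icc 1 n, γ ((i : ℤ) - j)
      = ∑ d ∈ (Finset.Icc 1 n).image (fun j : ℕ => (i : ℤ) - j), γ d := fun i => by
    rw [Finset.sum_image]
    intro a _ b _ hab
    simpa using hab
  -- Away from the edges all lags with `|d| ≤ L` occur in the window and only the tail `τ` is lost.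
  -- Indices within `L` of an edge lose at most the full mass `M`.
  have hterm : ∀ i ∈ Finset.Icc 1 n, ‖∑ j ∈ Finset.Icc 1 n, γ ((i : ℤ) - j) - Γ‖
      ≤ τ + ((if (i : ℝ) ≤ L then M else 0) + (if (n : ℝ) - L < i then M else 0)) := by
    intro i hi
    rw [himg]
    by_cases h1 : (i : ℝ) ≤ L
    · refine (norm_sum_sub_le hγ fun t _ => hM t).trans ?_
      rw [if_pos h1]
      split_ifs <;> linarith
    by_cases h2 : (n : ℝ) - L < i
    · refine (norm_sum_sub_le hγ fun t _ => hM t).trans ?_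
      rw [if_pos h2, if_neg h1]
      linarith
    rw [if_neg h1, if_neg h2]
    simp only [add_zero]
    refine norm_sum_sub_le hγ fun t ht => hτ t fun d hd => ?_
    by_contra hcon
    rw [not_lt, abs_le] at hcon
    refine Finset.disjoint_left.1 ht hd (Finset.mem_image.2 ⟨((i : ℤ) - d).toNat, ?_, ?_⟩)
    · have h4 : (0 : ℝ) < ((i : ℤ) - d : ℤ) := by push_cast; linarith
      have h5 : (((i : ℤ) - d : ℤ) : ℝ) ≤ (n : ℤ) := by push_cast; linarith
      have h4' : 0 < (i : ℤ) - d := by exact_mod_cast h4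
      have h5' : (i : ℤ) - d ≤ n := by exact_mod_cast h5
      rw [Finset.mem_Icc]
      omega
    · have h4 : (0 : ℝ) < ((i : ℤ) - d : ℤ) := by push_cast; linarith
      have h4' : 0 < (i : ℤ) - d := by exact_mod_cast h4
      omega
  refine (Finset.sum_le_sum hterm).trans ?_
  rw [Finset.sum_add_distrib, Finset.sum_add_distrib, Finset.sum_const, Nat.card_Icc,
    add_tsub_cancel_right, nsmul_eq_mul, ← Finset.sum_filter, ← Finset.sum_filter,
    Finset.sum_const, Finset.sum_const, nsmul_eq_mul, nsmul_eq_mul]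
  have c1 : (((Finset.Icc 1 n).filter fun i : ℕ => (i : ℝ) ≤ L).card : ℝ) ≤ L := by
    have : (Finset.Icc 1 n).filter (fun i : ℕ => (i : ℝ) ≤ L) ⊆ Finset.Icc 1 ⌊L⌋₊ := fun i hi => by
      rw [Finset.mem_filter, Finset.mem_Icc] at hi
      exact Finset.mem_Icc.2 ⟨hi.1.1, Nat.le_floor hi.2⟩
    have h2 := Finset.card_le_card this
    rw [Nat.card_Icc, add_tsub_cancel_right] at h2
    exact (Nat.cast_le.2 h2).trans (Nat.floor_le hL)
  have c2 : (((Finset.Icc 1 n).filter fun i : ℕ => (n : ℝ) - L < i).card : ℝ) ≤ L + 1 := by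
    have h2 : ((Finset.Icc 1 n).filter fun i : ℕ => (n : ℝ) - L < i).card
        ≤ (Finset.range ⌈L⌉₊).card := by
      refine Finset.card_le_card_of_injOn (fun i => n - i) ?_ ?_
      · intro i hi
        have hi' := Finset.mem_filter.1 (Finset.mem_coe.1 hi)
        rw [Finset.mem_Icc] at hi'
        refine Finset.mem_coe.2 (Finset.mem_range.2 (Nat.lt_ceil.2 ?_))
        rw [Nat.cast_sub hi'.1.2]
        linarith [hi'.2]
      · intro a ha b hb hab
        have ha' := Finset.mem_Icc.1 (Finset.mem_filter.1 (Finset.mem_coe.1 ha)).1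
        have hb' := Finset.mem_Icc.1 (Finset.mem_filter.1 (Finset.mem_coe.1 hb)).1
        simp only at hab
        omega
    rw [Finset.card_range] at h2
    exact (Nat.cast_le.2 h2).trans (Nat.ceil_lt_add_one hL).le
  have e1 := mul_le_mul_of_nonneg_right c1 hM0
  have e2 := mul_le_mul_of_nonneg_right c2 hM0
  linarith

end Window

/-! ### Quadruple sums with a lag window -/

section QuadSum

/-- The quadruple sums which give the second moments of a lag window estimator. -/
noncomputable def quadSum (n : ℕ) (κ k γ₁ γ₂ : ℤ → ℂ) : ℂ :=
  ∑ i ∈ Finset.Icc 1 n, ∑ j ∈ Finset.Icc 1 n, ∑ i' ∈ Finset.Icc 1 n, ∑ j' ∈ Finset.Icc 1 n,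
    κ ((i : ℤ) - j) * k ((i' : ℤ) - j') * (γ₁ ((i : ℤ) - i') * γ₂ ((j : ℤ) - j'))

variable {κ γ₁ γ₂ : ℤ → ℂ} {k : ℤ → ℝ} {B C T N L M₁ M₂ τ₁ τ₂ : ℝ}

/-- The second weight is bounded by `B`, which frees `i'` and `j'` to be summed separately, giving
`M₁ M₂`. The first weight then contributes `n * C`. -/
theorem norm_quadSum_le (hk0 : ∀ d, 0 ≤ k d) (hkB : ∀ d, k d ≤ B)
    (hkC : ∀ s : Finset ℤ, ∑ d ∈ s, k d ≤ C) (hκ : ∀ d, ‖κ d‖ ≤ k d) {k' : ℤ → ℂ}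
    (hk' : ∀ d, ‖k' d‖ ≤ k d)
    (hM₁ : ∀ s : Finset ℤ, ∑ d ∈ s, ‖γ₁ d‖ ≤ M₁) (hM₂ : ∀ s : Finset ℤ, ∑ d ∈ s, ‖γ₂ d‖ ≤ M₂)
    (n : ℕ) : ‖quadSum n κ k' γ₁ γ₂‖ ≤ n * C * B * (M₁ * M₂) := by
  have hB0 : 0 ≤ B := (hk0 0).trans (hkB 0)
  have hM₁0 : 0 ≤ M₁ := by simpa using hM₁ ∅
  have hM₂0 : 0 ≤ M₂ := by simpa using hM₂ ∅
  calc ‖quadSum n κ k' γ₁ γ₂‖ ≤ ∑ i ∈ Finset.Icc 1 n, ∑ j ∈ Finset.Icc 1 n,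
        ∑ i' ∈ Finset.Icc 1 n, ∑ j' ∈ Finset.Icc 1 n,
        k ((i : ℤ) - j) * B * (‖γ₁ ((i : ℤ) - i')‖ * ‖γ₂ ((j : ℤ) - j')‖) := by
        refine (norm_sum_le _ _).trans (Finset.sum_le_sum fun i _ => ?_)
        refine (norm_sum_le _ _).trans (Finset.sum_le_sum fun j _ => ?_)
        refine (norm_sum_le _ _).trans (Finset.sum_le_sum fun i' _ => ?_)
        refine (norm_sum_le _ _).trans (Finset.sum_le_sum fun j' _ => ?_)
        rw [norm_mul, norm_mul, norm_mul]
        gcongr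
        · exact hk0 _
        · exact hκ _
        · exact (hk' _).trans (hkB _)
    _ = ∑ i ∈ Finset.Icc 1 n, ∑ j ∈ Finset.Icc 1 n, k ((i : ℤ) - j) * B *
        ((∑ i' ∈ Finset.Icc 1 n, ‖γ₁ ((i : ℤ) - i')‖) *
          ∑ j' ∈ Finset.Icc 1 n, ‖γ₂ ((j : ℤ) - j')‖) := by
        simp_rw [Finset.sum_mul_sum, Finset.mul_sum]
    _ ≤ ∑ i ∈ Finset.Icc 1 n, ∑ j ∈ Finset.Icc 1 n, k ((i : ℤ) - j) * B * (M₁ * M₂) := by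
        refine Finset.sum_le_sum fun i _ => Finset.sum_le_sum fun j _ => ?_
        have h1 := sum_sub_le_of_bound hM₁ n (i : ℤ)
        have h2 := sum_sub_le_of_bound hM₂ n (j : ℤ)
        have := hk0 ((i : ℤ) - j)
        gcongr
    _ ≤ ∑ i ∈ Finset.Icc 1 n, C * B * (M₁ * M₂) := by
        refine Finset.sum_le_sum fun i _ => ?_
        rw [← Finset.sum_mul, ← Finset.sum_mul]
        have := sum_sub_le_of_bound hkC n (i : ℤ)
        gcongr
    _ = _ := by
        rw [Finset.sum_const, Nat.card_Icc, add_tsub_cancel_right, nsmul_eq_mul]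
        ring

/-- The arguments of the two windows differ by `(j - j') - (i - i')`. If both lags are at most `L`,
the shift is at most `2L`, and the variation bound controls the sum of the increments of `k` by
`2LT`. Otherwise one of the sequences is in its tail, which costs `τ₁` or `τ₂`. -/
theorem norm_quadSum_sub_le₁ (hk0 : ∀ d, 0 ≤ k d) (hkB : ∀ d, k d ≤ B)
    (hkC : ∀ s : Finset ℤ, ∑ d ∈ s, k d ≤ C)
    (hkT : ∀ (s : Finset ℤ) (q : ℤ), ∑ d ∈ s, |k (d + q) - k d| ≤ |(q : ℝ)| * T) (hT : 0 ≤ T)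
    (hL : 0 ≤ L) (hκ : ∀ d, ‖κ d‖ ≤ k d)
    (hM₁ : ∀ s : Finset ℤ, ∑ d ∈ s, ‖γ₁ d‖ ≤ M₁) (hM₂ : ∀ s : Finset ℤ, ∑ d ∈ s, ‖γ₂ d‖ ≤ M₂)
    (hτ₁ : ∀ s : Finset ℤ, (∀ d ∈ s, L < |(d : ℝ)|) → ∑ d ∈ s, ‖γ₁ d‖ ≤ τ₁)
    (hτ₂ : ∀ s : Finset ℤ, (∀ d ∈ s, L < |(d : ℝ)|) → ∑ d ∈ s, ‖γ₂ d‖ ≤ τ₂) (n : ℕ) :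
    ‖quadSum n κ (fun d => k d) γ₁ γ₂ - ∑ i ∈ Finset.Icc 1 n, ∑ j ∈ Finset.Icc 1 n,
        κ ((i : ℤ) - j) * k ((i : ℤ) - j) * ((∑ i' ∈ Finset.Icc 1 n, γ₁ ((i : ℤ) - i')) *
          ∑ j' ∈ Finset.Icc 1 n, γ₂ ((j : ℤ) - j'))‖
      ≤ n * (B * (2 * L * T) * (M₁ * M₂)) + n * C * B * (τ₁ * M₂ + M₁ * τ₂) := by
  classical
  have hB0 : 0 ≤ B := (hk0 0).trans (hkB 0)
  have hC0 : 0 ≤ C := by simpa using hkC ∅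
  have hM₁0 : 0 ≤ M₁ := by simpa using hM₁ ∅
  have hM₂0 : 0 ≤ M₂ := by simpa using hM₂ ∅
  have hτ₁0 : 0 ≤ τ₁ := by simpa using hτ₁ ∅ (by simp)
  have hτ₂0 : 0 ≤ τ₂ := by simpa using hτ₂ ∅ (by simp)
  set S := Finset.Icc 1 n with hS
  -- Splitting of the absolute values at lag `L`: `u₁`, `u₂` are the tails and `v₁`, `v₂` the bulk.
  let u₁ : ℤ → ℝ := fun d => if L < |(d : ℝ)| then ‖γ₁ d‖ else 0
  let u₂ : ℤ → ℝ := fun d => if L < |(d : ℝ)| then ‖γ₂ d‖ else 0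
  let v₁ : ℤ → ℝ := fun d => if L < |(d : ℝ)| then 0 else ‖γ₁ d‖
  let v₂ : ℤ → ℝ := fun d => if L < |(d : ℝ)| then 0 else ‖γ₂ d‖
  have hu₁ : ∀ s : Finset ℤ, ∑ d ∈ s, u₁ d ≤ τ₁ := fun s => by
    rw [← Finset.sum_filter]
    exact hτ₁ _ fun d hd => (Finset.mem_filter.1 hd).2
  have hu₂ : ∀ s : Finset ℤ, ∑ d ∈ s, u₂ d ≤ τ₂ := fun s => by
    rw [← Finset.sum_filter]
    exact hτ₂ _ fun d hd => (Finset.mem_filter.1 hd).2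
  have hu₁0 : ∀ d, 0 ≤ u₁ d := fun d => by simp only [u₁]; split_ifs <;> simp
  have hu₂0 : ∀ d, 0 ≤ u₂ d := fun d => by simp only [u₂]; split_ifs <;> simp
  have hv₁0 : ∀ d, 0 ≤ v₁ d := fun d => by simp only [v₁]; split_ifs <;> simp
  have hv₂0 : ∀ d, 0 ≤ v₂ d := fun d => by simp only [v₂]; split_ifs <;> simp
  have hv₁ : ∀ s : Finset ℤ, ∑ d ∈ s, v₁ d ≤ M₁ := fun s =>
    (Finset.sum_le_sum fun d _ => by simp only [v₁]; split_ifs <;> simp).trans (hM₁ s)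
  have hv₂ : ∀ s : Finset ℤ, ∑ d ∈ s, v₂ d ≤ M₂ := fun s =>
    (Finset.sum_le_sum fun d _ => by simp only [v₂]; split_ifs <;> simp).trans (hM₂ s)
  let D : ℤ → ℤ → ℝ := fun d q => |k (d + q) - k d|
  have hdiff : quadSum n κ (fun d => k d) γ₁ γ₂ - ∑ i ∈ S, ∑ j ∈ S,
        κ ((i : ℤ) - j) * k ((i : ℤ) - j) * ((∑ i' ∈ S, γ₁ ((i : ℤ) - i')) *
          ∑ j' ∈ S, γ₂ ((j : ℤ) - j'))
      = ∑ i ∈ S, ∑ j ∈ S, ∑ i' ∈ S, ∑ j' ∈ S, κ ((i : ℤ) - j) *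
        (k ((i' : ℤ) - j') - k ((i : ℤ) - j)) * (γ₁ ((i : ℤ) - i') * γ₂ ((j : ℤ) - j')) := by
    rw [quadSum]
    simp_rw [Finset.sum_mul_sum]
    rw [← Finset.sum_sub_distrib]
    refine Finset.sum_congr rfl fun i _ => ?_
    rw [← Finset.sum_sub_distrib]
    refine Finset.sum_congr rfl fun j _ => ?_
    rw [Finset.mul_sum, ← Finset.sum_sub_distrib]
    refine Finset.sum_congr rfl fun i' _ => ?_
    rw [Finset.mul_sum, ← Finset.sum_sub_distrib]
    refine Finset.sum_congr rfl fun j' _ => ?_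
    ring
  have hpt : ∀ i j i' j' : ℕ, ‖κ ((i : ℤ) - j) *
        (k ((i' : ℤ) - j') - k ((i : ℤ) - j)) * (γ₁ ((i : ℤ) - i') * γ₂ ((j : ℤ) - j'))‖
      ≤ B * (D ((i : ℤ) - j) (((j : ℤ) - j') - ((i : ℤ) - i')) *
          (v₁ ((i : ℤ) - i') * v₂ ((j : ℤ) - j'))) +
        k ((i : ℤ) - j) * B * (u₁ ((i : ℤ) - i') * ‖γ₂ ((j : ℤ) - j')‖ +
          ‖γ₁ ((i : ℤ) - i')‖ * u₂ ((j : ℤ) - j')) := by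
    intro i j i' j'
    have e1 : ((i' : ℤ) - j') = ((i : ℤ) - j) + (((j : ℤ) - j') - ((i : ℤ) - i')) := by ring
    rw [norm_mul, norm_mul, norm_mul, e1]
    generalize ((j : ℤ) - j') - ((i : ℤ) - i') = q
    generalize (i : ℤ) - j = d
    generalize (i : ℤ) - i' = s
    generalize (j : ℤ) - j' = r
    have hD : ‖((k (d + q) : ℂ)) - k d‖ = D d q := by
      rw [← Complex.ofReal_sub, Complex.norm_real, Real.norm_eq_abs]
    rw [hD]
    have hD0 : 0 ≤ D d q := abs_nonneg _
    have hDB : D d q ≤ B := abs_sub_le_iff.2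
      ⟨by linarith [hkB (d + q), hk0 d], by linarith [hkB d, hk0 (d + q)]⟩
    have b1 : ‖κ d‖ * D d q * (‖γ₁ s‖ * ‖γ₂ r‖) ≤ B * (D d q * (‖γ₁ s‖ * ‖γ₂ r‖)) := by
      rw [mul_assoc]
      gcongr
      exact (hκ d).trans (hkB d)
    have b2 : ‖κ d‖ * D d q * (‖γ₁ s‖ * ‖γ₂ r‖) ≤ k d * B * (‖γ₁ s‖ * ‖γ₂ r‖) := by
      have := hκ d
      have := hk0 d
      gcongr
    have p0 := hk0 d
    have hx : 0 ≤ k d * B * (‖γ₁ s‖ * ‖γ₂ r‖) := by positivity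
    by_cases h1 : L < |(s : ℝ)|
    · have hs : u₁ s = ‖γ₁ s‖ := if_pos h1
      have hs' : v₁ s = 0 := if_pos h1
      rw [hs, hs']
      have := mul_nonneg (mul_nonneg p0 hB0) (mul_nonneg (norm_nonneg (γ₁ s)) (hu₂0 r))
      rw [zero_mul, mul_zero, mul_zero, zero_add, mul_add]
      linarith
    · have hs : u₁ s = 0 := if_neg h1
      have hs' : v₁ s = ‖γ₁ s‖ := if_neg h1
      rw [hs, hs']
      by_cases h2 : L < |(r : ℝ)|
      · have hr : u₂ r = ‖γ₂ r‖ := if_pos h2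
        have hr' : v₂ r = 0 := if_pos h2
        rw [hr, hr', mul_zero, mul_zero, mul_zero, zero_mul, zero_add, zero_add]
        exact b2
      · have hr : u₂ r = 0 := if_neg h2
        have hr' : v₂ r = ‖γ₂ r‖ := if_neg h2
        rw [hr, hr']
        simpa using b1
  rw [hdiff]
  calc _ ≤ ∑ i ∈ S, ∑ j ∈ S, ∑ i' ∈ S, ∑ j' ∈ S,
        (B * (D ((i : ℤ) - j) (((j : ℤ) - j') - ((i : ℤ) - i')) *
          (v₁ ((i : ℤ) - i') * v₂ ((j : ℤ) - j'))) +
        k ((i : ℤ) - j) * B * (u₁ ((i : ℤ) - i') * ‖γ₂ ((j : ℤ) - j')‖ +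
          ‖γ₁ ((i : ℤ) - i')‖ * u₂ ((j : ℤ) - j'))) := by
        refine (norm_sum_le _ _).trans (Finset.sum_le_sum fun i _ => ?_)
        refine (norm_sum_le _ _).trans (Finset.sum_le_sum fun j _ => ?_)
        refine (norm_sum_le _ _).trans (Finset.sum_le_sum fun i' _ => ?_)
        refine (norm_sum_le _ _).trans (Finset.sum_le_sum fun j' _ => ?_)
        exact hpt i j i' j'
    _ = ∑ i ∈ S, ∑ i' ∈ S, v₁ ((i : ℤ) - i') * (B * ∑ j ∈ S, ∑ j' ∈ S,
          D ((i : ℤ) - j) (((j : ℤ) - j') - ((i : ℤ) - i')) * v₂ ((j : ℤ) - j')) +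
        ∑ i ∈ S, ∑ j ∈ S, k ((i : ℤ) - j) * B *
          ((∑ i' ∈ S, u₁ ((i : ℤ) - i')) * (∑ j' ∈ S, ‖γ₂ ((j : ℤ) - j')‖) +
            (∑ i' ∈ S, ‖γ₁ ((i : ℤ) - i')‖) * ∑ j' ∈ S, u₂ ((j : ℤ) - j')) := by
        simp_rw [Finset.sum_mul_sum]
        simp only [Finset.sum_add_distrib, Finset.mul_sum, mul_add]
        congr 1
        refine Finset.sum_congr rfl fun i _ => ?_
        rw [Finset.sum_comm]
        refine Finset.sum_congr rfl fun i' _ => Finset.sum_congr rfl fun j _ =>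
          Finset.sum_congr rfl fun j' _ => ?_
        ring
    _ ≤ ∑ i ∈ S, M₁ * (B * (2 * L * T * M₂)) + ∑ i ∈ S, C * B * (τ₁ * M₂ + M₁ * τ₂) := by
        refine add_le_add (Finset.sum_le_sum fun i _ => ?_) (Finset.sum_le_sum fun i _ => ?_)
        · have hin : ∀ i' ∈ S, v₁ ((i : ℤ) - i') * (B * ∑ j ∈ S, ∑ j' ∈ S,
              D ((i : ℤ) - j) (((j : ℤ) - j') - ((i : ℤ) - i')) * v₂ ((j : ℤ) - j'))
              ≤ v₁ ((i : ℤ) - i') * (B * (2 * L * T * M₂)) := by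
            intro i' _
            by_cases h1 : L < |(((i : ℤ) - i' : ℤ) : ℝ)|
            · have : v₁ ((i : ℤ) - i') = 0 := if_pos h1
              rw [this, zero_mul, zero_mul]
            refine mul_le_mul_of_nonneg_left (mul_le_mul_of_nonneg_left ?_ hB0) (hv₁0 _)
            set s : ℤ := (i : ℤ) - i' with hs
            -- Once the lag `r = j - j'` is made a free variable in `[-n, n]`, the sum over `j` runs
            -- over increments of `k` with the fixed shift `r - s`, to which `hkT` applies.
            calc ∑ j ∈ S, ∑ j' ∈ S, D ((i : ℤ) - j) (((j : ℤ) - j') - s) * v₂ ((j : ℤ) - j')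
                ≤ ∑ j ∈ S, ∑ r ∈ Finset.Icc (-(n : ℤ)) n, D ((i : ℤ) - j) (r - s) * v₂ r :=
                  Finset.sum_le_sum fun j hj =>
                    sum_sub_le (w := fun r => D ((i : ℤ) - j) (r - s) * v₂ r)
                      (fun r => mul_nonneg (abs_nonneg _) (hv₂0 r)) hj
              _ = ∑ r ∈ Finset.Icc (-(n : ℤ)) n, (∑ j ∈ S, D ((i : ℤ) - j) (r - s)) * v₂ r := by
                  rw [Finset.sum_comm]
                  simp_rw [Finset.sum_mul]
              _ ≤ ∑ r ∈ Finset.Icc (-(n : ℤ)) n, 2 * L * T * v₂ r := by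
                  refine Finset.sum_le_sum fun r _ => ?_
                  by_cases h2 : L < |(r : ℝ)|
                  · have : v₂ r = 0 := if_pos h2
                    rw [this, mul_zero, mul_zero]
                  refine mul_le_mul_of_nonneg_right ?_ (hv₂0 r)
                  refine (sum_sub_le_of_bound (fun t => hkT t (r - s)) n (i : ℤ)).trans ?_
                  refine mul_le_mul_of_nonneg_right ?_ hT
                  push_cast [hs] at h1 ⊢
                  rw [not_lt] at h1 h2
                  calc |(r : ℝ) - ((i : ℝ) - i')| ≤ |(r : ℝ)| + |(i : ℝ) - i'| := abs_sub _ _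
                    _ ≤ 2 * L := by linarith
              _ ≤ 2 * L * T * M₂ := by
                  rw [← Finset.mul_sum]
                  exact mul_le_mul_of_nonneg_left (hv₂ _) (by positivity)
          refine (Finset.sum_le_sum hin).trans ?_
          rw [← Finset.sum_mul]
          exact mul_le_mul_of_nonneg_right (sum_sub_le_of_bound hv₁ n (i : ℤ)) (by positivity)
        · have hin : ∀ j ∈ S, k ((i : ℤ) - j) * B *
              ((∑ i' ∈ S, u₁ ((i : ℤ) - i')) * (∑ j' ∈ S, ‖γ₂ ((j : ℤ) - j')‖) +
                (∑ i' ∈ S, ‖γ₁ ((i : ℤ) - i')‖) * ∑ j' ∈ S, u₂ ((j : ℤ) - j'))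
              ≤ k ((i : ℤ) - j) * B * (τ₁ * M₂ + M₁ * τ₂) := by
            intro j _
            have a1 := sum_sub_le_of_bound hu₁ n (i : ℤ)
            have a2 := sum_sub_le_of_bound hM₂ n (j : ℤ)
            have a3 := sum_sub_le_of_bound hM₁ n (i : ℤ)
            have a4 := sum_sub_le_of_bound hu₂ n (j : ℤ)
            have a5 : 0 ≤ ∑ j' ∈ S, u₂ ((j : ℤ) - j') := Finset.sum_nonneg fun _ _ => hu₂0 _
            have := hk0 ((i : ℤ) - j)
            gcongr
          refine (Finset.sum_le_sum hin).trans ?_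
          rw [← Finset.sum_mul, ← Finset.sum_mul]
          have := sum_sub_le_of_bound hkC n (i : ℤ)
          gcongr
    _ = _ := by
        simp only [hS, Finset.sum_const, Nat.card_Icc, add_tsub_cancel_right, nsmul_eq_mul]
        ring

/-- Three replacements by full sums: the inner sums by `Γ₁` and `Γ₂`, and the window sum over `j` by
`G`. Each is a truncated convolution, accurate away from the edges; for `g` the tail beyond `N`
vanishes. -/
theorem norm_window_sub_le {g : ℤ → ℂ} {G : ℂ} (hg : HasSum g G)
    (hgk : ∀ d, ‖g d‖ ≤ B * k d) (hB : 0 ≤ B) (hkC : ∀ s : Finset ℤ, ∑ d ∈ s, k d ≤ C)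
    (hkN : ∀ d : ℤ, N < |(d : ℝ)| → k d = 0) (hN : 0 ≤ N) (hL : 0 ≤ L)
    {Γ₁ Γ₂ : ℂ} (hΓ₁ : HasSum γ₁ Γ₁) (hΓ₂ : HasSum γ₂ Γ₂)
    (hM₁ : ∀ s : Finset ℤ, ∑ d ∈ s, ‖γ₁ d‖ ≤ M₁) (hM₂ : ∀ s : Finset ℤ, ∑ d ∈ s, ‖γ₂ d‖ ≤ M₂)
    (hτ₁ : ∀ s : Finset ℤ, (∀ d ∈ s, L < |(d : ℝ)|) → ∑ d ∈ s, ‖γ₁ d‖ ≤ τ₁)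
    (hτ₂ : ∀ s : Finset ℤ, (∀ d ∈ s, L < |(d : ℝ)|) → ∑ d ∈ s, ‖γ₂ d‖ ≤ τ₂) (n : ℕ) :
    ‖∑ i ∈ Finset.Icc 1 n, ∑ j ∈ Finset.Icc 1 n,
        g ((i : ℤ) - j) * ((∑ i' ∈ Finset.Icc 1 n, γ₁ ((i : ℤ) - i')) *
          ∑ j' ∈ Finset.Icc 1 n, γ₂ ((j : ℤ) - j')) - n * G * (Γ₁ * Γ₂)‖
      ≤ B * C * (M₂ * (n * τ₁ + (2 * L + 1) * M₁) + M₁ * (n * τ₂ + (2 * L + 1) * M₂)) +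
        (2 * N + 1) * (B * C) * (M₁ * M₂) := by
  have hM₁0 : 0 ≤ M₁ := by simpa using hM₁ ∅
  have hM₂0 : 0 ≤ M₂ := by simpa using hM₂ ∅
  have hC0 : 0 ≤ C := by simpa using hkC ∅
  have hgC : ∀ s : Finset ℤ, ∑ d ∈ s, ‖g d‖ ≤ B * C := fun s =>
    (Finset.sum_le_sum fun d _ => hgk d).trans (by
      rw [← Finset.mul_sum]; exact mul_le_mul_of_nonneg_left (hkC s) hB)
  have hΓ₁M : ‖Γ₁‖ ≤ M₁ := by
    have := norm_sum_sub_le hΓ₁ (s := ∅) fun t _ => hM₁ t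
    simpa using this
  have hΓ₂M : ‖Γ₂‖ ≤ M₂ := by
    have := norm_sum_sub_le hΓ₂ (s := ∅) fun t _ => hM₂ t
    simpa using this
  set S := Finset.Icc 1 n with hS
  set G₁ : ℕ → ℂ := fun i => ∑ i' ∈ S, γ₁ ((i : ℤ) - i') with hG₁
  set G₂ : ℕ → ℂ := fun j => ∑ j' ∈ S, γ₂ ((j : ℤ) - j') with hG₂
  have hG₂M : ∀ j, ‖G₂ j‖ ≤ M₂ := fun j =>
    (norm_sum_le _ _).trans (sum_sub_le_of_bound hM₂ n (j : ℤ))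
  have e1 := sum_norm_window_sub_le hΓ₁ hL hM₁ hτ₁ n
  have e2 := sum_norm_window_sub_le hΓ₂ hL hM₂ hτ₂ n
  have e3 := sum_norm_window_sub_le hg hN hgC (τ := 0) (fun s hs => by
    refine (Finset.sum_eq_zero fun d hd => ?_).le
    have := hgk d
    rw [hkN d (hs d hd), mul_zero] at this
    exact le_antisymm this (norm_nonneg _)) n
  have hsplit : ∑ i ∈ S, ∑ j ∈ S, g ((i : ℤ) - j) * (G₁ i * G₂ j) - n * G * (Γ₁ * Γ₂)
      = ∑ i ∈ S, ∑ j ∈ S, g ((i : ℤ) - j) * ((G₁ i - Γ₁) * G₂ j) +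
        ∑ i ∈ S, ∑ j ∈ S, g ((i : ℤ) - j) * (Γ₁ * (G₂ j - Γ₂)) +
        (∑ i ∈ S, (∑ j ∈ S, g ((i : ℤ) - j) - G)) * (Γ₁ * Γ₂) := by
    rw [Finset.sum_sub_distrib, Finset.sum_const, hS, Nat.card_Icc, add_tsub_cancel_right,
      nsmul_eq_mul, sub_mul, Finset.sum_mul, ← add_sub_assoc, ← Finset.sum_add_distrib,
      ← Finset.sum_add_distrib]
    congr 1
    refine Finset.sum_congr rfl fun i _ => ?_
    rw [Finset.sum_mul, ← Finset.sum_add_distrib, ← Finset.sum_add_distrib]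
    exact Finset.sum_congr rfl fun j _ => by ring
  rw [hsplit]
  refine (norm_add_le _ _).trans (add_le_add ((norm_add_le _ _).trans ?_) ?_)
  · rw [mul_add]
    refine add_le_add ?_ ?_
    · calc _ ≤ ∑ i ∈ S, ∑ j ∈ S, ‖g ((i : ℤ) - j)‖ * (‖G₁ i - Γ₁‖ * M₂) := by
            refine (norm_sum_le _ _).trans (Finset.sum_le_sum fun i _ => ?_)
            refine (norm_sum_le _ _).trans (Finset.sum_le_sum fun j _ => ?_)
            rw [norm_mul, norm_mul]
            gcongr
            exact hG₂M j
        _ ≤ ∑ i ∈ S, B * C * (‖G₁ i - Γ₁‖ * M₂) := by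
            refine Finset.sum_le_sum fun i _ => ?_
            rw [← Finset.sum_mul]
            exact mul_le_mul_of_nonneg_right
              (sum_sub_le_of_bound (w := fun d => ‖g d‖) hgC n (i : ℤ)) (by positivity)
        _ = B * C * (M₂ * ∑ i ∈ S, ‖G₁ i - Γ₁‖) := by
            simp only [Finset.mul_sum]
            exact Finset.sum_congr rfl fun i _ => by ring
        _ ≤ _ := by gcongr
    · calc _ ≤ ∑ i ∈ S, ∑ j ∈ S, ‖g ((i : ℤ) - j)‖ * (M₁ * ‖G₂ j - Γ₂‖) := by
            refine (norm_sum_le _ _).trans (Finset.sum_le_sum fun i _ => ?_)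
            refine (norm_sum_le _ _).trans (Finset.sum_le_sum fun j _ => ?_)
            rw [norm_mul, norm_mul]
            gcongr
        _ ≤ ∑ j ∈ S, B * C * (M₁ * ‖G₂ j - Γ₂‖) := by
            rw [Finset.sum_comm]
            refine Finset.sum_le_sum fun j _ => ?_
            rw [← Finset.sum_mul]
            exact mul_le_mul_of_nonneg_right
              (sum_sub_le_of_bound' (w := fun d => ‖g d‖) hgC n (j : ℤ)) (by positivity)
        _ = B * C * (M₁ * ∑ j ∈ S, ‖G₂ j - Γ₂‖) := by
            simp only [Finset.mul_sum]
        _ ≤ _ := by gcongr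
  · rw [norm_mul, norm_mul]
    have h1 : ‖∑ i ∈ S, (∑ j ∈ S, g ((i : ℤ) - j) - G)‖ ≤ (2 * N + 1) * (B * C) := by
      refine (norm_sum_le _ _).trans (e3.trans ?_)
      simp
    gcongr

end QuadSum

end SpectralCLT

namespace SpectralCLT

/-! ### Riemann sums of functions of bounded variation -/

/-- The variation of `F` is dominated by the increments of a monotone function, whose total
increment is at most `T`. -/
def HasVariationBound (F : ℝ → ℝ) (T : ℝ) : Prop :=
  ∃ V : ℝ → ℝ, Monotone V ∧ (∀ x y, x ≤ y → |F y - F x| ≤ V y - V x) ∧ ∀ x y, V y - V x ≤ T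

theorem hasVariationBound_of_boundedVariationOn {F : ℝ → ℝ}
    (hF : BoundedVariationOn F Set.univ) :
    HasVariationBound F (eVariationOn F Set.univ).toReal := by
  have hl : LocallyBoundedVariationOn F Set.univ := hF.locallyBoundedVariationOn
  have hm : Monotone (variationOnFromTo F Set.univ 0) := by
    rw [← monotoneOn_univ]
    exact variationOnFromTo.monotoneOn hl (Set.mem_univ _)
  have hadd : ∀ x y, variationOnFromTo F Set.univ 0 y - variationOnFromTo F Set.univ 0 x
      = variationOnFromTo F Set.univ x y := fun x y => by
    rw [← variationOnFromTo.add hl (Set.mem_univ 0) (Set.mem_univ x) (Set.mem_univ y)]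
    ring
  have hle : ∀ x y, x ≤ y → variationOnFromTo F Set.univ x y
      = (eVariationOn F (Set.univ ∩ Set.Icc x y)).toReal := fun x y h =>
    variationOnFromTo.eq_of_le _ _ h
  refine ⟨variationOnFromTo F Set.univ 0, hm, fun x y h => ?_, fun x y => ?_⟩
  · rw [hadd, hle x y h, ← Real.dist_eq, dist_edist]
    refine ENNReal.toReal_mono (hl x y (Set.mem_univ _) (Set.mem_univ _)) ?_
    exact eVariationOn.edist_le _ ⟨Set.mem_univ _, h, le_rfl⟩ ⟨Set.mem_univ _, le_rfl, h⟩
  · rcases le_total x y with h | h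
    · rw [hadd, hle x y h]
      exact ENNReal.toReal_mono hF (eVariationOn.mono _ (Set.subset_univ _))
    · exact (sub_nonpos.2 (hm h)).trans ENNReal.toReal_nonneg

namespace HasVariationBound

variable {F : ℝ → ℝ} {T B R h : ℝ}

theorem nonneg (hF : HasVariationBound F T) : 0 ≤ T := by
  obtain ⟨V, -, -, h⟩ := hF
  simpa using h 0 0

/-- Jordan decomposition: `V` and `V - F` are both monotone. -/
theorem measurable (hF : HasVariationBound F T) : Measurable F := by
  obtain ⟨V, hV, hFV, -⟩ := hF
  have h2 : Monotone fun x => V x - F x := fun x y hxy => by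
    have := (abs_le.1 (hFV x y hxy)).2
    simp only
    linarith
  have : F = fun x => V x - (V x - F x) := by ext; ring
  rw [this]
  exact hV.measurable.sub h2.measurable

theorem sq (hF : HasVariationBound F T) (hB : ∀ x, |F x| ≤ B) :
    HasVariationBound (fun x => F x ^ 2) (2 * B * T) := by
  obtain ⟨V, hV, hFV, hT⟩ := hF
  have hB0 : 0 ≤ B := (abs_nonneg _).trans (hB 0)
  refine ⟨fun x => 2 * B * V x, fun x y hxy => ?_, fun x y hxy => ?_, fun x y => ?_⟩
  · exact mul_le_mul_of_nonneg_left (hV hxy) (by positivity)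
  · rw [sq_sub_sq, abs_mul, ← mul_sub]
    refine mul_le_mul ?_ (hFV x y hxy) (abs_nonneg _) (by positivity)
    exact (abs_add_le _ _).trans (by linarith [hB x, hB y])
  · rw [← mul_sub]
    exact mul_le_mul_of_nonneg_left (hT x y) (by positivity)

theorem sum_sub_le_of_monotone {W : ℤ → ℝ} (hW : Monotone W) (hT : ∀ x y, W y - W x ≤ T)
    (s : Finset ℤ) : ∑ d ∈ s, (W (d + 1) - W d) ≤ T := by
  obtain ⟨N, hN⟩ : ∃ N : ℕ, ∀ d ∈ s, |d| ≤ N := by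
    refine ⟨∑ d ∈ s, d.natAbs, fun d hd => ?_⟩
    rw [Int.abs_eq_natAbs]
    exact_mod_cast Finset.single_le_sum (f := Int.natAbs) (fun _ _ => Nat.zero_le _) hd
  have hsub : s ⊆ (Finset.range (2 * N + 1)).image fun i : ℕ => (i : ℤ) - N := fun d hd => by
    have := abs_le.1 (hN d hd)
    rw [Finset.mem_image]
    exact ⟨(d + N).toNat, by rw [Finset.mem_range]; omega, by omega⟩
  refine (Finset.sum_le_sum_of_subset_of_nonneg hsub fun d _ _ =>
    sub_nonneg.2 (hW (by omega))).trans ?_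
  rw [Finset.sum_image fun a _ b _ h => by simpa using h]
  have := Finset.sum_range_sub (fun i : ℕ => W ((i : ℤ) - N)) (2 * N + 1)
  refine (le_of_eq ?_).trans ((this.le).trans (hT _ _))
  refine Finset.sum_congr rfl fun i _ => ?_
  push_cast
  rw [show (i : ℤ) - N + 1 = (i : ℤ) + 1 - N by ring]

/-- A shift by `q` is made of `|q|` unit shifts, and the sum over the grid of the unit increments of
`V` telescopes to at most `T`. Negative shifts reduce to positive ones by reindexing. -/
theorem sum_shift_le (hF : HasVariationBound F T) (hh : 0 ≤ h) (s : Finset ℤ) (q : ℤ) :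
    ∑ d ∈ s, |F ((d + q : ℤ) * h) - F (d * h)| ≤ |(q : ℝ)| * T := by
  obtain ⟨V, hV, hFV, hT⟩ := hF
  have hnat : ∀ (m : ℕ) (s : Finset ℤ),
      ∑ d ∈ s, |F ((d + m : ℤ) * h) - F (d * h)| ≤ m * T := by
    intro m s
    have hmono : ∀ r : ℤ, Monotone fun d : ℤ => V ((d + r : ℤ) * h) := fun r d d' hd =>
      hV (mul_le_mul_of_nonneg_right (by exact_mod_cast (by omega)) hh)
    calc _ ≤ ∑ d ∈ s, ∑ r ∈ Finset.range m,
          (V (((d + 1) + (r : ℤ) : ℤ) * h) - V ((d + (r : ℤ) : ℤ) * h)) := by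
          refine Finset.sum_le_sum fun d _ => ?_
          refine (hFV _ _ (mul_le_mul_of_nonneg_right (by push_cast; linarith [m.cast_nonneg (α := ℝ)]) hh)).trans
            (le_of_eq ?_)
          have := Finset.sum_range_sub (fun r : ℕ => V ((d + (r : ℤ) : ℤ) * h)) m
          simp only [Nat.cast_zero, add_zero] at this
          rw [← this]
          refine Finset.sum_congr rfl fun r _ => ?_
          push_cast
          ring_nf
      _ = ∑ r ∈ Finset.range m, ∑ d ∈ s,
          (V (((d + 1) + (r : ℤ) : ℤ) * h) - V ((d + (r : ℤ) : ℤ) * h)) := Finset.sum_comm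
      _ ≤ ∑ r ∈ Finset.range m, T := Finset.sum_le_sum fun r _ =>
          sum_sub_le_of_monotone (hmono r) (fun _ _ => hT _ _) s
      _ = m * T := by simp
  obtain ⟨m, rfl | rfl⟩ := q.eq_nat_or_neg
  · simpa using hnat m s
  · have := hnat m (s.map (Equiv.addRight (-(m : ℤ))).toEmbedding)
    rw [Finset.sum_map] at this
    simp only [Equiv.coe_toEmbedding, Equiv.coe_addRight, neg_add_cancel_right] at this
    simp_rw [abs_sub_comm (F (_ * h)) (F ((_ + -(m : ℤ) : ℤ) * h))] at this
    simpa using this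

variable (hF : HasVariationBound F T) (hh : 0 < h) (hR : ∀ x, R < |x| → F x = 0)
include hF hh hR

omit hF in
theorem eq_zero_of_lt {d : ℤ} (hd : R / h < |(d : ℝ)|) : F (d * h) = 0 := by
  refine hR _ ?_
  rw [abs_mul, abs_of_pos hh]
  exact (div_lt_iff₀ hh).1 hd

omit hF in
theorem hasFiniteSupport : (Function.support fun d : ℤ => F (d * h)).Finite := by
  refine (Set.finite_Icc (-⌈R / h⌉) ⌈R / h⌉).subset fun d hd => ?_
  have h1 : |(d : ℝ)| ≤ R / h := by
    by_contra! h2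
    exact hd (eq_zero_of_lt hh hR h2)
  have h2 : |d| ≤ ⌈R / h⌉ := by
    have := h1.trans (Int.le_ceil _)
    exact_mod_cast this
  exact abs_le.1 h2

omit hF in
theorem sum_le (hB : ∀ x, F x ≤ B) (hB0 : 0 ≤ B) (hR0 : 0 ≤ R) (s : Finset ℤ) :
    ∑ d ∈ s, F (d * h) ≤ B * (2 * (R / h) + 1) := by
  set N := ⌊R / h⌋ with hN
  have hN0 : 0 ≤ N := Int.floor_nonneg.2 (by positivity)
  calc ∑ d ∈ s, F (d * h) = ∑ d ∈ s with d ∈ Finset.Icc (-N) N, F (d * h) := by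
        rw [Finset.sum_filter]
        refine Finset.sum_congr rfl fun d _ => ?_
        split_ifs with h1
        · rfl
        refine eq_zero_of_lt hh hR ?_
        rw [Finset.mem_Icc, ← abs_le, not_le, hN] at h1
        exact_mod_cast Int.floor_lt.1 h1
    _ ≤ ∑ d ∈ s with d ∈ Finset.Icc (-N) N, B := Finset.sum_le_sum fun d _ => hB _
    _ ≤ ∑ d ∈ Finset.Icc (-N) N, B := Finset.sum_le_sum_of_subset_of_nonneg
        (fun d hd => (Finset.mem_filter.1 hd).2) fun _ _ _ => hB0
    _ = B * (2 * N + 1) := by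
        rw [Finset.sum_const, Int.card_Icc, nsmul_eq_mul, mul_comm]
        congr 1
        have : (((N + 1 - -N).toNat : ℤ) : ℝ) = 2 * N + 1 := by
          rw [Int.toNat_of_nonneg (by omega)]
          push_cast
          ring
        exact_mod_cast this
    _ ≤ _ := by
        gcongr
        exact Int.floor_le _

/-- On a cell of length `h` the error is at most `h` times the increment of `V` over the cell, and
these increments telescope. -/
theorem abs_riemannSum_sub_integral_le : |h * ∑' d : ℤ, F (d * h) - ∫ x, F x| ≤ h * T := by
  obtain ⟨N, hN⟩ := exists_nat_gt (R / h)
  have hm := hF.measurable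
  obtain ⟨V, hV, hFV, hT⟩ := hF
  have hNR : R < N * h := (div_lt_iff₀ hh).1 hN
  let a : ℕ → ℝ := fun i => ((i : ℤ) - N : ℤ) * h
  have hasucc : ∀ i, a (i + 1) = a i + h := fun i => by simp only [a]; push_cast; ring
  have hamono : Monotone a := monotone_nat_of_le_succ fun i => by rw [hasucc]; linarith
  have hpt : ∀ x y, x ≤ y → y ≤ x + h → |F y - F x| ≤ V (x + h) - V x := fun x y h1 h2 =>
    (hFV x y h1).trans (by linarith [hV h2])
  have hint : ∀ x y : ℝ, IntervalIntegrable F volume x y := fun x y => by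
    have hb : ∀ z, |F z| ≤ |F 0| + T := fun z => by
      have : |F z - F 0| ≤ T := by
        rcases le_total 0 z with h | h
        · exact (hFV _ _ h).trans (hT _ _)
        · rw [abs_sub_comm]; exact (hFV _ _ h).trans (hT _ _)
      have h3 := abs_sub_abs_le_abs_sub (F z) (F 0)
      linarith
    exact (intervalIntegrable_const (c := |F 0| + T)).mono_fun hm.aestronglyMeasurable
      (.of_forall fun z => by
        simp only [Real.norm_eq_abs]
        exact (hb z).trans (le_abs_self _))
  have hI : ∫ x, F x = ∑ i ∈ Finset.range (2 * N), ∫ x in a i..a (i + 1), F x := by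
    rw [intervalIntegral.sum_integral_adjacent_intervals fun i _ => hint _ _]
    have ha0 : a 0 = -(N * h) := by simp [a]
    have ha1 : a (2 * N) = N * h := by simp only [a]; push_cast; ring
    rw [ha0, ha1]
    refine (intervalIntegral.integral_eq_integral_of_support_subset fun x hx => ?_).symm
    have : |x| ≤ R := by
      by_contra! h2
      exact hx (hR x h2)
    have := abs_le.1 this
    exact ⟨by linarith, by linarith⟩
  have hS : ∑' d : ℤ, F (d * h) = ∑ i ∈ Finset.range (2 * N), F (a i) := by
    rw [tsum_eq_sum (s := (Finset.range (2 * N)).image fun i : ℕ => (i : ℤ) - N),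
      Finset.sum_image fun a _ b _ h => by simpa using h]
    intro d hd
    refine hR _ ?_
    rw [abs_mul, abs_of_pos hh]
    refine hNR.trans_le (mul_le_mul_of_nonneg_right ?_ hh.le)
    have : (N : ℤ) ≤ |d| := by
      by_contra! h2
      have h3 := abs_lt.1 h2
      exact hd (Finset.mem_image.2 ⟨(d + N).toNat, by rw [Finset.mem_range]; omega, by omega⟩)
    exact_mod_cast this
  rw [hI, hS, Finset.mul_sum, ← Finset.sum_sub_distrib]
  calc _ ≤ ∑ i ∈ Finset.range (2 * N), |h * F (a i) - ∫ x in a i..a (i + 1), F x| :=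
        Finset.abs_sum_le_sum_abs _ _
    _ ≤ ∑ i ∈ Finset.range (2 * N), h * (V (a (i + 1)) - V (a i)) := by
        refine Finset.sum_le_sum fun i _ => ?_
        have h1 : h * F (a i) = ∫ x in a i..a (i + 1), F (a i) := by
          rw [intervalIntegral.integral_const, hasucc, smul_eq_mul]
          ring
        rw [h1, ← intervalIntegral.integral_sub intervalIntegrable_const (hint _ _),
          ← Real.norm_eq_abs]
        refine (intervalIntegral.norm_integral_le_of_norm_le_const
          (C := V (a (i + 1)) - V (a i)) fun x hx => ?_).trans (le_of_eq ?_)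
        · rw [Set.uIoc_of_le (hamono (Nat.le_succ i)), hasucc] at hx
          rw [norm_sub_rev, Real.norm_eq_abs, hasucc]
          exact hpt _ _ hx.1.le hx.2
        · rw [hasucc, add_sub_cancel_left, abs_of_pos hh, mul_comm]
    _ ≤ h * T := by
        rw [← Finset.mul_sum, Finset.sum_range_sub fun i => V (a i)]
        exact mul_le_mul_of_nonneg_left (hT _ _) hh.le

/-- Summation by parts: multiplication by `1 - z` turns the coefficients into the increments `F(dh)
- F((d-1)h)`, whose absolute sum is at most the variation. -/
theorem norm_one_sub_mul_tsum_le {z : ℂ} (hz : ‖z‖ = 1) :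
    ‖(1 - z) * ∑' d : ℤ, (F (d * h) : ℂ) * z ^ d‖ ≤ T := by
  have hz0 : z ≠ 0 := fun h0 => by simp [h0] at hz
  have hfin := hasFiniteSupport hh hR
  have hs1 : Summable fun d : ℤ => (F (d * h) : ℂ) * z ^ d :=
    summable_of_hasFiniteSupport (hfin.subset fun d hd h0 => hd (by
      simp only at h0
      simp [h0]))
  have hs2 : Summable fun d : ℤ => (F ((d + -1 : ℤ) * h) : ℂ) * z ^ d := by
    have h1 := ((Equiv.addRight (-1 : ℤ)).summable_iff.2 hs1).mul_left z
    refine h1.congr fun d => ?_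
    simp only [Function.comp, Equiv.coe_addRight]
    rw [zpow_add₀ hz0, zpow_neg_one]
    field_simp
  have h2 : z * ∑' d : ℤ, (F (d * h) : ℂ) * z ^ d
      = ∑' d : ℤ, (F ((d + -1 : ℤ) * h) : ℂ) * z ^ d := by
    rw [← (Equiv.addRight (-1 : ℤ)).tsum_eq fun d : ℤ => (F (d * h) : ℂ) * z ^ d, ← tsum_mul_left]
    refine tsum_congr fun d => ?_
    simp only [Equiv.coe_addRight]
    rw [zpow_add₀ hz0, zpow_neg_one]
    field_simp
  rw [sub_mul, one_mul, h2, ← hs1.tsum_sub hs2]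
  have hsum := hs1.sub hs2
  refine le_of_tendsto (hsum.hasSum.norm) (.of_forall fun s => ?_)
  refine (norm_sum_le _ _).trans ?_
  have := hF.sum_shift_le hh.le s (-1)
  simp only [Int.cast_neg, Int.cast_one, abs_neg, abs_one, one_mul] at this
  refine le_trans (Finset.sum_le_sum fun d _ => ?_) this
  rw [← sub_mul, norm_mul, norm_zpow, hz, one_zpow, mul_one, ← Complex.ofReal_sub,
    Complex.norm_real, Real.norm_eq_abs, abs_sub_comm]

end HasVariationBound

end SpectralCLT

namespace SpectralCLT

/-! ### The limit of the scaled quadruple sums -/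

/-- A nonnegative function bounded by `B`, supported in `[-R, R]`, with variation at most `T`. -/
structure IsWindow (K : ℝ → ℝ) (B R T : ℝ) : Prop where
  nonneg : ∀ x, 0 ≤ K x
  le : ∀ x, K x ≤ B
  eq_zero : ∀ x, R < |x| → K x = 0
  radius_nonneg : 0 ≤ R
  variation : HasVariationBound K T

theorem KernelCondition.exists_isWindow {K : ℝ → ℝ} (hK : KernelCondition K) :
    ∃ B R T, IsWindow K B R T := by
  obtain ⟨R, hR⟩ := hK.hasCompactSupport.isCompact.isBounded.subset_closedBall 0
  have hv := hasVariationBound_of_boundedVariationOn hK.boundedVariation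
  obtain ⟨V, hV, hKV, hT⟩ := id hv
  refine ⟨K 0 + (eVariationOn K Set.univ).toReal, max R 0, _, hK.nonneg, fun x => ?_,
    fun x hx => ?_, le_max_right _ _, hv⟩
  · rcases le_total 0 x with h | h
    · linarith [(abs_le.1 ((hKV _ _ h).trans (hT _ _))).2]
    · linarith [(abs_le.1 ((hKV _ _ h).trans (hT _ _))).1]
  · by_contra h0
    have h1 := hR (subset_tsupport _ h0)
    rw [mem_closedBall_zero_iff, Real.norm_eq_abs] at h1
    exact absurd (h1.trans (le_max_left _ _)) (not_le.2 hx)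

/-- The sequence `δ γ` has absolute mass at most `M`, of which at most `τ` beyond `L`. -/
structure HasMassBound (γ : ℤ → ℂ) (δ L M τ : ℝ) : Prop where
  mass : ∀ s : Finset ℤ, δ * ∑ d ∈ s, ‖γ d‖ ≤ M
  tail : ∀ s : Finset ℤ, (∀ d ∈ s, L < |(d : ℝ)|) → δ * ∑ d ∈ s, ‖γ d‖ ≤ τ

namespace IsWindow

variable {K : ℝ → ℝ} {B R T h : ℝ}

theorem bound_nonneg (hK : IsWindow K B R T) : 0 ≤ B := (hK.nonneg 0).trans (hK.le 0)

theorem sq (hK : IsWindow K B R T) : IsWindow (fun x => K x ^ 2) (B ^ 2) R (2 * B * T) where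
  nonneg x := sq_nonneg _
  le x := pow_le_pow_left₀ (hK.nonneg x) (hK.le x) 2
  eq_zero x hx := by simp [hK.eq_zero x hx]
  radius_nonneg := hK.radius_nonneg
  variation := hK.variation.sq fun x => by rw [abs_of_nonneg (hK.nonneg x)]; exact hK.le x

theorem summable_mul_zpow (hK : IsWindow K B R T) (hh : 0 < h) (z : ℂ) :
    Summable fun d : ℤ => (K (d * h) : ℂ) * z ^ d :=
  summable_of_hasFiniteSupport
    ((HasVariationBound.hasFiniteSupport hh hK.eq_zero).subset fun d hd h0 => hd (by
      simp only at h0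
      simp [h0]))

/-- Applies the two quadruple-sum estimates with masses `M / δ`, tails `τ / δ` and window mass `B
(2RΔ/δ + 1)`. The scaling leaves an error in which every term contains one of the small quantities
`Lδ/Δ`, `τ`, `L/n`, `Δ/(nδ)`, `1/n`. -/
theorem norm_scaled_quadSum_sub_le (hK : IsWindow K B R T) {δ Δ L M τ : ℝ} {n : ℕ} (hn : 1 ≤ n)
    (hδ : 0 < δ) (hΔ : 0 < Δ) (hL : 0 ≤ L) {z : ℂ} (hz : ‖z‖ = 1) {γ₁ γ₂ : ℤ → ℂ}
    (h₁ : HasMassBound γ₁ δ L M τ) (h₂ : HasMassBound γ₂ δ L M τ) :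
    ‖((δ ^ 3 / (4 * Real.pi ^ 2 * (n * Δ)) : ℝ) : ℂ) *
        quadSum n (fun d => K (d * (δ / Δ)) * z ^ d) (fun d => K (d * (δ / Δ))) γ₁ γ₂ -
      ((δ / Δ : ℝ) * ∑' d : ℤ, ((K (d * (δ / Δ)) ^ 2 : ℝ) : ℂ) * z ^ d) *
        (((δ / (2 * Real.pi) : ℝ) * ∑' d, γ₁ d) * ((δ / (2 * Real.pi) : ℝ) * ∑' d, γ₂ d))‖
      ≤ 1 / (4 * Real.pi ^ 2) * (2 * B * T * M ^ 2 * (L * (δ / Δ)) +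
        B * (2 * R + δ / Δ) * B * (2 * M * τ) +
        2 * B * (B * (2 * R + δ / Δ)) * M * (τ + (2 * L + 1) / n * M) +
        (2 * (R / (δ / Δ)) + 1) / n * (B * (B * (2 * R + δ / Δ))) * M ^ 2) := by
  have hn0 : (0 : ℝ) < n := by exact_mod_cast hn
  have hh : 0 < δ / Δ := by positivity
  have hB0 := hK.bound_nonneg
  have hT0 := hK.variation.nonneg
  have hR0 := hK.radius_nonneg
  set k : ℤ → ℝ := fun d => K (d * (δ / Δ)) with hk
  set C : ℝ := B * (2 * (R / (δ / Δ)) + 1) with hC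
  have hk0 : ∀ d, 0 ≤ k d := fun d => hK.nonneg _
  have hkB : ∀ d, k d ≤ B := fun d => hK.le _
  have hkC : ∀ s : Finset ℤ, ∑ d ∈ s, k d ≤ C :=
    HasVariationBound.sum_le hh hK.eq_zero hK.le hB0 hR0
  have hkT : ∀ (s : Finset ℤ) (q : ℤ), ∑ d ∈ s, |k (d + q) - k d| ≤ |(q : ℝ)| * T :=
    hK.variation.sum_shift_le hh.le
  have hkN : ∀ d : ℤ, R / (δ / Δ) < |(d : ℝ)| → k d = 0 := fun d =>
    HasVariationBound.eq_zero_of_lt hh hK.eq_zero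
  have hκ : ∀ d : ℤ, ‖(k d : ℂ) * z ^ d‖ ≤ k d := fun d => by
    rw [norm_mul, norm_zpow, hz, one_zpow, mul_one, Complex.norm_real, Real.norm_of_nonneg (hk0 d)]
  have hmass : ∀ {γ : ℤ → ℂ}, HasMassBound γ δ L M τ → ∀ s : Finset ℤ,
      ∑ d ∈ s, ‖γ d‖ ≤ M / δ := fun hγ s => by
    rw [le_div_iff₀ hδ, mul_comm]
    exact hγ.mass s
  have htail : ∀ {γ : ℤ → ℂ}, HasMassBound γ δ L M τ → ∀ s : Finset ℤ,
      (∀ d ∈ s, L < |(d : ℝ)|) → ∑ d ∈ s, ‖γ d‖ ≤ τ / δ := fun hγ s hs => by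
    rw [le_div_iff₀ hδ, mul_comm]
    exact hγ.tail s hs
  have hsum : ∀ {γ : ℤ → ℂ}, HasMassBound γ δ L M τ → HasSum γ (∑' d, γ d) := fun hγ =>
    (summable_of_sum_le (fun _ => norm_nonneg _) (hmass hγ)).of_norm.hasSum
  have hg : HasSum (fun d : ℤ => (k d : ℂ) * z ^ d * k d)
      (∑' d : ℤ, ((k d ^ 2 : ℝ) : ℂ) * z ^ d) := by
    refine (hK.sq.summable_mul_zpow hh z).hasSum.congr_fun fun d => ?_
    push_cast [hk]
    ring
  have e1 := norm_quadSum_sub_le₁ hk0 hkB hkC hkT hT0 hL hκ (hmass h₁) (hmass h₂) (htail h₁)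
    (htail h₂) n
  have e2 := norm_window_sub_le hg (fun d => by
      rw [norm_mul, Complex.norm_real, Real.norm_of_nonneg (hk0 d)]
      exact mul_le_mul_of_nonneg_right ((hκ d).trans (hkB d)) (hk0 d)) hB0 hkC hkN
    (by positivity) hL (hsum h₁) (hsum h₂) (hmass h₁) (hmass h₂) (htail h₁) (htail h₂) n
  set G : ℂ := ∑' d : ℤ, ((k d ^ 2 : ℝ) : ℂ) * z ^ d
  have e3 := (norm_sub_le_norm_sub_add_norm_sub _ _ _).trans (add_le_add e1 e2)
  set A : ℝ := δ ^ 3 / (4 * Real.pi ^ 2 * (n * Δ)) with hA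
  have hmain : ((δ / Δ : ℝ) * G) *
        (((δ / (2 * Real.pi) : ℝ) * ∑' d, γ₁ d) * ((δ / (2 * Real.pi) : ℝ) * ∑' d, γ₂ d))
      = (A : ℂ) * (n * G * ((∑' d, γ₁ d) * ∑' d, γ₂ d)) := by
    -- The prefactor splits as `1/n` times one factor `δ/Δ` for the window sum and one `δ/(2π)` for
    -- each Fourier sum.
    have hA' : A * n = (δ / Δ) * (δ / (2 * Real.pi)) * (δ / (2 * Real.pi)) := by
      rw [hA]
      have := Real.pi_pos
      field_simp
      norm_num
    have hA2 : (A : ℂ) * n = ((δ / Δ : ℝ) : ℂ) * ((δ / (2 * Real.pi) : ℝ) : ℂ) *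
      ((δ / (2 * Real.pi) : ℝ) : ℂ) := by exact_mod_cast congrArg Complex.ofReal hA'
    linear_combination (-(G * ((∑' d, γ₁ d) * ∑' d, γ₂ d))) * hA2
  rw [hmain, ← mul_sub, norm_mul, Complex.norm_real, Real.norm_of_nonneg (by positivity)]
  refine (mul_le_mul_of_nonneg_left e3 (by positivity)).trans (le_of_eq ?_)
  rw [hA, hC]
  have := Real.pi_pos
  field_simp
  ring

/-- Not an asymptotic statement: it holds at each fixed `n` and keeps the masses `μ₁`, `μ₂` as a
product, in the form of the coordinatewise dominations used for tightness. -/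
theorem norm_scaled_quadSum_le (hK : IsWindow K B R T) {δ Δ μ₁ μ₂ : ℝ} {n : ℕ} (hn : 1 ≤ n)
    (hδ : 0 < δ) (hΔ : 0 < Δ) {κ k' γ₁ γ₂ : ℤ → ℂ} (hκ : ∀ d : ℤ, ‖κ d‖ ≤ K (d * (δ / Δ)))
    (hk' : ∀ d : ℤ, ‖k' d‖ ≤ K (d * (δ / Δ)))
    (h₁ : ∀ s : Finset ℤ, δ * ∑ d ∈ s, ‖γ₁ d‖ ≤ μ₁)
    (h₂ : ∀ s : Finset ℤ, δ * ∑ d ∈ s, ‖γ₂ d‖ ≤ μ₂) :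
    ‖((δ ^ 3 / (4 * Real.pi ^ 2 * (n * Δ)) : ℝ) : ℂ) * quadSum n κ k' γ₁ γ₂‖
      ≤ 1 / (4 * Real.pi ^ 2) * (B * (B * (2 * R + δ / Δ))) * (μ₁ * μ₂) := by
  have hn0 : (0 : ℝ) < n := by exact_mod_cast hn
  have hh : 0 < δ / Δ := by positivity
  have e := norm_quadSum_le (k := fun d : ℤ => K (d * (δ / Δ))) (fun d => hK.nonneg _)
    (fun d => hK.le _)
    (HasVariationBound.sum_le hh hK.eq_zero hK.le hK.bound_nonneg hK.radius_nonneg) hκ hk'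
    (M₁ := μ₁ / δ) (M₂ := μ₂ / δ)
    (fun s => by rw [le_div_iff₀ hδ, mul_comm]; exact h₁ s)
    (fun s => by rw [le_div_iff₀ hδ, mul_comm]; exact h₂ s) n
  rw [norm_mul, Complex.norm_real, Real.norm_of_nonneg (by positivity)]
  refine (mul_le_mul_of_nonneg_left e (by positivity)).trans (le_of_eq ?_)
  have := Real.pi_pos
  field_simp

theorem tendsto_scaled_quadSum (hK : IsWindow K B R T) {δ Δ L τ : ℕ → ℝ} {M : ℝ}
    (hδ : ∀ᶠ n in atTop, 0 < δ n) (hΔ : ∀ᶠ n in atTop, 0 < Δ n) (hL : ∀ᶠ n in atTop, 0 ≤ L n)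
    (hh : Tendsto (fun n => δ n / Δ n) atTop (𝓝 0))
    (hnh : Tendsto (fun n : ℕ => n * (δ n / Δ n)) atTop atTop)
    (hLh : Tendsto (fun n => L n * (δ n / Δ n)) atTop (𝓝 0)) (hτ : Tendsto τ atTop (𝓝 0))
    {z : ℕ → ℂ} (hz : ∀ n, ‖z n‖ = 1) {γ₁ γ₂ : ℕ → ℤ → ℂ}
    (h₁ : ∀ᶠ n in atTop, HasMassBound (γ₁ n) (δ n) (L n) M (τ n))
    (h₂ : ∀ᶠ n in atTop, HasMassBound (γ₂ n) (δ n) (L n) M (τ n)) {ω F₁ F₂ : ℂ}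
    (hω : Tendsto (fun n => (δ n / Δ n : ℝ) *
      ∑' d : ℤ, ((K (d * (δ n / Δ n)) ^ 2 : ℝ) : ℂ) * z n ^ d) atTop (𝓝 ω))
    (hF₁ : Tendsto (fun n => ((δ n / (2 * Real.pi) : ℝ) : ℂ) * ∑' d, γ₁ n d) atTop (𝓝 F₁))
    (hF₂ : Tendsto (fun n => ((δ n / (2 * Real.pi) : ℝ) : ℂ) * ∑' d, γ₂ n d) atTop (𝓝 F₂)) :
    Tendsto (fun n => ((δ n ^ 3 / (4 * Real.pi ^ 2 * (n * Δ n)) : ℝ) : ℂ) *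
      quadSum n (fun d => K (d * (δ n / Δ n)) * z n ^ d) (fun d => K (d * (δ n / Δ n)))
        (γ₁ n) (γ₂ n)) atTop (𝓝 (ω * (F₁ * F₂))) := by
  have hinv : Tendsto (fun n : ℕ => (n : ℝ)⁻¹) atTop (𝓝 0) := tendsto_inv_atTop_nhds_zero_nat
  have hnhinv : Tendsto (fun n : ℕ => ((n : ℝ) * (δ n / Δ n))⁻¹) atTop (𝓝 0) := hnh.inv_tendsto_atTop
  -- With `h = δ/Δ`, the quotient `L/n` equals `(Lh)/(nh)`, a null sequence over a divergent one.
  have hLn : Tendsto (fun n : ℕ => (2 * L n + 1) / n) atTop (𝓝 0) := by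
    have := ((hLh.mul hnhinv).const_mul 2).add hinv
    simp only [mul_zero, add_zero] at this
    refine this.congr' ?_
    filter_upwards [hδ, hΔ, eventually_gt_atTop 0] with n h1 h2 h3
    have : (0 : ℝ) < n := by exact_mod_cast h3
    field_simp
  have hRn : Tendsto (fun n : ℕ => (2 * (R / (δ n / Δ n)) + 1) / n) atTop (𝓝 0) := by
    have := (hnhinv.const_mul (2 * R)).add hinv
    simp only [mul_zero, add_zero] at this
    refine this.congr' ?_
    filter_upwards [hδ, hΔ, eventually_gt_atTop 0] with n h1 h2 h3
    have : (0 : ℝ) < n := by exact_mod_cast h3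
    field_simp
  have hc : Tendsto (fun n => B * (2 * R + δ n / Δ n)) atTop (𝓝 (B * (2 * R + 0))) :=
    (hh.const_add _).const_mul _
  have hE : Tendsto (fun n : ℕ => 1 / (4 * Real.pi ^ 2) * (2 * B * T * M ^ 2 * (L n * (δ n / Δ n)) +
        B * (2 * R + δ n / Δ n) * B * (2 * M * τ n) +
        2 * B * (B * (2 * R + δ n / Δ n)) * M * (τ n + (2 * L n + 1) / n * M) +
        (2 * (R / (δ n / Δ n)) + 1) / n * (B * (B * (2 * R + δ n / Δ n))) * M ^ 2)) atTop
      (𝓝 (1 / (4 * Real.pi ^ 2) * (2 * B * T * M ^ 2 * 0 +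
        B * (2 * R + 0) * B * (2 * M * 0) +
        2 * B * (B * (2 * R + 0)) * M * (0 + 0 * M) +
        0 * (B * (B * (2 * R + 0))) * M ^ 2))) :=
    ((((hLh.const_mul _).add ((hc.mul_const B).mul (hτ.const_mul _))).add
      (((hc.const_mul (2 * B)).mul_const M).mul (hτ.add (hLn.mul_const M)))).add
      ((hRn.mul (hc.const_mul B)).mul_const _)).const_mul _
  simp only [mul_zero, zero_mul, add_zero] at hE
  have hmain := hω.mul (hF₁.mul hF₂)
  have hdiff := squeeze_zero_norm' (f := fun n =>
    ((δ n ^ 3 / (4 * Real.pi ^ 2 * (n * Δ n)) : ℝ) : ℂ) *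
      quadSum n (fun d => K (d * (δ n / Δ n)) * z n ^ d) (fun d => K (d * (δ n / Δ n)))
        (γ₁ n) (γ₂ n) -
      ((δ n / Δ n : ℝ) * ∑' d : ℤ, ((K (d * (δ n / Δ n)) ^ 2 : ℝ) : ℂ) * z n ^ d) *
        (((δ n / (2 * Real.pi) : ℝ) * ∑' d, γ₁ n d) *
          ((δ n / (2 * Real.pi) : ℝ) * ∑' d, γ₂ n d))) (by
    filter_upwards [hδ, hΔ, hL, h₁, h₂, eventually_ge_atTop 1] with n a1 a2 a3 a4 a5 a6
    exact hK.norm_scaled_quadSum_sub_le a6 a1 a2 a3 (hz n) a4 a5) hE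
  simpa using hdiff.add hmain

/-! ### The limit of the scaled sums of the squared window -/

theorem tendsto_riemannSum_sq (hK : IsWindow K B R T) {u : ℕ → ℝ} (hu0 : ∀ᶠ n in atTop, 0 < u n)
    (hu : Tendsto u atTop (𝓝 0)) :
    Tendsto (fun n => u n * ∑' d : ℤ, K (d * u n) ^ 2) atTop (𝓝 (∫ x, K x ^ 2)) := by
  rw [tendsto_iff_norm_sub_tendsto_zero]
  refine squeeze_zero' (.of_forall fun n => norm_nonneg _) ?_
    (by simpa using hu.mul_const (2 * B * T))
  filter_upwards [hu0] with n hn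
  exact hK.sq.variation.abs_riemannSum_sub_integral_le hn hK.sq.eq_zero

/-- Summation by parts bounds the sum by the variation of `K²` divided by `|1 - z n|`: the
oscillating regime. -/
theorem tendsto_sq_tsum_of_div_tendsto_zero (hK : IsWindow K B R T) {u : ℕ → ℝ}
    (hu0 : ∀ᶠ n in atTop, 0 < u n) {z : ℕ → ℂ} (hz : ∀ n, ‖z n‖ = 1)
    (hz1 : ∀ᶠ n in atTop, z n ≠ 1)
    (hu : Tendsto (fun n => u n / ‖1 - z n‖) atTop (𝓝 0)) :
    Tendsto (fun n => (u n : ℂ) * ∑' d : ℤ, ((K (d * u n) ^ 2 : ℝ) : ℂ) * z n ^ d) atTop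
      (𝓝 0) := by
  refine squeeze_zero_norm' ?_ (by simpa using hu.mul_const (2 * B * T))
  filter_upwards [hu0, hz1] with n hn hzn
  have h1 := hK.sq.variation.norm_one_sub_mul_tsum_le hn hK.sq.eq_zero (hz n)
  rw [norm_mul] at h1
  have h2 : 0 < ‖1 - z n‖ := norm_pos_iff.2 (sub_ne_zero.2 hzn.symm)
  rw [norm_mul, Complex.norm_real, Real.norm_of_nonneg hn.le, div_mul_eq_mul_div, le_div_iff₀ h2,
    mul_assoc, mul_comm _ ‖1 - z n‖]
  exact mul_le_mul_of_nonneg_left h1 hn.le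

/-- Only `|d| ≤ R / u` contribute, and there `|e^{idφ} - 1| ≤ R |φ/u|`. A phase that is small
against the mesh is therefore invisible, and the Riemann sum of `K²` remains. -/
theorem tendsto_sq_tsum_of_arg (hK : IsWindow K B R T) {u φ : ℕ → ℝ}
    (hu0 : ∀ᶠ n in atTop, 0 < u n) (hu : Tendsto u atTop (𝓝 0))
    (hφ : Tendsto (fun n => φ n / u n) atTop (𝓝 0)) :
    Tendsto (fun n => (u n : ℂ) * ∑' d : ℤ, ((K (d * u n) ^ 2 : ℝ) : ℂ) *
      Complex.exp (φ n * Complex.I) ^ d) atTop (𝓝 ((∫ x, K x ^ 2 : ℝ) : ℂ)) := by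
  have h1 := (Complex.continuous_ofReal.tendsto _).comp (hK.tendsto_riemannSum_sq hu0 hu)
  have h2 : Tendsto (fun n => (u n : ℂ) * ∑' d : ℤ, ((K (d * u n) ^ 2 : ℝ) : ℂ) *
      Complex.exp (φ n * Complex.I) ^ d - ((u n * ∑' d : ℤ, K (d * u n) ^ 2 : ℝ) : ℂ)) atTop
      (𝓝 0) := by
    have h3 : Tendsto (fun n => B ^ 2 * (2 * R + u n) * (R * |φ n / u n|)) atTop (𝓝 0) := by
      have := ((hu.const_add (2 * R)).const_mul (B ^ 2)).mul (hφ.abs.const_mul R)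
      simpa using this
    refine squeeze_zero_norm' ?_ h3
    filter_upwards [hu0] with n hn
    have s1 := hK.sq.summable_mul_zpow hn (Complex.exp (φ n * Complex.I))
    have s2 := hK.sq.summable_mul_zpow hn 1
    simp only [one_zpow, mul_one] at s2
    push_cast at s1 s2 ⊢
    rw [← mul_sub, ← s1.tsum_sub s2]
    have hR0 := hK.radius_nonneg
    refine le_of_tendsto ((s1.sub s2).hasSum.mul_left _).norm (.of_forall fun s => ?_)
    rw [← Finset.mul_sum, norm_mul, Complex.norm_real, Real.norm_of_nonneg hn.le]
    calc u n * ‖∑ d ∈ s, ((K (d * u n) : ℂ) ^ 2 * Complex.exp (φ n * Complex.I) ^ d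
            - (K (d * u n) : ℂ) ^ 2)‖
        ≤ u n * ∑ d ∈ s, K (d * u n) ^ 2 * (R * |φ n / u n|) := by
          refine mul_le_mul_of_nonneg_left ?_ hn.le
          refine (norm_sum_le _ _).trans (Finset.sum_le_sum fun d _ => ?_)
          rw [← mul_sub_one, norm_mul, norm_pow, Complex.norm_real, Real.norm_eq_abs, sq_abs]
          by_cases hd : R / u n < |(d : ℝ)|
          · have : K (d * u n) = 0 := HasVariationBound.eq_zero_of_lt hn hK.eq_zero hd
            rw [this]
            simp
          refine mul_le_mul_of_nonneg_left ?_ (sq_nonneg _)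
          rw [← Complex.exp_int_mul, show (d : ℂ) * (φ n * Complex.I)
            = Complex.I * ((d * φ n : ℝ) : ℂ) by push_cast; ring]
          refine (Real.norm_exp_I_mul_ofReal_sub_one_le).trans ?_
          rw [Real.norm_eq_abs, abs_mul, abs_div, abs_of_pos hn]
          calc |(d : ℝ)| * |φ n| ≤ R / u n * |φ n| :=
                mul_le_mul_of_nonneg_right (not_lt.1 hd) (abs_nonneg _)
            _ = _ := by ring
      _ = u n * (∑ d ∈ s, K (d * u n) ^ 2) * (R * |φ n / u n|) := by
          rw [← Finset.sum_mul, mul_assoc]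
      _ ≤ u n * (B ^ 2 * (2 * (R / u n) + 1)) * (R * |φ n / u n|) := by
          have := HasVariationBound.sum_le hn hK.sq.eq_zero hK.sq.le (sq_nonneg B) hR0 s
          gcongr
      _ = _ := by
          congr 1
          field_simp
  simpa using h2.add h1

theorem tendsto_sq_tsum_cInd (hK : IsWindow K B R T) {δ Δ : ℕ → ℝ} {δlim θ : ℝ}
    (hδ : ∀ᶠ n in atTop, 0 < δ n) (hΔ : ∀ᶠ n in atTop, 0 < Δ n) (hδl : Tendsto δ atTop (𝓝 δlim))
    (hΔl : Tendsto Δ atTop atTop) (hθ : 0 < δlim → |θ| ≤ Real.pi / δlim)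
    (hedge : 0 < δlim → |θ| = Real.pi / δlim →
      Tendsto (fun n => Δ n * (δ n - δlim)) atTop (𝓝 0)) :
    Tendsto (fun n => ((δ n / Δ n : ℝ) : ℂ) *
      ∑' d : ℤ, ((K (d * (δ n / Δ n)) ^ 2 : ℝ) : ℂ) *
        Complex.exp ((2 * δ n * θ : ℝ) * Complex.I) ^ d) atTop
      (𝓝 ((cInd θ δlim * ∫ x, K x ^ 2 : ℝ) : ℂ)) := by
  have hδ0 : 0 ≤ δlim := ge_of_tendsto hδl (hδ.mono fun n h => h.le)
  have hu0 : ∀ᶠ n in atTop, 0 < δ n / Δ n := by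
    filter_upwards [hδ, hΔ] with n h1 h2
    positivity
  have hu : Tendsto (fun n => δ n / Δ n) atTop (𝓝 0) := hδl.div_atTop hΔl
  have hπ := Real.pi_pos
  by_cases hθ0 : θ = 0
  · have := hK.tendsto_sq_tsum_of_arg (φ := fun _ => 0) hu0 hu (by simp)
    simpa [hθ0, cInd] using this
  by_cases hed : 0 < δlim ∧ |θ| = Real.pi / δlim
  · have hc : cInd θ δlim = 1 := if_pos (Or.inr ⟨hed.1, eq_or_eq_neg_of_abs_eq hed.2⟩)
    rw [hc, one_mul]
    -- At an edge frequency `e^{2iδ_∞θ} = 1`, so the phase is effectively `2(δ_n - δ_∞)θ`. Divided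
    -- by `δ_n/Δ_n` it is `2θ Δ_n(δ_n - δ_∞)/δ_n`, which tends to zero by `hedge`.
    have hexp : ∀ n, Complex.exp ((2 * δ n * θ : ℝ) * Complex.I)
        = Complex.exp ((2 * (δ n - δlim) * θ : ℝ) * Complex.I) := fun n => by
      have hper : ((2 * δ n * θ : ℝ) : ℂ) * Complex.I
          = (2 * (δ n - δlim) * θ : ℝ) * Complex.I + (2 * δlim * θ : ℝ) * Complex.I := by
        push_cast
        ring
      rw [hper, Complex.exp_add]
      have h1 : Complex.exp ((2 * δlim * θ : ℝ) * Complex.I) = 1 := by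
        have hd := hed.1.ne'
        rcases eq_or_eq_neg_of_abs_eq hed.2 with h | h
        · rw [h, show 2 * δlim * (Real.pi / δlim) = 2 * Real.pi by field_simp]
          push_cast
          exact Complex.exp_two_pi_mul_I
        · rw [h, show 2 * δlim * -(Real.pi / δlim) = -(2 * Real.pi) by field_simp]
          push_cast
          rw [neg_mul, Complex.exp_neg, Complex.exp_two_pi_mul_I, inv_one]
      rw [h1, mul_one]
    simp_rw [hexp]
    refine hK.tendsto_sq_tsum_of_arg hu0 hu ?_
    have h1 := (((hedge hed.1 hed.2).const_mul (2 * θ)).div hδl hed.1.ne')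
    simp only [mul_zero, zero_div] at h1
    refine h1.congr' ?_
    filter_upwards [hδ, hΔ] with n h1 h2
    simp only [Pi.div_apply]
    field_simp
  have hc : cInd θ δlim = 0 := if_neg (by
    rintro (h | ⟨h1, h2⟩)
    · exact hθ0 h
    · refine hed ⟨h1, ?_⟩
      rcases h2 with h2 | h2
      · rw [h2, abs_of_pos (by positivity)]
      · rw [h2, abs_neg, abs_of_pos (by positivity)])
  rw [hc, zero_mul, Complex.ofReal_zero]
  -- Here `v n` is the exact order of `1 - z_n`. It is `δ_n` if the mesh tends to zero, with `w =
  -- -2iθ` from the derivative of the exponential, and constant otherwise. Both dominate `δ_n/Δ_n`.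
  suffices h : ∃ w : ℂ, w ≠ 0 ∧ ∃ v : ℕ → ℝ, (∀ᶠ n in atTop, 0 < v n) ∧
      Tendsto (fun n => (1 - Complex.exp ((2 * δ n * θ : ℝ) * Complex.I)) / v n) atTop (𝓝 w) ∧
      Tendsto (fun n => (δ n / Δ n) / v n) atTop (𝓝 0) by
    obtain ⟨w, hw, v, hv0, hv, hv2⟩ := h
    refine hK.tendsto_sq_tsum_of_div_tendsto_zero hu0 (fun n => Complex.norm_exp_ofReal_mul_I _)
      ?_ ?_
    · filter_upwards [hv.eventually_ne hw] with n h1 h2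
      rw [h2] at h1
      simp at h1
    · have := hv2.div hv.norm (norm_ne_zero_iff.2 hw)
      rw [zero_div] at this
      refine this.congr' ?_
      filter_upwards [hv0] with n hn
      simp only [Pi.div_apply, norm_div, Complex.norm_real, Real.norm_of_nonneg hn.le]
      field_simp
  rcases hδ0.eq_or_lt with h0 | hpos
  · refine ⟨-(2 * θ * Complex.I), by simp [hθ0], δ, hδ, ?_, ?_⟩
    · have hd : HasDerivAt (fun x : ℝ => Complex.exp ((2 * x * θ : ℝ) * Complex.I))
          (2 * θ * Complex.I) 0 := by
        have h1 : HasDerivAt (fun x : ℝ => ((2 * x * θ : ℝ) : ℂ) * Complex.I)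
            (2 * θ * Complex.I) 0 := by
          have := (((hasDerivAt_id (0 : ℝ)).const_mul 2).mul_const θ).ofReal_comp.mul_const
            Complex.I
          simpa using this
        simpa using h1.cexp
      have hs := hasDerivAt_iff_tendsto_slope_zero.1 hd
      have hδ' : Tendsto δ atTop (𝓝[≠] 0) := tendsto_nhdsWithin_iff.2
        ⟨h0 ▸ hδl, hδ.mono fun n h => h.ne'⟩
      refine ((hs.comp hδ').neg).congr fun n => ?_
      simp only [Function.comp, zero_add, mul_zero, zero_mul, Complex.ofReal_zero,
        Complex.exp_zero, Complex.real_smul]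
      push_cast
      ring
    · refine hΔl.inv_tendsto_atTop.congr' ?_
      filter_upwards [hδ, hΔ] with n h1 h2
      simp only [Pi.inv_apply]
      field_simp
  · refine ⟨1 - Complex.exp ((2 * δlim * θ : ℝ) * Complex.I), ?_, fun _ => 1, by simp, ?_, ?_⟩
    · intro h
      -- If `1 - z_n` tended to zero, then `δ_∞ θ = mπ` for an integer `m`. Strictly inside the
      -- frequency band this forces `m = 0`, hence `θ = 0`.
      obtain ⟨m, hm⟩ := Complex.exp_eq_one_iff.1 (sub_eq_zero.1 h).symm
      have h2 : 2 * δlim * θ = m * (2 * Real.pi) := by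
        have : ((2 * δlim * θ : ℝ) : ℂ) * Complex.I = ((m * (2 * Real.pi) : ℝ) : ℂ) * Complex.I := by
          rw [hm]
          push_cast
          ring
        exact_mod_cast mul_right_cancel₀ Complex.I_ne_zero this
      have h3 : |θ| < Real.pi / δlim := (hθ hpos).lt_of_ne fun h => hed ⟨hpos, h⟩
      rw [lt_div_iff₀ hpos] at h3
      have h4 : |(m : ℝ)| * Real.pi < Real.pi := by
        have : |2 * δlim * θ| = |(m : ℝ)| * (2 * Real.pi) := by
          rw [h2, abs_mul, abs_of_pos (show 0 < 2 * Real.pi by positivity)]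
        rw [abs_mul, abs_of_pos (show 0 < 2 * δlim by positivity)] at this
        nlinarith
      have h5 : |(m : ℝ)| < 1 := by
        by_contra! h6
        nlinarith
      have h6 : m = 0 := by
        have : |m| < 1 := by exact_mod_cast h5
        exact Int.abs_lt_one_iff.1 this
      rw [h6, Int.cast_zero, zero_mul] at h2
      exact hθ0 ((mul_eq_zero.1 h2).resolve_left (by positivity))
    · have hcont : Continuous fun x : ℝ => 1 - Complex.exp ((2 * x * θ : ℝ) * Complex.I) := by
        fun_prop
      simpa [Function.comp_def] using (hcont.tendsto δlim).comp hδl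
    · simpa using hu

end IsWindow

end SpectralCLT

namespace SpectralCLT

/-! ### Second moments of quadratic sums of a Gaussian process -/

section LagSum

variable {Ω : Type*} [MeasurableSpace Ω] {P : Measure Ω}

theorem IsCentredGaussianFamily.conj {J : Type*} [Fintype J] {Y : J → Ω → ℂ}
    (hY : IsCentredGaussianFamily Y P) (b : J → Bool) :
    IsCentredGaussianFamily
      (fun k ω => if b k then (starRingEnd ℂ) (Y k ω) else Y k ω) P := by
  intro s
  obtain ⟨v, hv⟩ := hY fun k => if b k then (starRingEnd ℂ) (s k) else s k
  refine ⟨v, hv ▸ ?_⟩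
  congr 2
  funext ω
  rw [Complex.re_sum, Complex.re_sum]
  refine Finset.sum_congr rfl fun k _ => ?_
  by_cases h : b k <;> simp [h]

theorem IsCentredGaussianFamily.isCentredGaussianVector {J : Type*} [Fintype J] {Y : J → Ω → ℂ}
    (hY : IsCentredGaussianFamily Y P) :
    IsCentredGaussianVector
      (fun (p : J × Bool) ω => if p.2 then (Y p.1 ω).im else (Y p.1 ω).re) P := by
  intro t
  obtain ⟨v, hv⟩ := hY fun k => (t (k, false) : ℂ) - t (k, true) * Complex.I
  refine ⟨v, hv ▸ ?_⟩
  congr 2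
  funext ω
  rw [Complex.re_sum, Fintype.sum_prod_type]
  refine Finset.sum_congr rfl fun k _ => ?_
  simp
  ring

/-- The centred quadratic sums with weights depending on the lag. -/
noncomputable def lagSum (P : Measure Ω) (n : ℕ) (k : ℤ → ℝ) (y₁ y₂ : ℕ → Ω → ℂ) (ω : Ω) : ℂ :=
  ∑ i ∈ Finset.Icc 1 n, ∑ j ∈ Finset.Icc 1 n, (k ((i : ℤ) - j) : ℂ) *
    (y₁ i ω * (starRingEnd ℂ) (y₂ j ω) - ∫ ω', y₁ i ω' * (starRingEnd ℂ) (y₂ j ω') ∂P)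

variable [IsProbabilityMeasure P]

theorem hasAllMoments_lagSum {y₁ y₂ : ℕ → Ω → ℂ} (h₁ : ∀ i, HasAllMoments (y₁ i) P)
    (h₂ : ∀ i, HasAllMoments (y₂ i) P) (n : ℕ) (k : ℤ → ℝ) :
    HasAllMoments (lagSum P n k y₁ y₂) P :=
  .finset_sum fun i _ => .finset_sum fun j _ => (((h₁ i).mul (h₂ j).star).sub_const _).const_mul _

theorem integral_lagSum {y₁ y₂ : ℕ → Ω → ℂ} (h₁ : ∀ i, HasAllMoments (y₁ i) P)
    (h₂ : ∀ i, HasAllMoments (y₂ i) P) (n : ℕ) (k : ℤ → ℝ) :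
    ∫ ω, lagSum P n k y₁ y₂ ω ∂P = 0 := by
  have hi : ∀ i j : ℕ, HasAllMoments (fun ω => (k ((i : ℤ) - j) : ℂ) *
      (y₁ i ω * (starRingEnd ℂ) (y₂ j ω) - ∫ ω', y₁ i ω' * (starRingEnd ℂ) (y₂ j ω') ∂P)) P :=
    fun i j => (((h₁ i).mul (h₂ j).star).sub_const _).const_mul _
  unfold lagSum
  rw [integral_finsetSum _ fun i _ => (HasAllMoments.finset_sum fun j _ => hi i j).integrable]
  refine Finset.sum_eq_zero fun i _ => ?_
  rw [integral_finsetSum _ fun j _ => (hi i j).integrable]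
  refine Finset.sum_eq_zero fun j _ => ?_
  rw [integral_const_mul, integral_sub ((h₁ i).mul (h₂ j).star).integrable (integrable_const _)]
  simp

/-- Isserlis for `y₁, conj y₂, conj y₃, y₄`. Of the three pairings, `(y₁, y₂)(y₃, y₄)` is cancelled
by the centring; the two others are a product of covariances and a product of pseudo-covariances. -/
theorem integral_lagSum_mul_conj {y₁ y₂ y₃ y₄ : ℕ → Ω → ℂ}
    (hY : ∀ i j i' j', IsCentredGaussianFamily ![y₁ i, y₂ j, y₃ i', y₄ j'] P)
    (n : ℕ) (k : ℤ → ℝ) :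
    ∫ ω, lagSum P n k y₁ y₂ ω * (starRingEnd ℂ) (lagSum P n k y₃ y₄ ω) ∂P =
      ∑ i ∈ Finset.Icc 1 n, ∑ j ∈ Finset.Icc 1 n, ∑ i' ∈ Finset.Icc 1 n, ∑ j' ∈ Finset.Icc 1 n,
        (k ((i : ℤ) - j) : ℂ) * k ((i' : ℤ) - j') *
        ((∫ ω, y₁ i ω * (starRingEnd ℂ) (y₃ i' ω) ∂P) *
          (starRingEnd ℂ) (∫ ω, y₂ j ω * (starRingEnd ℂ) (y₄ j' ω) ∂P) +
        (∫ ω, y₁ i ω * y₄ j' ω ∂P) * (starRingEnd ℂ) (∫ ω, y₂ j ω * y₃ i' ω ∂P)) := by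
  have h₁ : ∀ i, HasAllMoments (y₁ i) P := fun i => by
    simpa using (hY i i i i).hasAllMoments 0
  have h₂ : ∀ i, HasAllMoments (y₂ i) P := fun i => by
    simpa using (hY i i i i).hasAllMoments 1
  have h₃ : ∀ i, HasAllMoments (y₃ i) P := fun i => by
    simpa using (hY i i i i).hasAllMoments 2
  have h₄ : ∀ i, HasAllMoments (y₄ i) P := fun i => by
    simpa using (hY i i i i).hasAllMoments 3
  set u : ℕ → ℕ → Ω → ℂ := fun i j ω => y₁ i ω * (starRingEnd ℂ) (y₂ j ω) -
    ∫ ω', y₁ i ω' * (starRingEnd ℂ) (y₂ j ω') ∂P with hu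
  set v : ℕ → ℕ → Ω → ℂ := fun i j ω => y₃ i ω * (starRingEnd ℂ) (y₄ j ω) -
    ∫ ω', y₃ i ω' * (starRingEnd ℂ) (y₄ j ω') ∂P with hv
  have hum : ∀ i j, HasAllMoments (u i j) P := fun i j => ((h₁ i).mul (h₂ j).star).sub_const _
  have hvm : ∀ i j, HasAllMoments (v i j) P := fun i j => ((h₃ i).mul (h₄ j).star).sub_const _
  have key : ∀ i j i' j', ∫ ω, u i j ω * (starRingEnd ℂ) (v i' j' ω) ∂P =
      (∫ ω, y₁ i ω * (starRingEnd ℂ) (y₃ i' ω) ∂P) *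
          (starRingEnd ℂ) (∫ ω, y₂ j ω * (starRingEnd ℂ) (y₄ j' ω) ∂P) +
        (∫ ω, y₁ i ω * y₄ j' ω ∂P) * (starRingEnd ℂ) (∫ ω, y₂ j ω * y₃ i' ω ∂P) := by
    intro i j i' j'
    have h4 := ((hY i j i' j').conj ![false, true, true, false]).integral_mul_four
    simp at h4
    simp only [← integral_conj, map_mul, Complex.conj_conj]
    have e1 : ∀ ω, u i j ω * (starRingEnd ℂ) (v i' j' ω)
        = (y₁ i ω * (starRingEnd ℂ) (y₂ j ω) * (starRingEnd ℂ) (y₃ i' ω) * y₄ j' ω -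
          (∫ ω', y₁ i ω' * (starRingEnd ℂ) (y₂ j ω') ∂P) *
            ((starRingEnd ℂ) (y₃ i' ω) * y₄ j' ω)) -
          u i j ω * (∫ ω', (starRingEnd ℂ) (y₃ i' ω') * y₄ j' ω' ∂P) := fun ω => by
      simp only [hu, hv, map_sub, map_mul, Complex.conj_conj, ← integral_conj]
      ring
    have i1 : Integrable (fun ω => y₁ i ω * (starRingEnd ℂ) (y₂ j ω) *
        (starRingEnd ℂ) (y₃ i' ω) * y₄ j' ω) P :=
      ((((h₁ i).mul (h₂ j).star).mul (h₃ i').star).mul (h₄ j')).integrable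
    have i2 : Integrable (fun ω => (∫ ω', y₁ i ω' * (starRingEnd ℂ) (y₂ j ω') ∂P) *
        ((starRingEnd ℂ) (y₃ i' ω) * y₄ j' ω)) P :=
      (((h₃ i').star.mul (h₄ j')).const_mul _).integrable
    have i3 : Integrable (fun ω => y₁ i ω * (starRingEnd ℂ) (y₂ j ω) *
        (starRingEnd ℂ) (y₃ i' ω) * y₄ j' ω - (∫ ω', y₁ i ω' * (starRingEnd ℂ) (y₂ j ω') ∂P) *
        ((starRingEnd ℂ) (y₃ i' ω) * y₄ j' ω)) P := i1.sub i2
    have u0 : ∫ ω, u i j ω ∂P = 0 := by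
      simp only [hu]
      rw [integral_sub ((h₁ i).mul (h₂ j).star).integrable (integrable_const _)]
      simp
    simp_rw [e1]
    rw [integral_sub i3 ((hum i j).integrable.mul_const _), integral_sub i1 i2, h4,
      integral_const_mul, integral_mul_const, u0]
    ring
  have hexp : ∀ ω, lagSum P n k y₁ y₂ ω * (starRingEnd ℂ) (lagSum P n k y₃ y₄ ω)
      = ∑ i ∈ Finset.Icc 1 n, ∑ j ∈ Finset.Icc 1 n, ∑ i' ∈ Finset.Icc 1 n,
        ∑ j' ∈ Finset.Icc 1 n, (k ((i : ℤ) - j) : ℂ) * k ((i' : ℤ) - j') *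
          (u i j ω * (starRingEnd ℂ) (v i' j' ω)) := fun ω => by
    simp only [lagSum, map_sum, map_mul, Complex.conj_ofReal]
    rw [Finset.sum_mul]
    refine Finset.sum_congr rfl fun i _ => ?_
    rw [Finset.sum_mul]
    refine Finset.sum_congr rfl fun j _ => ?_
    rw [Finset.mul_sum]
    refine Finset.sum_congr rfl fun i' _ => ?_
    rw [Finset.mul_sum]
    refine Finset.sum_congr rfl fun j' _ => ?_
    simp only [hu, hv]
    ring
  have hm : ∀ i j i' j' : ℕ, HasAllMoments (fun ω => (k ((i : ℤ) - j) : ℂ) * k ((i' : ℤ) - j') *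
      (u i j ω * (starRingEnd ℂ) (v i' j' ω))) P := fun i j i' j' =>
    ((hum i j).mul (hvm i' j').star).const_mul _
  simp_rw [hexp]
  rw [integral_finsetSum _ fun i _ => (HasAllMoments.finset_sum fun j _ =>
    .finset_sum fun i' _ => .finset_sum fun j' _ => hm i j i' j').integrable]
  refine Finset.sum_congr rfl fun i _ => ?_
  rw [integral_finsetSum _ fun j _ => (HasAllMoments.finset_sum fun i' _ =>
    .finset_sum fun j' _ => hm i j i' j').integrable]
  refine Finset.sum_congr rfl fun j _ => ?_
  rw [integral_finsetSum _ fun i' _ =>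
    (HasAllMoments.finset_sum fun j' _ => hm i j i' j').integrable]
  refine Finset.sum_congr rfl fun i' _ => ?_
  rw [integral_finsetSum _ fun j' _ => (hm i j i' j').integrable]
  refine Finset.sum_congr rfl fun j' _ => ?_
  rw [integral_const_mul, key]

end LagSum

/-! ### Gaussian processes in a Hilbert space -/

section ProcessLaw

theorem inner_integral_apply {H : Type*} [NormedAddCommGroup H] [InnerProductSpace ℂ H]
    [CompleteSpace H] {Ω : Type*} [MeasurableSpace Ω] {P : Measure Ω} {W : Ω → H →L[ℂ] H}
    (hW : Integrable W P) (y z : H) :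
    inner ℂ y ((∫ ω, W ω ∂P) z) = ∫ ω, inner ℂ y (W ω z) ∂P := by
  let Φ : (H →L[ℂ] H) →L[ℂ] ℂ := (innerSL ℂ y).comp (ContinuousLinearMap.apply ℂ H z)
  have h1 : ∀ A : H →L[ℂ] H, Φ A = inner ℂ y (A z) := fun A => rfl
  rw [← h1, ← Φ.integral_comp_comm hW]
  rfl

theorem integrable_of_norm_eq_mul {H F Ω : Type*} [NormedAddCommGroup H] [NormedAddCommGroup F]
    [MeasurableSpace Ω] {P : Measure Ω} {Y Z : Ω → H}
    (hY : MemLp Y 2 P) (hZ : MemLp Z 2 P) {W : Ω → F} (hW : AEStronglyMeasurable W P)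
    (h : ∀ ω, ‖W ω‖ = ‖Y ω‖ * ‖Z ω‖) : Integrable W P := by
  have h1 : Integrable (fun ω => ‖Y ω‖ * ‖Z ω‖) P := hY.norm.integrable_mul hZ.norm
  exact h1.mono hW (ae_of_all _ fun ω => by rw [h, norm_mul, norm_norm, norm_norm])

variable {H : Type*} [NormedAddCommGroup H] [InnerProductSpace ℂ H] [CompleteSpace H]
  [TopologicalSpace.SeparableSpace H] [MeasurableSpace H] [BorelSpace H]
  {Ω : Type*} [MeasurableSpace Ω] {P : Measure Ω} {X : ℝ → Ω → H}

theorem isCentredGaussianFamily_inner (hgauss : IsGaussianProcess X P)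
    (hmean : ∀ t, ∫ ω, X t ω ∂P = 0) {J : Type*} [Fintype J] (v : J → H) (t : J → ℝ) :
    IsCentredGaussianFamily (fun k ω => inner ℂ (v k) (X (t k) ω)) P := by
  have : SecondCountableTopology H := UniformSpace.secondCountable_of_separable H
  intro s
  let L : J → H →L[ℝ] ℝ := fun k =>
    Complex.reCLM.comp ((innerSL ℂ ((starRingEnd ℂ) (s k) • v k)).restrictScalars ℝ)
  have hL : ∀ k x, L k x = (s k * inner ℂ (v k) x).re := fun k x => by
    simp [L]
  have h1 := ((hgauss.comp_right t).comp_left L).hasGaussianLaw_fun_sum (I := Finset.univ)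
  have h2 : (fun ω => ∑ k, L k ((X ∘ t) k ω))
      = fun ω => (∑ k, s k * inner ℂ (v k) (X (t k) ω)).re := by
    funext ω
    simp [hL, Complex.re_sum]
  have h3 := h1.map_eq_gaussianReal
  have h4 : ∫ ω, ∑ k, L k ((X ∘ t) k ω) ∂P = 0 := by
    have hint : ∀ k, Integrable (X (t k)) P := fun k => (hgauss.hasGaussianLaw_eval _).integrable
    simp only [Function.comp]
    rw [integral_finsetSum _ fun k _ => (L k).integrable_comp (hint k)]
    refine Finset.sum_eq_zero fun k _ => ?_
    rw [(L k).integral_comp_comm (hint k), hmean, map_zero]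
  rw [h4] at h3
  exact ⟨_, h2 ▸ h3⟩

theorem memLp_two_process (hgauss : IsGaussianProcess X P) (t : ℝ) : MemLp (X t) 2 P := by
  have : SecondCountableTopology H := UniformSpace.secondCountable_of_separable H
  exact (hgauss.hasGaussianLaw_eval t).memLp_two

theorem integrable_outer (hgauss : IsGaussianProcess X P) (t s : ℝ) :
    Integrable (fun ω => HSOperator.outer (X t ω) (X s ω)) P := by
  have h1 := memLp_two_process hgauss t
  have h2 := memLp_two_process hgauss s
  have hm : AEStronglyMeasurable (fun ω => HSOperator.outer (X t ω) (X s ω)) P :=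
    HSOperator.continuous_outer.comp_aestronglyMeasurable (f := fun ω => (X t ω, X s ω))
      (h1.1.prodMk h2.1)
  exact integrable_of_norm_eq_mul h1 h2 hm fun ω => HSOperator.norm_outer (X t ω) (X s ω)

theorem integrable_estimator (hgauss : IsGaussianProcess X P) (K : ℝ → ℝ) (n : ℕ) (δ Δ θ : ℝ) :
    Integrable (estimator X K n δ Δ θ) P := by
  unfold estimator
  refine Integrable.smul (𝕜 := ℂ) _ (integrable_finsetSum _ fun i _ =>
    integrable_finsetSum _ fun j _ => ?_)
  exact Integrable.smul (𝕜 := ℂ) _ (integrable_outer hgauss _ _)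

/-- Turns Bochner integrals of operators into scalar moments; square integrability of both factors
makes the rank-one operators integrable in operator norm. -/
theorem inner_integral_rankOne {Y Z : Ω → H} (hY : MemLp Y 2 P) (hZ : MemLp Z 2 P) (y z : H) :
    inner ℂ y ((∫ ω, InnerProductSpace.rankOne ℂ (Y ω) (Z ω) ∂P : H →L[ℂ] H) z)
      = ∫ ω, inner ℂ y (Y ω) * (starRingEnd ℂ) (inner ℂ z (Z ω)) ∂P := by
  have hc : Continuous fun p : H × H => InnerProductSpace.rankOne ℂ p.1 p.2 :=
    (ContinuousLinearMap.smulRightL ℂ H H).continuous₂.comp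
      (((innerSL ℂ).continuous.comp continuous_snd).prodMk continuous_fst)
  have hm : AEStronglyMeasurable
      (fun ω => (InnerProductSpace.rankOne ℂ (Y ω) (Z ω) : H →L[ℂ] H)) P :=
    hc.comp_aestronglyMeasurable (f := fun ω => (Y ω, Z ω)) (hY.1.prodMk hZ.1)
  have hint : Integrable (fun ω => (InnerProductSpace.rankOne ℂ (Y ω) (Z ω) : H →L[ℂ] H)) P :=
    integrable_of_norm_eq_mul hY hZ hm fun ω => InnerProductSpace.norm_rankOne (Y ω) (Z ω)
  rw [inner_integral_apply hint]
  refine integral_congr_ae (ae_of_all _ fun ω => ?_)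
  simp only [InnerProductSpace.rankOne_apply, inner_smul_right, inner_conj_symm]
  rw [mul_comm]

theorem inner_cov (hgauss : IsGaussianProcess X P) (t s : ℝ) (y z : H) :
    inner ℂ y (cov P X t s z)
      = ∫ ω, inner ℂ y (X t ω) * (starRingEnd ℂ) (inner ℂ z (X s ω)) ∂P :=
  inner_integral_rankOne (memLp_two_process hgauss t) (memLp_two_process hgauss s) y z

/-- The conjugations of `z` and of `X(s)` cancel in the inner product, which leaves a moment without
complex conjugates. -/
theorem inner_pcov (hgauss : IsGaussianProcess X P) {κ : Type*} (r : HilbertBasis κ ℂ H)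
    (t s : ℝ) (y z : H) :
    inner ℂ y (pcov r P X t s (conjH r z))
      = ∫ ω, inner ℂ y (X t ω) * inner ℂ z (X s ω) ∂P := by
  have h2 := memLp_two_process hgauss s
  have h3 : MemLp (fun ω => conjH r (X s ω)) 2 P := by
    refine h2.of_le ((continuous_conjH r).comp_aestronglyMeasurable h2.1)
      (ae_of_all _ fun ω => ?_)
    rw [norm_conjH]
  rw [pcov, inner_integral_rankOne (memLp_two_process hgauss t) h3]
  refine integral_congr_ae (ae_of_all _ fun ω => ?_)
  simp only [inner_conjH_conjH, inner_conj_symm]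

/-- The scalar process `⟨X(δ i), g⟩`, demodulated at the frequency `θ`. -/
noncomputable def coord (X : ℝ → Ω → H) (δ θ : ℝ) (g : H) (i : ℕ) (ω : Ω) : ℂ :=
  inner ℂ (Complex.exp (-(Complex.I * i * δ * θ)) • g) (X (δ * i) ω)

theorem coord_eq (δ θ : ℝ) (g : H) (i : ℕ) (ω : Ω) :
    coord X δ θ g i ω = Complex.exp (Complex.I * i * δ * θ) * inner ℂ g (X (δ * i) ω) := by
  rw [coord, inner_smul_left, ← Complex.exp_conj]
  simp

theorem isCentredGaussianFamily_coord (hgauss : IsGaussianProcess X P)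
    (hmean : ∀ t, ∫ ω, X t ω ∂P = 0) (δ θ : ℝ) {J : Type*} [Fintype J] (g : J → H) (i : J → ℕ) :
    IsCentredGaussianFamily (fun k => coord X δ θ (g k) (i k)) P :=
  isCentredGaussianFamily_inner hgauss hmean _ fun k => δ * i k

theorem hasAllMoments_coord (hgauss : IsGaussianProcess X P)
    (hmean : ∀ t, ∫ ω, X t ω ∂P = 0) (δ θ : ℝ) (g : H) (i : ℕ) :
    HasAllMoments (coord X δ θ g i) P :=
  (isCentredGaussianFamily_coord hgauss hmean δ θ (fun _ : Unit => g) fun _ => i).hasAllMoments ()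

/-- The demodulated covariance sequence. -/
noncomputable def covSeq (P : Measure Ω) (X : ℝ → Ω → H) (δ θ : ℝ) (y z : H) (d : ℤ) : ℂ :=
  Complex.exp (Complex.I * d * δ * θ) * inner ℂ y (statCov P X (d * δ) z)

/-- The demodulated pseudo-covariance sequence. -/
noncomputable def pcovSeq {κ : Type*} (r : HilbertBasis κ ℂ H) (P : Measure Ω) (X : ℝ → Ω → H)
    (δ θ : ℝ) (y z : H) (d : ℤ) : ℂ :=
  Complex.exp (Complex.I * d * δ * (-θ : ℝ)) * inner ℂ y (statPCov r P X (d * δ) (conjH r z))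

variable {κ : Type*} {r : HilbertBasis κ ℂ H}

theorem integral_coord_mul_conj (hgauss : IsGaussianProcess X P) (hstat : IsStationary r P X)
    (δ θ : ℝ) (y z : H) (i j : ℕ) :
    ∫ ω, coord X δ θ y i ω * (starRingEnd ℂ) (coord X δ θ z j ω) ∂P
      = covSeq P X δ θ y z ((i : ℤ) - j) := by
  have h1 := hstat.cov_eq ((((i : ℤ) - j : ℤ) : ℝ) * δ) 0 (δ * j)
  rw [show (((i : ℤ) - j : ℤ) : ℝ) * δ + δ * j = δ * i by push_cast; ring, zero_add] at h1
  rw [covSeq, statCov, ← h1, inner_cov hgauss, ← integral_const_mul]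
  refine integral_congr_ae (ae_of_all _ fun ω => ?_)
  simp only [coord_eq, map_mul, ← Complex.exp_conj, Complex.conj_I, Complex.conj_ofReal,
    Complex.conj_natCast]
  have h2 : Complex.exp (Complex.I * ((i : ℤ) - j : ℤ) * δ * θ)
      = Complex.exp (Complex.I * i * δ * θ) * Complex.exp (-Complex.I * j * δ * θ) := by
    rw [← Complex.exp_add]
    congr 1
    push_cast
    ring
  rw [h2]
  ring

/-- Without conjugation the phases add: `e^{i(i+j)δθ} = e^{2iiδθ} e^{-i(i-j)δθ}`, where the second
factor depends on the lag alone. This explains the sign `-θ` in the pseudo-spectral density, and the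
residual phase is the source of `c(θ)`. -/
theorem integral_coord_mul (hgauss : IsGaussianProcess X P) (hstat : IsStationary r P X)
    (δ θ : ℝ) (y z : H) (i j : ℕ) :
    ∫ ω, coord X δ θ y i ω * coord X δ θ z j ω ∂P
      = Complex.exp (2 * Complex.I * i * δ * θ) * pcovSeq r P X δ θ y z ((i : ℤ) - j) := by
  have h1 := hstat.pcov_eq ((((i : ℤ) - j : ℤ) : ℝ) * δ) 0 (δ * j)
  rw [show (((i : ℤ) - j : ℤ) : ℝ) * δ + δ * j = δ * i by push_cast; ring, zero_add] at h1
  rw [pcovSeq, statPCov, ← h1, inner_pcov hgauss, ← mul_assoc, ← Complex.exp_add,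
    ← integral_const_mul]
  refine integral_congr_ae (ae_of_all _ fun ω => ?_)
  simp only [coord_eq]
  have h2 : Complex.exp (2 * Complex.I * i * δ * θ +
        Complex.I * ((i : ℤ) - j : ℤ) * δ * (-θ : ℝ))
      = Complex.exp (Complex.I * i * δ * θ) * Complex.exp (Complex.I * j * δ * θ) := by
    rw [← Complex.exp_add]
    congr 1
    push_cast
    ring
  rw [h2]
  ring

/-- A moment `E[UV]` without conjugates is symmetric in its factors, so exchanging the vectors
reverses the lag. -/
theorem inner_statPCov_symm (hgauss : IsGaussianProcess X P) (hstat : IsStationary r P X)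
    (δ : ℝ) (y z : H) (d : ℤ) :
    inner ℂ y (statPCov r P X (d * δ) (conjH r z))
      = inner ℂ z (statPCov r P X ((-d : ℤ) * δ) (conjH r y)) := by
  have h1 := hstat.pcov_eq (((-d : ℤ) : ℝ) * δ) 0 (d * δ)
  rw [show ((-d : ℤ) : ℝ) * δ + d * δ = 0 by push_cast; ring, zero_add] at h1
  rw [statPCov, statPCov, ← h1, inner_pcov hgauss, inner_pcov hgauss]
  simp_rw [mul_comm]

/-- In the second pairing `i` meets `j'` and `j` meets `i'`; renaming `i'` and `j'` gives the same
type of quadruple sum because `k` is even. The residual phases at `i` and `j` combine to a power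
with exponent `i - j` and are absorbed in the first window. -/
theorem integral_lagSum_coord [IsProbabilityMeasure P] (hgauss : IsGaussianProcess X P)
    (hmean : ∀ t, ∫ ω, X t ω ∂P = 0) (hstat : IsStationary r P X) (n : ℕ) {k : ℤ → ℝ}
    (hk : ∀ d, k (-d) = k d) (δ θ : ℝ) (g₁ g₂ g₃ g₄ : H) :
    ∫ ω, lagSum P n k (coord X δ θ g₁) (coord X δ θ g₂) ω *
        (starRingEnd ℂ) (lagSum P n k (coord X δ θ g₃) (coord X δ θ g₄) ω) ∂P =
      quadSum n (fun d => k d) (fun d => k d) (covSeq P X δ θ g₁ g₃)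
        (fun d => (starRingEnd ℂ) (covSeq P X δ θ g₂ g₄ d)) +
      quadSum n (fun d => k d * Complex.exp ((2 * δ * θ : ℝ) * Complex.I) ^ d) (fun d => k d)
        (pcovSeq r P X δ θ g₁ g₄) (fun d => (starRingEnd ℂ) (pcovSeq r P X δ θ g₂ g₃ d)) := by
  rw [integral_lagSum_mul_conj]
  · simp_rw [integral_coord_mul_conj hgauss hstat, integral_coord_mul hgauss hstat, mul_add,
      Finset.sum_add_distrib]
    rw [quadSum, quadSum]
    congr 1
    refine Finset.sum_congr rfl fun i _ => Finset.sum_congr rfl fun j _ => ?_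
    rw [Finset.sum_comm]
    refine Finset.sum_congr rfl fun j' _ => Finset.sum_congr rfl fun i' _ => ?_
    have h1 : Complex.exp (2 * Complex.I * i * δ * θ) *
        (starRingEnd ℂ) (Complex.exp (2 * Complex.I * j * δ * θ))
        = Complex.exp ((2 * δ * θ : ℝ) * Complex.I) ^ ((i : ℤ) - j) := by
      rw [← Complex.exp_conj, ← Complex.exp_add, ← Complex.exp_int_mul]
      congr 1
      have h2 : (starRingEnd ℂ) 2 = 2 := Complex.conj_ofNat 2
      simp only [map_mul, Complex.conj_I, Complex.conj_ofReal, Complex.conj_natCast, h2]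
      push_cast
      ring
    rw [← h1, ← hk ((i' : ℤ) - j'), neg_sub, map_mul]
    ring
  · intro i j i' j'
    convert! isCentredGaussianFamily_coord hgauss hmean δ θ ![g₁, g₂, g₃, g₄] ![i, j, i', j']
      using 1
    funext l
    fin_cases l <;> rfl

theorem inner_normalizedError [IsProbabilityMeasure P] (hgauss : IsGaussianProcess X P)
    (hmean : ∀ t, ∫ ω, X t ω ∂P = 0) (K : ℝ → ℝ) (n : ℕ) (δ Δ θ : ℝ) (g₁ g₂ : H) (ω : Ω) :
    inner ℂ g₁ (HSOperator.toCLM (normalizedError P X K n δ Δ θ ω) g₂)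
      = ((√(n * δ / Δ) * (δ / (2 * Real.pi * n)) : ℝ) : ℂ) *
        lagSum P n (fun d => K (d * (δ / Δ))) (coord X δ θ g₁) (coord X δ θ g₂) ω := by
  have hest : ∀ ω, inner ℂ (HSOperator.outer g₁ g₂) (estimator X K n δ Δ θ ω)
      = ((δ / (2 * Real.pi * n) : ℝ) : ℂ) * ∑ i ∈ Finset.Icc 1 n, ∑ j ∈ Finset.Icc 1 n,
        (K (((i : ℤ) - j : ℤ) * (δ / Δ)) : ℂ) *
          (coord X δ θ g₁ i ω * (starRingEnd ℂ) (coord X δ θ g₂ j ω)) := fun ω => by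
    rw [estimator, inner_smul_right, inner_sum]
    congr 1
    refine Finset.sum_congr rfl fun i _ => ?_
    rw [inner_sum]
    refine Finset.sum_congr rfl fun j _ => ?_
    rw [inner_smul_right, HSOperator.inner_outer, HSOperator.toCLM_outer, inner_smul_right,
      coord_eq, coord_eq, map_mul, inner_conj_symm, ← Complex.exp_conj]
    have h1 : Complex.exp (Complex.I * ((i : ℂ) - (j : ℂ)) * δ * θ)
        = Complex.exp (Complex.I * i * δ * θ) *
          Complex.exp ((starRingEnd ℂ) (Complex.I * j * δ * θ)) := by
      rw [← Complex.exp_add]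
      congr 1
      simp only [map_mul, Complex.conj_I, Complex.conj_ofReal, Complex.conj_natCast]
      ring
    have h2 : ((i : ℝ) - (j : ℝ)) / Δ * δ = ((i : ℤ) - j : ℤ) * (δ / Δ) := by
      push_cast
      ring
    rw [h1, h2]
    ring
  have hint := integrable_estimator hgauss K n δ Δ θ
  have hm := hasAllMoments_coord hgauss hmean δ θ
  rw [← HSOperator.inner_outer, normalizedError, inner_smul_right, inner_sub_right,
    ← integral_inner hint]
  simp_rw [hest]
  rw [integral_const_mul, ← mul_sub, ← mul_assoc, ← Complex.ofReal_mul,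
    integral_finsetSum _ fun i _ => (HasAllMoments.finset_sum fun j _ =>
      ((hm g₁ i).mul (hm g₂ j).star).const_mul _).integrable, ← Finset.sum_sub_distrib]
  congr 1
  rw [lagSum]
  refine Finset.sum_congr rfl fun i _ => ?_
  rw [integral_finsetSum _ fun j _ => (((hm g₁ i).mul (hm g₂ j).star).const_mul _).integrable,
    ← Finset.sum_sub_distrib]
  refine Finset.sum_congr rfl fun j _ => ?_
  rw [integral_const_mul, mul_sub]

theorem aemeasurable_normalizedError (hgauss : IsGaussianProcess X P) (K : ℝ → ℝ) (n : ℕ)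
    (δ Δ θ : ℝ) : AEMeasurable (normalizedError P X K n δ Δ θ) P := by
  have hint := integrable_estimator hgauss K n δ Δ θ
  exact ((hint.1.sub aestronglyMeasurable_const).const_smul (𝕜 := ℂ) _).aemeasurable

end ProcessLaw

end SpectralCLT

namespace SpectralCLT

/-! ### Consequences of the assumptions -/

namespace HasMassBound

variable {γ : ℤ → ℂ} {δ L M M' τ τ' : ℝ}

theorem mono (h : HasMassBound γ δ L M τ) (hM : M ≤ M') (hτ : τ ≤ τ') :
    HasMassBound γ δ L M' τ' :=
  ⟨fun s => (h.mass s).trans hM, fun s hs => (h.tail s hs).trans hτ⟩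

theorem conj (h : HasMassBound γ δ L M τ) :
    HasMassBound (fun d => (starRingEnd ℂ) (γ d)) δ L M τ :=
  ⟨fun s => by simpa using h.mass s, fun s hs => by simpa using h.tail s hs⟩

end HasMassBound

theorem mul_sum_le_toReal {γ : ℤ → ℂ} {δ : ℝ} (hδ : 0 ≤ δ) {s : Finset ℤ} {b : ℝ≥0∞} (hb : b ≠ ∞)
    (h : ENNReal.ofReal δ * ∑ d ∈ s, ‖γ d‖ₑ ≤ b) : δ * ∑ d ∈ s, ‖γ d‖ ≤ b.toReal := by
  rw [← ENNReal.ofReal_le_iff_le_toReal hb, ENNReal.ofReal_mul hδ,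
    ENNReal.ofReal_sum_of_nonneg fun _ _ => norm_nonneg _]
  simpa [ofReal_norm] using h

/-! ### From trace-norm bounds on operators to scalar sequences. -/

section Trace

variable {H : Type*} [NormedAddCommGroup H] [InnerProductSpace ℂ H] [CompleteSpace H]

theorem hasMassBound_of_traceNorm {A : ℤ → H →L[ℂ] H} {c : ℤ → ℂ} (hc : ∀ d, ‖c d‖ = 1)
    {δ L : ℝ} (hδ : 0 ≤ δ) {M τ : ℝ≥0∞} (hM : M ≠ ∞) (hτ : τ ≠ ∞)
    (hAM : ENNReal.ofReal δ * ∑' x : ℤ, traceNorm (A x) ≤ M)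
    (hAτ : ENNReal.ofReal δ * ∑' x : {x : ℤ // L < |(x : ℝ)|}, traceNorm (A x) ≤ τ) (y z : H) :
    HasMassBound (fun d => c d * inner ℂ y (A d z)) δ L (‖y‖ * ‖z‖ * M.toReal)
      (‖y‖ * ‖z‖ * τ.toReal) := by
  have hpt : ∀ d, ‖c d * inner ℂ y (A d z)‖ₑ ≤ ‖y‖ₑ * ‖z‖ₑ * traceNorm (A d) := fun d => by
    rw [enorm_mul, ← ofReal_norm (c d), hc, ENNReal.ofReal_one, one_mul, mul_comm (_ * _)]
    exact enorm_inner_apply_le_traceNorm _ _ _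
  have hyz : ∀ b : ℝ≥0∞, (‖y‖ₑ * ‖z‖ₑ * b).toReal = ‖y‖ * ‖z‖ * b.toReal := fun b => by
    simp
  have hfin : ∀ b : ℝ≥0∞, b ≠ ∞ → ‖y‖ₑ * ‖z‖ₑ * b ≠ ∞ := fun b hb => by finiteness
  refine ⟨fun s => ?_, fun s hs => ?_⟩
  · rw [← hyz]
    refine mul_sum_le_toReal hδ (hfin _ hM) ?_
    calc _ ≤ ENNReal.ofReal δ * ∑ d ∈ s, ‖y‖ₑ * ‖z‖ₑ * traceNorm (A d) := by
          gcongr with d _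
          exact hpt d
      _ = ‖y‖ₑ * ‖z‖ₑ * (ENNReal.ofReal δ * ∑ d ∈ s, traceNorm (A d)) := by
          rw [← Finset.mul_sum]
          ring
      _ ≤ _ := by
          gcongr
          exact (mul_le_mul_right (ENNReal.sum_le_tsum s) _).trans hAM
  · rw [← hyz]
    refine mul_sum_le_toReal hδ (hfin _ hτ) ?_
    calc _ ≤ ENNReal.ofReal δ * ∑ d ∈ s, ‖y‖ₑ * ‖z‖ₑ * traceNorm (A d) := by
          gcongr with d _
          exact hpt d
      _ = ‖y‖ₑ * ‖z‖ₑ * (ENNReal.ofReal δ * ∑ d ∈ s, traceNorm (A d)) := by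
          rw [← Finset.mul_sum]
          ring
      _ ≤ _ := by
          gcongr
          refine (mul_le_mul_right ?_ _).trans hAτ
          classical
          rw [← Finset.sum_subtype_of_mem (p := fun d : ℤ => L < |(d : ℝ)|)
            (fun d => traceNorm (A d)) hs]
          exact ENNReal.sum_le_tsum _

/-- Trace-norm summability implies absolute convergence in operator norm, so the pairing with `y`
and `z` may be taken inside the series. -/
theorem inner_foldedTransform {C : ℝ → H →L[ℂ] H} {θ δ : ℝ} (hδ : 0 < δ)
    (hC : ∑' k : ℤ, traceNorm (C (k * δ)) ≠ ∞) (y z : H) :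
    inner ℂ y (foldedTransform C θ δ z) = ((δ / (2 * Real.pi) : ℝ) : ℂ) *
      ∑' k : ℤ, Complex.exp (Complex.I * k * δ * θ) * inner ℂ y (C (k * δ) z) := by
  let Φ : (H →L[ℂ] H) →L[ℂ] ℂ := (innerSL ℂ y).comp (ContinuousLinearMap.apply ℂ H z)
  have h1 : ∀ A : H →L[ℂ] H, inner ℂ y (A z) = Φ A := fun A => rfl
  have hs : Summable fun k : ℤ => Complex.exp (Complex.I * k * δ * θ) • C (k * δ) := by
    refine Summable.of_norm ?_
    refine (ENNReal.summable_toReal hC).of_nonneg_of_le (fun _ => norm_nonneg _) fun k => ?_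
    have h2 : ‖Complex.exp (Complex.I * k * δ * θ)‖ = 1 := by
      rw [show Complex.I * k * δ * θ = ((k * δ * θ : ℝ) : ℂ) * Complex.I by push_cast; ring,
        Complex.norm_exp_ofReal_mul_I]
    rw [norm_smul, h2, one_mul, ← toReal_enorm]
    exact ENNReal.toReal_mono (ENNReal.ne_top_of_tsum_ne_top hC k) (enorm_le_traceNorm _)
  rw [foldedTransform, if_neg hδ.ne', h1, map_smul, Φ.map_tsum hs, smul_eq_mul]
  congr 1
  refine tsum_congr fun k => ?_
  rw [map_smul, smul_eq_mul, h1]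

theorem tendsto_inner_of_traceNorm {A : ℕ → H →L[ℂ] H} {B : H →L[ℂ] H}
    (h : Tendsto (fun n => traceNorm (A n - B)) atTop (𝓝 0)) (y z : H) :
    Tendsto (fun n => inner ℂ y (A n z)) atTop (𝓝 (inner ℂ y (B z))) := by
  rw [tendsto_iff_edist_tendsto_0]
  have h2 : Tendsto (fun n => traceNorm (A n - B) * (‖y‖ₑ * ‖z‖ₑ)) atTop (𝓝 0) := by
    have := ENNReal.Tendsto.mul_const h (b := ‖y‖ₑ * ‖z‖ₑ) (Or.inr (by finiteness))
    simpa using this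
  refine tendsto_of_tendsto_of_tendsto_of_le_of_le tendsto_const_nhds h2 (fun _ => zero_le)
    fun n => ?_
  rw [edist_eq_enorm_sub, ← inner_sub_right, ← sub_apply]
  exact enorm_inner_apply_le_traceNorm _ _ _

end Trace

/-! ### Limits of the second moments of the normalized error. -/

section Moments

variable {H : Type*} [NormedAddCommGroup H] [InnerProductSpace ℂ H] [CompleteSpace H]
  {Ω : Type*} [MeasurableSpace Ω] {P : Measure Ω} {X : ℝ → Ω → H}
  {κ ι : Type*} {r : HilbertBasis κ ℂ H} {e : HilbertBasis ι ℂ H} {δ Δ : ℕ → ℝ} {δlim θ : ℝ}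

namespace CLTCondition

theorem eventually_mesh_pos (h : CLTCondition r e P X δ Δ δlim θ) : ∀ᶠ n in atTop, 0 < δ n :=
  eventually_atTop.2 ⟨1, h.mesh_pos⟩

theorem eventually_bandwidth_pos (h : CLTCondition r e P X δ Δ δlim θ) :
    ∀ᶠ n in atTop, 0 < Δ n :=
  eventually_atTop.2 ⟨1, h.bandwidth_pos⟩

/-- Divergence of the bandwidth is hidden in the tail conditions: `L_n δ_n → ∞` with bounded `δ_n`
gives `L_n → ∞`, and eventually `L_n ≤ Δ_n`. -/
theorem tendsto_bandwidth (h : CLTCondition r e P X δ Δ δlim θ) : Tendsto Δ atTop atTop := by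
  obtain ⟨L, hL, hLδ, hLΔ, -, -⟩ := h.tails
  obtain ⟨D, hD⟩ := h.mesh_tendsto.bddAbove_range
  have hD0 : 0 < |D| + 1 := by positivity
  have hLt : Tendsto L atTop atTop := by
    refine tendsto_atTop_mono' _ ?_ (hLδ.const_mul_atTop (inv_pos.2 hD0))
    filter_upwards [h.eventually_mesh_pos, eventually_ge_atTop 1] with n h1 h2
    rw [inv_mul_le_iff₀ hD0, mul_comm]
    have : δ n ≤ |D| + 1 := (hD ⟨n, rfl⟩).trans ((le_abs_self D).trans (by linarith))
    exact mul_le_mul_of_nonneg_right this (hL n h2).le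
  refine tendsto_atTop_mono' _ ?_ hLt
  filter_upwards [h.eventually_bandwidth_pos, hLΔ.eventually_lt_const one_pos] with n h1 h2
  rw [div_lt_one h1] at h2
  exact h2.le

theorem tendsto_mesh_div_bandwidth (h : CLTCondition r e P X δ Δ δlim θ) :
    Tendsto (fun n => δ n / Δ n) atTop (𝓝 0) :=
  h.mesh_tendsto.div_atTop h.tendsto_bandwidth

theorem tendsto_mul_mesh_div_bandwidth (h : CLTCondition r e P X δ Δ δlim θ) :
    Tendsto (fun n : ℕ => n * (δ n / Δ n)) atTop atTop :=
  h.ratio_tendsto.congr fun n => by ring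

/-- The covariance and pseudo-covariance sequences have uniformly bounded mass and negligible
tails. -/
theorem exists_hasMassBound (h : CLTCondition r e P X δ Δ δlim θ) :
    ∃ (L τ : ℕ → ℝ) (M : ℝ), (∀ᶠ n in atTop, 0 ≤ L n) ∧
      Tendsto (fun n => L n * (δ n / Δ n)) atTop (𝓝 0) ∧ Tendsto τ atTop (𝓝 0) ∧
      (∀ n, 0 ≤ τ n) ∧ 0 ≤ M ∧ ∀ᶠ n in atTop, ∀ y z : H,
        HasMassBound (covSeq P X (δ n) θ y z) (δ n) (L n) (‖y‖ * ‖z‖ * M) (‖y‖ * ‖z‖ * τ n) ∧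
        HasMassBound (pcovSeq r P X (δ n) θ y z) (δ n) (L n) (‖y‖ * ‖z‖ * M)
          (‖y‖ * ‖z‖ * τ n) := by
  obtain ⟨L, hL, -, hLΔ, hτ₁, hτ₂⟩ := h.tails
  obtain ⟨M₁, hM₁⟩ := h.cov_summable
  obtain ⟨M₂, hM₂⟩ := h.pcov_summable
  set τ₁ : ℕ → ℝ≥0∞ := fun n => ENNReal.ofReal (δ n) *
    ∑' x : {x : ℤ // L n < |(x : ℝ)|}, traceNorm (statCov P X (δ n * (x : ℤ))) with hτ₁'
  set τ₂ : ℕ → ℝ≥0∞ := fun n => ENNReal.ofReal (δ n) *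
    ∑' x : {x : ℤ // L n < |(x : ℝ)|}, traceNorm (statPCov r P X (δ n * (x : ℤ))) with hτ₂'
  have t₁ := (ENNReal.tendsto_toReal ENNReal.zero_ne_top).comp hτ₁
  have t₂ := (ENNReal.tendsto_toReal ENNReal.zero_ne_top).comp hτ₂
  refine ⟨L, fun n => (τ₁ n).toReal + (τ₂ n).toReal, M₁ + M₂,
    eventually_atTop.2 ⟨1, fun n hn => (hL n hn).le⟩, ?_, by simpa using t₁.add t₂,
    fun n => by positivity, by positivity, ?_⟩
  · have := hLΔ.mul h.mesh_tendsto
    rw [zero_mul] at this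
    exact this.congr fun n => by ring
  filter_upwards [h.eventually_mesh_pos, eventually_ge_atTop 1,
    hτ₁.eventually_ne ENNReal.zero_ne_top, hτ₂.eventually_ne ENNReal.zero_ne_top]
    with n hδ hn f₁ f₂ y z
  have hexp : ∀ x : ℝ, ‖Complex.exp (Complex.I * x)‖ = 1 := fun x => by
    rw [mul_comm, Complex.norm_exp_ofReal_mul_I]
  have c₁ : ∀ d : ℤ, ‖Complex.exp (Complex.I * d * δ n * θ)‖ = 1 := fun d => by
    have := hexp (d * δ n * θ)
    push_cast at this
    rwa [mul_assoc, mul_assoc, ← mul_assoc (d : ℂ)]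
  have c₂ : ∀ d : ℤ, ‖Complex.exp (Complex.I * d * δ n * (-θ : ℝ))‖ = 1 := fun d => by
    have := hexp (d * δ n * (-θ : ℝ))
    push_cast at this ⊢
    rwa [mul_assoc, mul_assoc, ← mul_assoc (d : ℂ)]
  have b₁ := hasMassBound_of_traceNorm (A := fun d : ℤ => statCov P X (d * δ n)) c₁ hδ.le
    (L := L n)     ENNReal.coe_ne_top f₁ (by simpa only [mul_comm] using hM₁ n hn)
    (le_of_eq (by simp only [hτ₁', mul_comm])) y z
  have b₂ := hasMassBound_of_traceNorm (A := fun d : ℤ => statPCov r P X (d * δ n)) c₂ hδ.le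
    (L := L n)     ENNReal.coe_ne_top f₂ (by simpa only [mul_comm] using hM₂ n hn)
    (le_of_eq (by simp only [hτ₂', mul_comm])) y (conjH r z)
  rw [norm_conjH] at b₂
  refine ⟨b₁.mono ?_ ?_, b₂.mono ?_ ?_⟩
  · refine mul_le_mul_of_nonneg_left ?_ (by positivity)
    simp
  · exact mul_le_mul_of_nonneg_left (by simp) (by positivity)
  · refine mul_le_mul_of_nonneg_left ?_ (by positivity)
    simp
  · exact mul_le_mul_of_nonneg_left (by simp) (by positivity)

theorem tendsto_tsum_covSeq (h : CLTCondition r e P X δ Δ δlim θ) (y z : H) :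
    Tendsto (fun n => ((δ n / (2 * Real.pi) : ℝ) : ℂ) * ∑' d, covSeq P X (δ n) θ y z d) atTop
      (𝓝 (inner ℂ y (specDensity P X θ δlim z))) := by
  obtain ⟨M, hM⟩ := h.cov_summable
  refine (tendsto_inner_of_traceNorm h.spec_tendsto y z).congr' ?_
  filter_upwards [h.eventually_mesh_pos, eventually_ge_atTop 1] with n hδ hn
  refine inner_foldedTransform hδ (fun htop => ?_) y z
  have := hM n hn
  simp_rw [mul_comm (δ n)] at this
  rw [htop, ENNReal.mul_top (by simpa using hδ)] at this
  simp at this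

theorem tendsto_tsum_pcovSeq (h : CLTCondition r e P X δ Δ δlim θ) (y z : H) :
    Tendsto (fun n => ((δ n / (2 * Real.pi) : ℝ) : ℂ) * ∑' d, pcovSeq r P X (δ n) θ y z d) atTop
      (𝓝 (inner ℂ y (pseudoSpecDensity r P X θ δlim (conjH r z)))) := by
  obtain ⟨M, hM⟩ := h.pcov_summable
  refine (tendsto_inner_of_traceNorm h.pspec_tendsto y (conjH r z)).congr' ?_
  filter_upwards [h.eventually_mesh_pos, eventually_ge_atTop 1] with n hδ hn
  refine inner_foldedTransform hδ (fun htop => ?_) y (conjH r z)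
  have := hM n hn
  simp_rw [mul_comm (δ n)] at this
  rw [htop, ENNReal.mul_top (by simpa using hδ)] at this
  simp at this

end CLTCondition

variable [TopologicalSpace.SeparableSpace H] [MeasurableSpace H] [BorelSpace H]
  [IsProbabilityMeasure P] {K : ℝ → ℝ}

theorem integral_inner_normalizedError (hgauss : IsGaussianProcess X P)
    (hmean : ∀ t, ∫ ω, X t ω ∂P = 0) (hstat : IsStationary r P X) (hsymm : ∀ x, K (-x) = K x)
    {n : ℕ} (hn : 1 ≤ n) {δ Δ : ℝ} (hδ : 0 < δ) (hΔ : 0 < Δ) (θ : ℝ) (g₁ g₂ g₃ g₄ : H) :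
    ∫ ω, inner ℂ g₁ (HSOperator.toCLM (normalizedError P X K n δ Δ θ ω) g₂) *
      (starRingEnd ℂ) (inner ℂ g₃ (HSOperator.toCLM (normalizedError P X K n δ Δ θ ω) g₄)) ∂P =
    ((δ ^ 3 / (4 * Real.pi ^ 2 * (n * Δ)) : ℝ) : ℂ) *
      quadSum n (fun d => K (d * (δ / Δ))) (fun d => K (d * (δ / Δ))) (covSeq P X δ θ g₁ g₃)
        (fun d => (starRingEnd ℂ) (covSeq P X δ θ g₂ g₄ d)) +
    ((δ ^ 3 / (4 * Real.pi ^ 2 * (n * Δ)) : ℝ) : ℂ) *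
      quadSum n (fun d => K (d * (δ / Δ)) * Complex.exp ((2 * δ * θ : ℝ) * Complex.I) ^ d)
        (fun d => K (d * (δ / Δ))) (pcovSeq r P X δ θ g₁ g₄)
        (fun d => (starRingEnd ℂ) (pcovSeq r P X δ θ g₂ g₃ d)) := by
  have hn0 : (0 : ℝ) < n := by exact_mod_cast hn
  -- The square of the scalar prefactor of `lagSum` in `𝒯_n`.
  have hc : (√(n * δ / Δ) * (δ / (2 * Real.pi * n))) * (√(n * δ / Δ) * (δ / (2 * Real.pi * n)))
      = δ ^ 3 / (4 * Real.pi ^ 2 * (n * Δ)) := by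
    have h1 : √(n * δ / Δ) * √(n * δ / Δ) = n * δ / Δ := Real.mul_self_sqrt (by positivity)
    have := Real.pi_pos
    calc _ = (√(n * δ / Δ) * √(n * δ / Δ)) * (δ / (2 * Real.pi * n)) ^ 2 := by ring
      _ = _ := by
        rw [h1]
        field_simp
        ring
  simp_rw [inner_normalizedError hgauss hmean, map_mul, Complex.conj_ofReal,
    mul_mul_mul_comm ((√(n * δ / Δ) * (δ / (2 * Real.pi * n)) : ℝ) : ℂ)]
  rw [integral_const_mul, integral_lagSum_coord hgauss hmean hstat n (fun d => by
    rw [Int.cast_neg, neg_mul, hsymm]), ← Complex.ofReal_mul, hc, mul_add]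

/-- In each quadruple sum the two sequences are conjugate to each other, so the two Fourier limits
multiply to a squared modulus. The window limit is `∫ K²` for the covariance sum (`z = 1`) and `c(θ)
∫ K²` for the pseudo-covariance sum. -/
theorem tendsto_integral_inner_normalizedError (hgauss : IsGaussianProcess X P)
    (hmean : ∀ t, ∫ ω, X t ω ∂P = 0) (hstat : IsStationary r P X) (hK : KernelCondition K)
    (h : CLTCondition r e P X δ Δ δlim θ) (hθ : 0 < δlim → |θ| ≤ Real.pi / δlim)
    (hedge : 0 < δlim → |θ| = Real.pi / δlim →
      Tendsto (fun n => Δ n * (δ n - δlim)) atTop (𝓝 0)) (g g' : H) :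
    Tendsto (fun n => ∫ ω,
      inner ℂ g (HSOperator.toCLM (normalizedError P X K n (δ n) (Δ n) θ ω) g) *
      (starRingEnd ℂ) (inner ℂ g' (HSOperator.toCLM
        (normalizedError P X K n (δ n) (Δ n) θ ω) g')) ∂P) atTop
      (𝓝 (((∫ x, K x ^ 2) * (‖inner ℂ g (specDensity P X θ δlim g')‖ ^ 2 + cInd θ δlim *
        ‖inner ℂ g (pseudoSpecDensity r P X θ δlim (conjH r g'))‖ ^ 2) : ℝ) : ℂ)) := by
  obtain ⟨B, R, T, hW⟩ := hK.exists_isWindow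
  obtain ⟨L, τ, M, hL, hLh, hτ, -, -, hmass⟩ := h.exists_hasMassBound
  set c := ‖g‖ * ‖g'‖ with hcdef
  have hconj : ∀ {a : ℕ → ℝ} {γ : ℕ → ℤ → ℂ} {F : ℂ},
      Tendsto (fun n => (a n : ℂ) * ∑' d, γ n d) atTop (𝓝 F) →
      Tendsto (fun n => (a n : ℂ) * ∑' d, (starRingEnd ℂ) (γ n d)) atTop
        (𝓝 ((starRingEnd ℂ) F)) := fun {a γ F} ht => by
    refine ((Complex.continuous_conj.tendsto F).comp ht).congr fun n => ?_
    simp [Complex.conj_tsum]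
  have h1 := hW.tendsto_scaled_quadSum (τ := fun n => c * τ n) (M := c * M) h.eventually_mesh_pos
    h.eventually_bandwidth_pos hL h.tendsto_mesh_div_bandwidth h.tendsto_mul_mesh_div_bandwidth
    hLh (by simpa using hτ.const_mul c) (z := fun _ => 1) (fun _ => by simp)
    (hmass.mono fun n hn => (hn g g').1) (hmass.mono fun n hn => (hn g g').1.conj)
    (ω := ((∫ x, K x ^ 2 : ℝ) : ℂ)) (by
      have := (Complex.continuous_ofReal.tendsto _).comp (hW.tendsto_riemannSum_sq
        (h.eventually_mesh_pos.and h.eventually_bandwidth_pos |>.mono fun n hn =>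
          div_pos hn.1 hn.2) h.tendsto_mesh_div_bandwidth)
      refine this.congr fun n => ?_
      simp only [Function.comp, one_zpow, mul_one]
      rw [Complex.ofReal_mul, Complex.ofReal_tsum])
    (h.tendsto_tsum_covSeq g g') (hconj (h.tendsto_tsum_covSeq g g'))
  have h2 := hW.tendsto_scaled_quadSum (τ := fun n => c * τ n) (M := c * M) h.eventually_mesh_pos
    h.eventually_bandwidth_pos hL h.tendsto_mesh_div_bandwidth h.tendsto_mul_mesh_div_bandwidth
    hLh (by simpa using hτ.const_mul c) (fun n => Complex.norm_exp_ofReal_mul_I (2 * δ n * θ))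
    (hmass.mono fun n hn => (hn g g').2) (hmass.mono fun n hn => (hn g g').2.conj)
    (hW.tendsto_sq_tsum_cInd h.eventually_mesh_pos h.eventually_bandwidth_pos h.mesh_tendsto
      h.tendsto_bandwidth hθ hedge)
    (h.tendsto_tsum_pcovSeq g g') (hconj (h.tendsto_tsum_pcovSeq g g'))
  have h3 := h1.add h2
  simp only [one_zpow, mul_one] at h3
  have hlim : ∀ x y z w : ℝ, ∀ F F' : ℂ, z = ‖F‖ ^ 2 → w = ‖F'‖ ^ 2 →
      (x : ℂ) * (F * (starRingEnd ℂ) F) + ((y * x : ℝ) : ℂ) * (F' * (starRingEnd ℂ) F')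
        = ((x * (z + y * w) : ℝ) : ℂ) := by
    rintro x y _ _ F F' rfl rfl
    rw [Complex.mul_conj', Complex.mul_conj']
    push_cast
    ring
  rw [hlim _ _ _ _ _ _ rfl rfl] at h3
  refine h3.congr' ?_
  filter_upwards [h.eventually_mesh_pos, h.eventually_bandwidth_pos, eventually_ge_atTop 1]
    with n a1 a2 a3
  rw [integral_inner_normalizedError hgauss hmean hstat hK.symm a3 a1 a2]

end Moments

end SpectralCLT

namespace SpectralCLT

/-! ### Uniform second moment bounds -/

section Tight

variable {H : Type*} [NormedAddCommGroup H] [InnerProductSpace ℂ H] [CompleteSpace H]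
  {Ω : Type*} [MeasurableSpace Ω] {P : Measure Ω} {X : ℝ → Ω → H}
  {κ ι : Type*} {r : HilbertBasis κ ℂ H} {e : HilbertBasis ι ℂ H} {δ Δ : ℕ → ℝ} {δlim θ : ℝ}

theorem mul_sum_le_toReal_tsum {γ c : ℤ → ℂ} (hγ : ∀ d, ‖γ d‖ = ‖c d‖) {δ : ℝ} (hδ : 0 ≤ δ)
    (hb : ENNReal.ofReal δ * ∑' d, ‖c d‖ₑ ≠ ∞) (s : Finset ℤ) :
    δ * ∑ d ∈ s, ‖γ d‖ ≤ (ENNReal.ofReal δ * ∑' d, ‖c d‖ₑ).toReal := by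
  simp_rw [hγ]
  exact mul_sum_le_toReal hδ hb (mul_le_mul_right (ENNReal.sum_le_tsum s) _)

theorem toReal_mul_toReal_le {δ : ℝ} (hδ : 0 ≤ δ) {u v : ℤ → ℂ} {a : ℝ≥0}
    (h : ENNReal.ofReal (δ ^ 2) * ∑' x₁, ∑' x₂, ‖u x₁‖ₑ * ‖v x₂‖ₑ ≤ a) :
    (ENNReal.ofReal δ * ∑' x, ‖u x‖ₑ).toReal * (ENNReal.ofReal δ * ∑' x, ‖v x‖ₑ).toReal ≤ a := by
  rw [← ENNReal.toReal_mul]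
  refine ENNReal.toReal_le_coe_of_le_coe (le_trans (le_of_eq ?_) h)
  simp_rw [ENNReal.tsum_mul_left, ENNReal.tsum_mul_right]
  rw [pow_two, ENNReal.ofReal_mul hδ]
  ring

theorem norm_covSeq (δ θ : ℝ) (y z : H) (d : ℤ) :
    ‖covSeq P X δ θ y z d‖ = ‖inner ℂ y (statCov P X (δ * d) z)‖ := by
  rw [covSeq, norm_mul, show Complex.I * d * δ * θ = ((d * δ * θ : ℝ) : ℂ) * Complex.I by
    push_cast; ring, Complex.norm_exp_ofReal_mul_I, one_mul, mul_comm δ]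

theorem norm_pcovSeq (δ θ : ℝ) (y z : H) (d : ℤ) :
    ‖pcovSeq r P X δ θ y z d‖ = ‖inner ℂ y (statPCov r P X (δ * d) (conjH r z))‖ := by
  rw [pcovSeq, norm_mul, show Complex.I * d * δ * (-θ : ℝ) = ((d * δ * -θ : ℝ) : ℂ) * Complex.I by
    push_cast; ring, Complex.norm_exp_ofReal_mul_I, one_mul, mul_comm δ]

theorem mul_tsum_enorm_inner_ne_top {A : ℤ → H →L[ℂ] H} {δ : ℝ} {M : ℝ≥0}
    (hM : ENNReal.ofReal δ * ∑' x : ℤ, traceNorm (A x) ≤ M) (y z : H) :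
    ENNReal.ofReal δ * ∑' x : ℤ, ‖inner ℂ y (A x z)‖ₑ ≠ ∞ := by
  have h1 : ENNReal.ofReal δ * ∑' x : ℤ, ‖inner ℂ y (A x z)‖ₑ ≤ M * (‖y‖ₑ * ‖z‖ₑ) := by
    refine le_trans ?_ (mul_le_mul_left hM _)
    rw [mul_assoc, ← ENNReal.tsum_mul_right]
    gcongr
    exact enorm_inner_apply_le_traceNorm _ _ _
  exact ne_top_of_le_ne_top (by finiteness) h1

variable [TopologicalSpace.SeparableSpace H] [MeasurableSpace H] [BorelSpace H]
  [IsProbabilityMeasure P] {K : ℝ → ℝ}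

theorem hasAllMoments_inner_normalizedError (hgauss : IsGaussianProcess X P)
    (hmean : ∀ t, ∫ ω, X t ω ∂P = 0) (n : ℕ) (δ Δ θ : ℝ) (g₁ g₂ : H) :
    HasAllMoments (fun ω =>
      inner ℂ g₁ (HSOperator.toCLM (normalizedError P X K n δ Δ θ ω) g₂)) P := by
  simp_rw [inner_normalizedError hgauss hmean]
  have hm := hasAllMoments_coord hgauss hmean δ θ
  exact (hasAllMoments_lagSum (hm g₁) (hm g₂) _ _).const_mul _

theorem lintegral_enorm_sq_eq {F : Ω → ℂ} (hF : HasAllMoments F P) :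
    ∫⁻ ω, ‖F ω‖ₑ ^ 2 ∂P = ENNReal.ofReal ‖∫ ω, F ω * (starRingEnd ℂ) (F ω) ∂P‖ := by
  have h1 : Integrable (fun ω => ‖F ω‖ ^ 2) P := (hF 2 (by simp)).integrable_norm_pow (by simp)
  have h2 : ∀ ω, F ω * (starRingEnd ℂ) (F ω) = ((‖F ω‖ ^ 2 : ℝ) : ℂ) := fun ω => by
    rw [Complex.mul_conj']
    push_cast
    rfl
  simp_rw [h2]
  rw [integral_complex_ofReal, Complex.norm_real, Real.norm_of_nonneg
    (integral_nonneg fun ω => by positivity), ofReal_integral_eq_lintegral_ofReal h1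
    (ae_of_all _ fun ω => by positivity)]
  refine lintegral_congr fun ω => ?_
  rw [ENNReal.ofReal_pow (norm_nonneg _), ofReal_norm]

/-- The moment formula at finite `n`, in absolute values. For the coordinate `e_l ⊗ e_k` the first
pairing involves `C_{l,l}` and `C_{k,k}`. The second involves `Č_{k,l}` twice, after the symmetry of
the pseudo-covariance and a reflection of the lag that does not change absolute sums. -/
theorem exists_coordinate_bound (hgauss : IsGaussianProcess X P)
    (hmean : ∀ t, ∫ ω, X t ω ∂P = 0) (hstat : IsStationary r P X) (hK : KernelCondition K)
    (h : CLTCondition r e P X δ Δ δlim θ) :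
    ∃ s : ι × ι → ℝ≥0∞, ∑' p, s p ≠ ∞ ∧ ∀ n p, ∫⁻ ω, ‖inner ℂ (HSOperator.outerBasis e p)
      (normalizedError P X K n (δ n) (Δ n) θ ω)‖ₑ ^ 2 ∂P ≤ s p := by
  obtain ⟨B, R, T, hW⟩ := hK.exists_isWindow
  obtain ⟨a, ha, hCa⟩ := h.cov_coef
  obtain ⟨b, hb, hCb⟩ := h.pcov_coef
  obtain ⟨M₁, hM₁⟩ := h.cov_summable
  obtain ⟨M₂, hM₂⟩ := h.pcov_summable
  obtain ⟨D, hD⟩ := h.tendsto_mesh_div_bandwidth.bddAbove_range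
  have hB := hW.bound_nonneg
  have hR := hW.radius_nonneg
  set E : ℝ := 1 / (4 * Real.pi ^ 2) * (B * (B * (2 * R + |D|))) with hE
  have hE0 : 0 ≤ E := by positivity
  refine ⟨fun p => ENNReal.ofReal E * (a p.2 p.1 + b p.1 p.2 : ℝ≥0), ?_, fun n p => ?_⟩
  · rw [ENNReal.tsum_mul_left]
    refine ENNReal.mul_ne_top ENNReal.ofReal_ne_top ?_
    have ha' : Summable fun p : ι × ι => a p.2 p.1 :=
      (Equiv.prodComm ι ι).summable_iff.2 ha
    exact ENNReal.tsum_coe_ne_top_iff_summable.2 (ha'.add hb)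
  simp_rw [HSOperator.outerBasis_apply, HSOperator.inner_outer]
  rw [lintegral_enorm_sq_eq (hasAllMoments_inner_normalizedError hgauss hmean _ _ _ _ _ _)]
  rcases Nat.eq_zero_or_pos n with rfl | hn
  -- At `n = 0` the conditions on `δ` and `Δ` are not available, but the normalizing square root
  -- vanishes.
  · simp [normalizedError]
  have hδ := h.mesh_pos n hn
  have hΔ := h.bandwidth_pos n hn
  rw [integral_inner_normalizedError hgauss hmean hstat hK.symm hn hδ hΔ]
  have hk : ∀ d : ℤ, ‖(K (d * (δ n / Δ n)) : ℂ)‖ ≤ K (d * (δ n / Δ n)) := fun d => by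
    rw [Complex.norm_real, Real.norm_of_nonneg (hK.nonneg _)]
  have hk' : ∀ d : ℤ, ‖(K (d * (δ n / Δ n)) : ℂ) *
      Complex.exp ((2 * δ n * θ : ℝ) * Complex.I) ^ d‖ ≤ K (d * (δ n / Δ n)) := fun d => by
    rw [norm_mul, norm_zpow, Complex.norm_exp_ofReal_mul_I, one_zpow, mul_one]
    exact hk d
  obtain ⟨k, l⟩ := p
  have e₁ := hW.norm_scaled_quadSum_le hn hδ hΔ hk hk
    (mul_sum_le_toReal_tsum (c := fun d => covCoef e P X l l (δ n * d))
      (fun d => norm_covSeq (δ n) θ (e l) (e l) d) hδ.le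
      (mul_tsum_enorm_inner_ne_top (hM₁ n hn) (e l) (e l)))
    (mul_sum_le_toReal_tsum (γ := fun d => (starRingEnd ℂ) (covSeq P X (δ n) θ (e k) (e k) d))
      (c := fun d => covCoef e P X k k (δ n * d))
      (fun d => by rw [RCLike.norm_conj]; exact norm_covSeq (δ n) θ (e k) (e k) d) hδ.le
      (mul_tsum_enorm_inner_ne_top (hM₁ n hn) (e k) (e k)))
  have hrefl : ENNReal.ofReal (δ n) * ∑' d : ℤ, ‖pcovCoef r e P X k l (δ n * (-d : ℤ))‖ₑ
      = ENNReal.ofReal (δ n) * ∑' d : ℤ, ‖pcovCoef r e P X k l (δ n * d)‖ₑ := by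
    congr 1
    exact (Equiv.neg ℤ).tsum_eq fun d : ℤ => ‖pcovCoef r e P X k l (δ n * d)‖ₑ
  have hfin := mul_tsum_enorm_inner_ne_top (hM₂ n hn) (e l) (conjH r (e k))
  have e₂ := hW.norm_scaled_quadSum_le hn hδ hΔ hk' hk
    (mul_sum_le_toReal_tsum (c := fun d => pcovCoef r e P X k l (δ n * d))
      (fun d => norm_pcovSeq (δ n) θ (e l) (e k) d) hδ.le hfin)
    (mul_sum_le_toReal_tsum (γ := fun d => (starRingEnd ℂ) (pcovSeq r P X (δ n) θ (e k) (e l) d))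
      (c := fun d => pcovCoef r e P X k l (δ n * (-d : ℤ)))
      (fun d => by
        rw [RCLike.norm_conj, norm_pcovSeq, mul_comm (δ n), inner_statPCov_symm hgauss hstat,
          mul_comm _ (δ n)]
        rfl) hδ.le (by rw [hrefl]; exact hfin))
  rw [hrefl] at e₂
  have f₁ := toReal_mul_toReal_le hδ.le (hCa n hn l k)
  have f₂ := toReal_mul_toReal_le hδ.le (hCb n hn k l)
  have hDE : 1 / (4 * Real.pi ^ 2) * (B * (B * (2 * R + δ n / Δ n))) ≤ E := by
    have : δ n / Δ n ≤ |D| := (hD ⟨n, rfl⟩).trans (le_abs_self D)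
    rw [hE]
    gcongr
  rw [← ENNReal.ofReal_coe_nnreal, ← ENNReal.ofReal_mul hE0]
  refine ENNReal.ofReal_le_ofReal ((norm_add_le _ _).trans ?_)
  rw [NNReal.coe_add, mul_add]
  refine add_le_add (e₁.trans ?_) (e₂.trans ?_)
  · exact mul_le_mul hDE f₁ (by positivity) hE0
  · exact mul_le_mul hDE f₂ (by positivity) hE0

end Tight

end SpectralCLT

namespace SpectralCLT

/-! ### The central limit theorem for real quadratic functionals -/

section Functional

variable {H : Type*} [NormedAddCommGroup H] [InnerProductSpace ℂ H] [CompleteSpace H]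

/-- The functional `T ↦ ∑ a_l ⟨T g_l, g_l⟩`. -/
noncomputable def quadFunctional {J : Type*} [Fintype J] (a : J → ℝ) (g : J → H)
    (T : HSOperator H) : ℂ :=
  ∑ l, (a l : ℂ) * inner ℂ (g l) (HSOperator.toCLM T (g l))

variable {Ω : Type*} [MeasurableSpace Ω] {P : Measure Ω}

theorem conj_lagSum (n : ℕ) {k : ℤ → ℝ} (hk : ∀ d, k (-d) = k d) (y₁ y₂ : ℕ → Ω → ℂ) (ω : Ω) :
    (starRingEnd ℂ) (lagSum P n k y₁ y₂ ω) = lagSum P n k y₂ y₁ ω := by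
  simp only [lagSum, map_sum]
  rw [Finset.sum_comm]
  refine Finset.sum_congr rfl fun i _ => Finset.sum_congr rfl fun j _ => ?_
  rw [map_mul, Complex.conj_ofReal, map_sub, map_mul, Complex.conj_conj, ← integral_conj,
    ← hk ((j : ℤ) - i), neg_sub]
  simp only [map_mul, Complex.conj_conj, mul_comm]

/-- Every product of a real or imaginary part of `z` with one of `w` is the real part of a
combination of `z * conj w` and `z * w` with coefficients of modulus `1/2`. -/
theorem abs_integral_re_im_mul_le {y y' : Ω → ℂ} (hy : HasAllMoments y P)
    (hy' : HasAllMoments y' P) (b b' : Bool) :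
    |∫ ω, (if b then (y ω).im else (y ω).re) * (if b' then (y' ω).im else (y' ω).re) ∂P|
      ≤ ‖∫ ω, y ω * (starRingEnd ℂ) (y' ω) ∂P‖ + ‖∫ ω, y ω * y' ω ∂P‖ := by
  have h1 : Integrable (fun ω => y ω * (starRingEnd ℂ) (y' ω)) P := (hy.mul hy'.star).integrable
  have h2 : Integrable (fun ω => y ω * y' ω) P := (hy.mul hy').integrable
  set u := ∫ ω, y ω * (starRingEnd ℂ) (y' ω) ∂P with hu
  set v := ∫ ω, y ω * y' ω ∂P with hv
  have hlin : ∀ (c d : ℂ), ∫ ω, (c * (y ω * (starRingEnd ℂ) (y' ω)) + d * (y ω * y' ω)).re ∂P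
      = (c * u + d * v).re := fun c d => by
    have h3 : Integrable (fun ω => c * (y ω * (starRingEnd ℂ) (y' ω)) + d * (y ω * y' ω)) P :=
      (h1.const_mul c).add (h2.const_mul d)
    rw [← RCLike.re_eq_complex_re, integral_re h3,
      integral_add (h1.const_mul c) (h2.const_mul d), integral_const_mul, integral_const_mul]
  have hbound : ∀ c d : ℂ, ‖c‖ ≤ 1 → ‖d‖ ≤ 1 → |(c * u + d * v).re| ≤ ‖u‖ + ‖v‖ :=
    fun c d hc hd => (Complex.abs_re_le_norm _).trans ((norm_add_le _ _).trans (by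
      rw [norm_mul, norm_mul]
      exact add_le_add (mul_le_of_le_one_left (norm_nonneg _) hc)
        (mul_le_of_le_one_left (norm_nonneg _) hd)))
  obtain ⟨c, d, hc, hd, hcd⟩ : ∃ c d : ℂ, ‖c‖ ≤ 1 ∧ ‖d‖ ≤ 1 ∧ ∀ z w : ℂ,
      (if b then z.im else z.re) * (if b' then w.im else w.re)
        = (c * (z * (starRingEnd ℂ) w) + d * (z * w)).re := by
    cases b <;> cases b'
    · refine ⟨1 / 2, 1 / 2, by norm_num, by norm_num, fun z w => ?_⟩
      simp
      ring
    · refine ⟨Complex.I / 2, -Complex.I / 2, by norm_num, by norm_num, fun z w => ?_⟩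
      simp
      ring
    · refine ⟨-Complex.I / 2, -Complex.I / 2, by norm_num, by norm_num, fun z w => ?_⟩
      simp
      ring
    · refine ⟨1 / 2, -1 / 2, by norm_num, by norm_num, fun z w => ?_⟩
      simp
      ring
  simp_rw [hcd, hlin]
  exact hbound c d hc hd

theorem mul_re_add_im_mul_im (z w : ℂ) :
    z.re * w.re + z.im * w.im = (z * (starRingEnd ℂ) w).re := by
  simp

end Functional

/-! ### Self-adjointness of the error and variance of its quadratic functionals. -/

section CLT

variable {H : Type*} [NormedAddCommGroup H] [InnerProductSpace ℂ H] [CompleteSpace H]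
  [TopologicalSpace.SeparableSpace H] [MeasurableSpace H] [BorelSpace H]
  {Ω : Type*} [MeasurableSpace Ω] {P : Measure Ω} [IsProbabilityMeasure P] {X : ℝ → Ω → H}
  {κ ι : Type*} {r : HilbertBasis κ ℂ H} {e : HilbertBasis ι ℂ H} {δ Δ : ℕ → ℝ} {δlim θ : ℝ}
  {K : ℝ → ℝ}

/-- The operators `𝒯_n` are self-adjoint. -/
theorem conj_inner_normalizedError (hgauss : IsGaussianProcess X P)
    (hmean : ∀ t, ∫ ω, X t ω ∂P = 0) (hsymm : ∀ x, K (-x) = K x) (n : ℕ) (δ Δ θ : ℝ)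
    (x y : H) (ω : Ω) :
    (starRingEnd ℂ) (inner ℂ x (HSOperator.toCLM (normalizedError P X K n δ Δ θ ω) y))
      = inner ℂ y (HSOperator.toCLM (normalizedError P X K n δ Δ θ ω) x) := by
  rw [inner_normalizedError hgauss hmean, inner_normalizedError hgauss hmean, map_mul,
    Complex.conj_ofReal, conj_lagSum n fun d => by rw [Int.cast_neg, neg_mul, hsymm]]

theorem im_quadFunctional_normalizedError (hgauss : IsGaussianProcess X P)
    (hmean : ∀ t, ∫ ω, X t ω ∂P = 0) (hsymm : ∀ x, K (-x) = K x) (n : ℕ) (δ Δ θ : ℝ)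
    {J : Type*} [Fintype J] (a : J → ℝ) (g : J → H) (ω : Ω) :
    (quadFunctional a g (normalizedError P X K n δ Δ θ ω)).im = 0 := by
  rw [← Complex.conj_eq_iff_im, quadFunctional, map_sum]
  refine Finset.sum_congr rfl fun l _ => ?_
  rw [map_mul, Complex.conj_ofReal, conj_inner_normalizedError hgauss hmean hsymm]

theorem hasAllMoments_quadFunctional (hgauss : IsGaussianProcess X P)
    (hmean : ∀ t, ∫ ω, X t ω ∂P = 0) (n : ℕ) (δ Δ θ : ℝ) {J : Type*} [Fintype J] (a : J → ℝ)
    (g : J → H) :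
    HasAllMoments (fun ω => quadFunctional a g (normalizedError P X K n δ Δ θ ω)) P :=
  .finset_sum fun _ _ => (hasAllMoments_inner_normalizedError hgauss hmean _ _ _ _ _ _).const_mul _

theorem integral_quadFunctional (hgauss : IsGaussianProcess X P)
    (hmean : ∀ t, ∫ ω, X t ω ∂P = 0) (n : ℕ) (δ Δ θ : ℝ) {J : Type*} [Fintype J] (a : J → ℝ)
    (g : J → H) :
    ∫ ω, (quadFunctional a g (normalizedError P X K n δ Δ θ ω)).re ∂P = 0 := by
  have h1 := integral_re (hasAllMoments_quadFunctional (K := K) hgauss hmean n δ Δ θ a g).integrable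
  simp only [RCLike.re_eq_complex_re] at h1
  have hm := hasAllMoments_coord hgauss hmean δ θ
  rw [h1]
  unfold quadFunctional
  rw [integral_finsetSum _ fun l _ =>
    ((hasAllMoments_inner_normalizedError hgauss hmean _ _ _ _ _ _).const_mul _).integrable]
  simp_rw [integral_const_mul, inner_normalizedError hgauss hmean, integral_const_mul]
  rw [Finset.sum_eq_zero fun l _ => by
    rw [integral_lagSum (hm (g l)) (hm (g l)), mul_zero, mul_zero], Complex.zero_re]

/-- The limit variance of a quadratic functional. -/
noncomputable def limitVariance (r : HilbertBasis κ ℂ H) (P : Measure Ω) (X : ℝ → Ω → H)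
    (K : ℝ → ℝ) (θ δlim : ℝ) {J : Type*} [Fintype J] (a : J → ℝ) (g : J → H) : ℝ :=
  (∫ x, K x ^ 2) * ∑ l₁, ∑ l₂, a l₁ * a l₂ *
    (‖inner ℂ (g l₁) (specDensity P X θ δlim (g l₂))‖ ^ 2 +
      cInd θ δlim *
        ‖inner ℂ (g l₁) (pseudoSpecDensity r P X θ δlim (conjH r (g l₂)))‖ ^ 2)

theorem tendsto_integral_sq_quadFunctional (hgauss : IsGaussianProcess X P)
    (hmean : ∀ t, ∫ ω, X t ω ∂P = 0) (hstat : IsStationary r P X) (hK : KernelCondition K)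
    (h : CLTCondition r e P X δ Δ δlim θ) (hθ : 0 < δlim → |θ| ≤ Real.pi / δlim)
    (hedge : 0 < δlim → |θ| = Real.pi / δlim →
      Tendsto (fun n => Δ n * (δ n - δlim)) atTop (𝓝 0))
    {J : Type*} [Fintype J] (a : J → ℝ) (g : J → H) :
    Tendsto (fun n => ∫ ω,
      (quadFunctional a g (normalizedError P X K n (δ n) (Δ n) θ ω)).re ^ 2 ∂P) atTop
      (𝓝 (limitVariance r P X K θ δlim a g)) := by
  have h1 : ∀ n, ((∫ ω, (quadFunctional a g
      (normalizedError P X K n (δ n) (Δ n) θ ω)).re ^ 2 ∂P : ℝ) : ℂ)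
      = ∑ l₁, ∑ l₂, ((a l₁ * a l₂ : ℝ) : ℂ) * ∫ ω,
      inner ℂ (g l₁) (HSOperator.toCLM (normalizedError P X K n (δ n) (Δ n) θ ω) (g l₁)) *
      (starRingEnd ℂ) (inner ℂ (g l₂) (HSOperator.toCLM
        (normalizedError P X K n (δ n) (Δ n) θ ω) (g l₂))) ∂P := fun n => by
    have hm : ∀ l, HasAllMoments (fun ω => inner ℂ (g l)
        (HSOperator.toCLM (normalizedError P X K n (δ n) (Δ n) θ ω) (g l))) P := fun l =>
      hasAllMoments_inner_normalizedError hgauss hmean _ _ _ _ _ _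
    rw [← integral_complex_ofReal]
    have h2 : ∀ ω, (((quadFunctional a g (normalizedError P X K n (δ n) (Δ n) θ ω)).re ^ 2 : ℝ) : ℂ)
        = ∑ l₁, ∑ l₂, ((a l₁ * a l₂ : ℝ) : ℂ) *
          (inner ℂ (g l₁) (HSOperator.toCLM (normalizedError P X K n (δ n) (Δ n) θ ω) (g l₁)) *
          (starRingEnd ℂ) (inner ℂ (g l₂) (HSOperator.toCLM
            (normalizedError P X K n (δ n) (Δ n) θ ω) (g l₂)))) := fun ω => by
      have h3 : (((quadFunctional a g (normalizedError P X K n (δ n) (Δ n) θ ω)).re : ℝ) : ℂ)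
          = quadFunctional a g (normalizedError P X K n (δ n) (Δ n) θ ω) :=
        Complex.ext (by simp)
          (by rw [im_quadFunctional_normalizedError hgauss hmean hK.symm, Complex.ofReal_im])
      -- The functional is real, so its square may be written with one factor conjugated; this is
      -- the form of the mixed moments computed above.
      have h4 : (starRingEnd ℂ) (quadFunctional a g (normalizedError P X K n (δ n) (Δ n) θ ω))
          = quadFunctional a g (normalizedError P X K n (δ n) (Δ n) θ ω) := by
        rw [← h3, Complex.conj_ofReal]
      rw [Complex.ofReal_pow, h3, pow_two]
      nth_rewrite 2 [← h4]
      rw [quadFunctional, map_sum, Finset.sum_mul_sum]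
      refine Finset.sum_congr rfl fun l₁ _ => Finset.sum_congr rfl fun l₂ _ => ?_
      rw [map_mul, Complex.conj_ofReal]
      push_cast
      ring
    simp_rw [h2]
    rw [integral_finsetSum _ fun l₁ _ => (HasAllMoments.finset_sum fun l₂ _ =>
      ((hm l₁).mul (hm l₂).star).const_mul _).integrable]
    refine Finset.sum_congr rfl fun l₁ _ => ?_
    rw [integral_finsetSum _ fun l₂ _ => (((hm l₁).mul (hm l₂).star).const_mul _).integrable]
    exact Finset.sum_congr rfl fun l₂ _ => integral_const_mul _ _
  have h2 : Tendsto (fun n => ((∫ ω, (quadFunctional a g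
      (normalizedError P X K n (δ n) (Δ n) θ ω)).re ^ 2 ∂P : ℝ) : ℂ)) atTop
      (𝓝 ((limitVariance r P X K θ δlim a g : ℝ) : ℂ)) := by
    simp_rw [h1]
    have := tendsto_finsetSum (f := fun l₁ n => ∑ l₂, ((a l₁ * a l₂ : ℝ) : ℂ) * ∫ ω,
      inner ℂ (g l₁) (HSOperator.toCLM (normalizedError P X K n (δ n) (Δ n) θ ω) (g l₁)) *
      (starRingEnd ℂ) (inner ℂ (g l₂) (HSOperator.toCLM
        (normalizedError P X K n (δ n) (Δ n) θ ω) (g l₂))) ∂P) Finset.univ fun l₁ _ =>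
      tendsto_finsetSum Finset.univ fun l₂ _ =>
        (tendsto_integral_inner_normalizedError hgauss hmean hstat hK h hθ hedge (g l₁)
          (g l₂)).const_mul ((a l₁ * a l₂ : ℝ) : ℂ)
    convert! this using 2
    rw [limitVariance, Finset.mul_sum, Complex.ofReal_sum]
    refine Finset.sum_congr rfl fun l₁ _ => ?_
    rw [Finset.mul_sum, Complex.ofReal_sum]
    refine Finset.sum_congr rfl fun l₂ _ => ?_
    rw [← Complex.ofReal_mul]
    congr 1
    ring
  have := (Complex.continuous_re.tendsto _).comp h2
  simpa [Function.comp_def] using this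

end CLT

end SpectralCLT

namespace SpectralCLT

/-! ### Asymptotic normality of the quadratic functionals. -/

section CLT

variable {H : Type*} [NormedAddCommGroup H] [InnerProductSpace ℂ H] [CompleteSpace H]
  [TopologicalSpace.SeparableSpace H] [MeasurableSpace H] [BorelSpace H]
  {Ω : Type*} [MeasurableSpace Ω] {P : Measure Ω} [IsProbabilityMeasure P] {X : ℝ → Ω → H}
  {κ ι : Type*} {r : HilbertBasis κ ℂ H} {e : HilbertBasis ι ℂ H} {δ Δ : ℕ → ℝ} {δlim θ : ℝ}
  {K : ℝ → ℝ}

/-- The real and imaginary parts of the demodulated coordinates. -/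
noncomputable def coordPart (X : ℝ → Ω → H) (δ θ : ℝ) (n : ℕ) {J : Type*} (g : J → H)
    (p : (Finset.Icc 1 n × J) × Bool) (ω : Ω) : ℝ :=
  if p.2 then (coord X δ θ (g p.1.2) p.1.1 ω).im else (coord X δ θ (g p.1.2) p.1.1 ω).re

open Classical in
/-- The matrix of a quadratic functional in the real coordinates. -/
noncomputable def formMatrix (n : ℕ) (k : ℤ → ℝ) {J : Type*} (c : J → ℝ) :
    Matrix ((Finset.Icc 1 n × J) × Bool) ((Finset.Icc 1 n × J) × Bool) ℝ :=
  Matrix.of fun p q => if p.1.2 = q.1.2 ∧ p.2 = q.2 then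
    c p.1.2 * k ((p.1.1 : ℕ) - (q.1.1 : ℕ) : ℤ) else 0

/-- The function `f` is left general to cover both uses: the expansion of the quadratic form and the
sum of absolute values along a row. -/
theorem sum_formMatrix (n : ℕ) (k : ℤ → ℝ) {J : Type*} [Fintype J] (c : J → ℝ)
    (p : (Finset.Icc 1 n × J) × Bool) (f : (Finset.Icc 1 n × J) × Bool → ℝ → ℝ)
    (hf : ∀ q, f q 0 = 0) :
    ∑ q, f q (formMatrix n k c p q) = ∑ j : Finset.Icc 1 n,
      f ((j, p.1.2), p.2) (c p.1.2 * k ((p.1.1 : ℕ) - (j : ℕ) : ℤ)) := by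
  classical
  rw [Fintype.sum_prod_type, Fintype.sum_prod_type]
  refine Finset.sum_congr rfl fun j _ => ?_
  rw [Finset.sum_eq_single p.1.2, Finset.sum_eq_single p.2]
  · simp [formMatrix]
  · intro b _ hb
    simp [formMatrix, hb.symm, hf]
  · simp
  · intro l _ hl
    refine Finset.sum_eq_zero fun b _ => ?_
    simp [formMatrix, hl.symm, hf]
  · simp

theorem isHermitian_formMatrix (n : ℕ) {k : ℤ → ℝ} (hk : ∀ d, k (-d) = k d) {J : Type*}
    (c : J → ℝ) : (formMatrix n k c).IsHermitian := by
  ext p q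
  simp only [Matrix.conjTranspose_apply, star_trivial, formMatrix, Matrix.of_apply]
  by_cases h : p.1.2 = q.1.2 ∧ p.2 = q.2
  · rw [if_pos h, if_pos ⟨h.1.symm, h.2.symm⟩, h.1, ← hk, neg_sub]
  · rw [if_neg h, if_neg fun h' => h ⟨h'.1.symm, h'.2.symm⟩]

theorem isCentredGaussianVector_coordPart (hgauss : IsGaussianProcess X P)
    (hmean : ∀ t, ∫ ω, X t ω ∂P = 0) (δ θ : ℝ) (n : ℕ) {J : Type*} [Fintype J] (g : J → H) :
    IsCentredGaussianVector (coordPart X δ θ n g) P :=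
  (isCentredGaussianFamily_coord hgauss hmean δ θ (fun p : Finset.Icc 1 n × J => g p.2)
    fun p => p.1).isCentredGaussianVector

/-- Since `Re (y conj y') = Re y Re y' + Im y Im y'`, the form couples neither different `g_l` nor
real with imaginary parts. The constant `b` collects the means. -/
theorem re_quadFunctional_eq (hgauss : IsGaussianProcess X P)
    (hmean : ∀ t, ∫ ω, X t ω ∂P = 0) (n : ℕ) (δ Δ θ : ℝ) {J : Type*} [Fintype J] (a : J → ℝ)
    (g : J → H) : ∃ b : ℝ, ∀ ω, (quadFunctional a g (normalizedError P X K n δ Δ θ ω)).re =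
      ∑ p, ∑ q, formMatrix n (fun d => K (d * (δ / Δ)))
        (fun l => √(n * δ / Δ) * (δ / (2 * Real.pi * n)) * a l) p q *
          (coordPart X δ θ n g p ω * coordPart X δ θ n g q ω) - b := by
  set c := √(n * δ / Δ) * (δ / (2 * Real.pi * n)) with hc
  set m : J → ℕ → ℕ → ℂ := fun l i j =>
    ∫ ω', coord X δ θ (g l) i ω' * (starRingEnd ℂ) (coord X δ θ (g l) j ω') ∂P with hm
  refine ⟨∑ i : Finset.Icc 1 n, ∑ l, ∑ j : Finset.Icc 1 n,
    c * a l * K (((i : ℕ) - (j : ℕ) : ℤ) * (δ / Δ)) * (m l i j).re, fun ω => ?_⟩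
  have h1 : ∀ p : (Finset.Icc 1 n × J) × Bool,
      ∑ q, formMatrix n (fun d => K (d * (δ / Δ))) (fun l => c * a l) p q *
          (coordPart X δ θ n g p ω * coordPart X δ θ n g q ω) =
      ∑ j : Finset.Icc 1 n, c * a p.1.2 * K (((p.1.1 : ℕ) - (j : ℕ) : ℤ) * (δ / Δ)) *
        (coordPart X δ θ n g p ω * coordPart X δ θ n g ((j, p.1.2), p.2) ω) := fun p =>
    sum_formMatrix n (fun d => K (d * (δ / Δ))) (fun l => c * a l) p
      (fun q x => x * (coordPart X δ θ n g p ω * coordPart X δ θ n g q ω)) fun q => zero_mul _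
  simp_rw [h1]
  rw [Fintype.sum_prod_type, Fintype.sum_prod_type, ← Finset.sum_sub_distrib]
  have h2 : (quadFunctional a g (normalizedError P X K n δ Δ θ ω)).re
      = ∑ i : Finset.Icc 1 n, ∑ l, ∑ j : Finset.Icc 1 n,
        c * a l * K (((i : ℕ) - (j : ℕ) : ℤ) * (δ / Δ)) *
          (coord X δ θ (g l) i ω * (starRingEnd ℂ) (coord X δ θ (g l) j ω) - m l i j).re := by
    rw [quadFunctional, Complex.re_sum, Finset.sum_comm]
    refine Finset.sum_congr rfl fun l _ => ?_
    rw [inner_normalizedError hgauss hmean, ← hc, ← mul_assoc, ← Complex.ofReal_mul,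
      Complex.re_ofReal_mul, lagSum, Complex.re_sum, Finset.mul_sum,
      ← Finset.sum_coe_sort (Finset.Icc 1 n)]
    refine Finset.sum_congr rfl fun i _ => ?_
    rw [Complex.re_sum, Finset.mul_sum, ← Finset.sum_coe_sort (Finset.Icc 1 n)]
    refine Finset.sum_congr rfl fun j _ => ?_
    rw [Complex.re_ofReal_mul]
    ring
  rw [h2]
  refine Finset.sum_congr rfl fun i _ => ?_
  rw [← Finset.sum_sub_distrib]
  refine Finset.sum_congr rfl fun l _ => ?_
  rw [Fintype.sum_bool, ← Finset.sum_add_distrib, ← Finset.sum_sub_distrib]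
  refine Finset.sum_congr rfl fun j _ => ?_
  rw [Complex.sub_re, ← mul_re_add_im_mul_im]
  simp only [coordPart, if_true, Bool.false_eq_true, if_false]
  ring

/-- Each entry is bounded by a covariance plus a pseudo-covariance, and the sum over the lag of
either is at most its mass, of order `1/δ`. The factor `4` counts two parts and two kinds of
covariance. -/
theorem sum_abs_integral_coordPart_le (hgauss : IsGaussianProcess X P)
    (hmean : ∀ t, ∫ ω, X t ω ∂P = 0) (hstat : IsStationary r P X) {δ θ L M τ : ℝ} (hδ : 0 < δ)
    (hM : 0 ≤ M) (hmass : ∀ y z : H,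
        HasMassBound (covSeq P X δ θ y z) δ L (‖y‖ * ‖z‖ * M) (‖y‖ * ‖z‖ * τ) ∧
        HasMassBound (pcovSeq r P X δ θ y z) δ L (‖y‖ * ‖z‖ * M) (‖y‖ * ‖z‖ * τ)) (n : ℕ)
    {J : Type*} [Fintype J] (g : J → H) (p : (Finset.Icc 1 n × J) × Bool) :
    ∑ q, |∫ ω, coordPart X δ θ n g p ω * coordPart X δ θ n g q ω ∂P|
      ≤ 4 * (∑ l, ‖g l‖) ^ 2 * M / δ := by
  have hm := hasAllMoments_coord hgauss hmean δ θ
  have hG : ∀ l, ‖g l‖ ≤ ∑ l, ‖g l‖ := fun l =>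
    Finset.single_le_sum (f := fun l => ‖g l‖) (fun _ _ => norm_nonneg _) (Finset.mem_univ l)
  set i : ℕ := (p.1.1 : ℕ) with hi
  set l := p.1.2 with hl
  have h1 : ∀ (j : Finset.Icc 1 n) (l' : J) (b : Bool),
      |∫ ω, coordPart X δ θ n g p ω * coordPart X δ θ n g ((j, l'), b) ω ∂P|
        ≤ ‖covSeq P X δ θ (g l) (g l') ((i : ℤ) - (j : ℕ))‖ +
          ‖pcovSeq r P X δ θ (g l) (g l') ((i : ℤ) - (j : ℕ))‖ := fun j l' b => by
    refine (abs_integral_re_im_mul_le (hm (g l) i) (hm (g l') j) p.2 b).trans (le_of_eq ?_)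
    rw [integral_coord_mul_conj hgauss hstat, integral_coord_mul hgauss hstat, norm_mul,
      show 2 * Complex.I * i * δ * θ = ((2 * i * δ * θ : ℝ) : ℂ) * Complex.I by
        push_cast; ring, Complex.norm_exp_ofReal_mul_I, one_mul]
  have hdiv : ∀ {γ : ℤ → ℂ} {M' τ' : ℝ}, HasMassBound γ δ L M' τ' →
      ∑ j : Finset.Icc 1 n, ‖γ ((i : ℤ) - (j : ℕ))‖ ≤ M' / δ := fun {γ M' τ'} hγ => by
    rw [Finset.sum_coe_sort (Finset.Icc 1 n) fun j => ‖γ ((i : ℤ) - j)‖]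
    refine sum_sub_le_of_bound (w := fun d => ‖γ d‖) (fun s => ?_) n (i : ℤ)
    rw [le_div_iff₀ hδ, mul_comm]
    exact hγ.mass s
  calc _ = ∑ l', ∑ j : Finset.Icc 1 n, ∑ b : Bool,
        |∫ ω, coordPart X δ θ n g p ω * coordPart X δ θ n g ((j, l'), b) ω ∂P| := by
        rw [Fintype.sum_prod_type, Fintype.sum_prod_type, Finset.sum_comm]
    _ ≤ ∑ l', ∑ j : Finset.Icc 1 n, 2 * (‖covSeq P X δ θ (g l) (g l') ((i : ℤ) - (j : ℕ))‖ +
          ‖pcovSeq r P X δ θ (g l) (g l') ((i : ℤ) - (j : ℕ))‖) := by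
        refine Finset.sum_le_sum fun l' _ => Finset.sum_le_sum fun j _ => ?_
        rw [Fintype.sum_bool, two_mul]
        exact add_le_add (h1 j l' true) (h1 j l' false)
    _ ≤ ∑ l', 2 * (‖g l‖ * ‖g l'‖ * M / δ + ‖g l‖ * ‖g l'‖ * M / δ) := by
        refine Finset.sum_le_sum fun l' _ => ?_
        rw [← Finset.mul_sum, Finset.sum_add_distrib]
        have := hdiv (hmass (g l) (g l')).1
        have := hdiv (hmass (g l) (g l')).2
        gcongr
    _ = 4 * (‖g l‖ * ∑ l', ‖g l'‖) * M / δ := by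
        simp only [Finset.mul_sum, Finset.sum_mul, Finset.sum_div]
        exact Finset.sum_congr rfl fun l' _ => by ring
    _ ≤ _ := by
        rw [pow_two]
        have : 0 ≤ ∑ l', ‖g l'‖ := Finset.sum_nonneg fun _ _ => norm_nonneg _
        gcongr
        exact hG l

theorem tendsto_charFun_quadFunctional (hgauss : IsGaussianProcess X P)
    (hmean : ∀ t, ∫ ω, X t ω ∂P = 0) (hstat : IsStationary r P X) (hK : KernelCondition K)
    (h : CLTCondition r e P X δ Δ δlim θ) (hθ : 0 < δlim → |θ| ≤ Real.pi / δlim)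
    (hedge : 0 < δlim → |θ| = Real.pi / δlim →
      Tendsto (fun n => Δ n * (δ n - δlim)) atTop (𝓝 0))
    {J : Type*} [Fintype J] (a : J → ℝ) (g : J → H) (t : ℝ) :
    Tendsto (fun n => charFun (P.map fun ω =>
      (quadFunctional a g (normalizedError P X K n (δ n) (Δ n) θ ω)).re) t) atTop
      (𝓝 (Complex.exp (-(t ^ 2 * limitVariance r P X K θ δlim a g / 2 : ℝ)))) := by
  obtain ⟨B, R, T, hW⟩ := hK.exists_isWindow
  obtain ⟨L, τ, M, hL, hLh, hτ, hτ0, hM0, hmass⟩ := h.exists_hasMassBound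
  choose b hb using fun n => re_quadFunctional_eq (K := K) hgauss hmean n (δ n) (Δ n) θ a g
  have hB := hW.bound_nonneg
  have hR := hW.radius_nonneg
  set G := ∑ l, ‖g l‖ with hG
  set S := ∑ l, |a l| with hS
  have haS : ∀ l, |a l| ≤ S := fun l =>
    Finset.single_le_sum (f := fun l => |a l|) (fun _ _ => abs_nonneg _) (Finset.mem_univ l)
  refine tendsto_charFun_quadraticForm (J := fun n => (Finset.Icc 1 n × J) × Bool)
    (Z := fun n => coordPart X (δ n) θ n g)
    (α := fun n => 4 * G ^ 2 * M / δ n)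
    (β := fun n => √(n * δ n / Δ n) * (δ n / (2 * Real.pi * n)) * S *
      (B * (2 * (R / (δ n / Δ n)) + 1)))
    (fun n => isCentredGaussianVector_coordPart hgauss hmean _ _ _ _)
    (fun n => isHermitian_formMatrix n (fun d => by rw [Int.cast_neg, neg_mul, hK.symm]) _)
    ?_ ?_ ?_ ?_ hb (fun n => integral_quadFunctional hgauss hmean _ _ _ _ _ _)
    (tendsto_integral_sq_quadFunctional hgauss hmean hstat hK h hθ hedge a g) t
  · filter_upwards [h.eventually_mesh_pos] with n hn
    positivity
  · filter_upwards [h.eventually_mesh_pos, hmass] with n hn hmn p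
    exact sum_abs_integral_coordPart_le hgauss hmean hstat hn hM0 hmn n g p
  · filter_upwards [h.eventually_mesh_pos, h.eventually_bandwidth_pos] with n hδ hΔ p
    have h1 := sum_formMatrix n (fun d => K (d * (δ n / Δ n)))
      (fun l => √(n * δ n / Δ n) * (δ n / (2 * Real.pi * n)) * a l) p (fun _ x => |x|)
      fun _ => abs_zero
    rw [h1]
    simp_rw [abs_mul (√(n * δ n / Δ n) * (δ n / (2 * Real.pi * n)) * a p.1.2),
      abs_mul (√(n * δ n / Δ n) * (δ n / (2 * Real.pi * n)))]
    rw [← Finset.mul_sum, abs_of_nonneg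
      (show 0 ≤ √(n * δ n / Δ n) * (δ n / (2 * Real.pi * n)) by positivity)]
    have h2 : ∑ j : Finset.Icc 1 n, |K (((p.1.1 : ℕ) - (j : ℕ) : ℤ) * (δ n / Δ n))|
        ≤ B * (2 * (R / (δ n / Δ n)) + 1) := by
      simp_rw [abs_of_nonneg (hK.nonneg _)]
      rw [Finset.sum_coe_sort (Finset.Icc 1 n) fun j =>
        K (((p.1.1 : ℕ) - j : ℤ) * (δ n / Δ n))]
      exact sum_sub_le_of_bound (w := fun d : ℤ => K (d * (δ n / Δ n)))
        (HasVariationBound.sum_le (div_pos hδ hΔ) hW.eq_zero hW.le hB hR) n _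
    have h3 := haS p.1.2
    have h4 : 0 ≤ S := (abs_nonneg _).trans h3
    gcongr
  -- With `h = δ/Δ`, the product of the row sums is a bounded factor times `δ⁻¹ · √(nh) (δ/n) · h⁻¹
  -- = (nh)^{-1/2}`, so `nδ/Δ → ∞` is exactly what is needed.
  · have h1 : Tendsto (fun n : ℕ => √(n * (δ n / Δ n))) atTop atTop :=
      Real.tendsto_sqrt_atTop.comp h.tendsto_mul_mesh_div_bandwidth
    have h2 := ((h.tendsto_mesh_div_bandwidth.const_add (2 * R)).const_mul
      (4 * G ^ 2 * M * S * B / (2 * Real.pi))).mul h1.inv_tendsto_atTop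
    rw [mul_zero] at h2
    refine h2.congr' ?_
    filter_upwards [h.eventually_mesh_pos, h.eventually_bandwidth_pos, eventually_ge_atTop 1]
      with n hδ hΔ hn
    have hn0 : (0 : ℝ) < n := by exact_mod_cast hn
    have h3 : √(n * (δ n / Δ n)) * √(n * (δ n / Δ n)) = n * (δ n / Δ n) :=
      Real.mul_self_sqrt (by positivity)
    have h4 : 0 < √(n * (δ n / Δ n)) := Real.sqrt_pos.2 (by positivity)
    have hπ := Real.pi_pos
    rw [mul_div_assoc (n : ℝ), Pi.inv_apply]
    generalize √(n * (δ n / Δ n)) = q at h3 h4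
    have h5 : q⁻¹ = q / (n * (δ n / Δ n)) := by
      rw [← h3]
      field_simp
    rw [h5]
    field_simp

end CLT

end SpectralCLT

namespace SpectralCLT

/-! ### Real functionals on the space of Hilbert–Schmidt operators -/

section Dual

variable {H : Type*} [NormedAddCommGroup H] [InnerProductSpace ℂ H] [CompleteSpace H]

/-- The real functional `T ↦ Re ⟪A, T⟫`. -/
noncomputable def reFunctional (A : HSOperator H) : StrongDual ℝ (HSOperator H) :=
  Complex.reCLM.comp ((innerSL ℂ A).restrictScalars ℝ)

theorem reFunctional_apply (A T : HSOperator H) : reFunctional A T = (inner ℂ A T).re := rfl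

/-- The operator that represents a quadratic functional. -/
noncomputable def quadRep {J : Type*} [Fintype J] (a : J → ℝ) (g : J → H) : HSOperator H :=
  ∑ l, (a l : ℂ) • HSOperator.outer (g l) (g l)

theorem inner_quadRep {J : Type*} [Fintype J] (a : J → ℝ) (g : J → H) (T : HSOperator H) :
    inner ℂ (quadRep a g) T = quadFunctional a g T := by
  simp [quadRep, quadFunctional, HSOperator.inner_outer]

/-- The operators `A` such that `Re ⟪A, ·⟫` agrees with a quadratic functional on the
self-adjoint operators. -/
def quadSet (H : Type*) [NormedAddCommGroup H] [InnerProductSpace ℂ H] [CompleteSpace H] :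
    Set (HSOperator H) :=
  {A | ∃ (J : Type) (_ : Fintype J) (a : J → ℝ) (g : J → H), ∀ T : HSOperator H,
    (∀ x y, (starRingEnd ℂ) (inner ℂ x (HSOperator.toCLM T y)) =
      inner ℂ y (HSOperator.toCLM T x)) → (inner ℂ A T).re = (quadFunctional a g T).re}

theorem add_mem_quadSet {A B : HSOperator H} (hA : A ∈ quadSet H) (hB : B ∈ quadSet H) :
    A + B ∈ quadSet H := by
  obtain ⟨J, _, a, g, h⟩ := hA
  obtain ⟨J', _, a', g', h'⟩ := hB
  refine ⟨J ⊕ J', inferInstance, Sum.elim a a', Sum.elim g g', fun T hT => ?_⟩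
  rw [inner_add_left, Complex.add_re, h T hT, h' T hT, ← Complex.add_re]
  simp [quadFunctional, Fintype.sum_sum_type]

/-- Polarization: `⟨T(x+y), x+y⟩ - ⟨T(x-y), x-y⟩` has real part `4 Re ⟨x, T y⟩` when `T` is
self-adjoint. The weight `-1/4` is why the weights are not required to be positive here. -/
theorem outer_mem_quadSet (x y : H) : HSOperator.outer x y ∈ quadSet H := by
  refine ⟨Bool, inferInstance, fun b => if b then 1 / 4 else -(1 / 4),
    fun b => if b then x + y else x - y, fun T hT => ?_⟩
  have h1 := congrArg Complex.re (hT x y)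
  rw [Complex.conj_re] at h1
  simp only [HSOperator.inner_outer, quadFunctional, Fintype.sum_bool, if_true,
    Bool.false_eq_true, if_false, map_add, map_sub, inner_add_left, inner_add_right,
    inner_sub_left, inner_sub_right, Complex.add_re, Complex.sub_re, Complex.re_ofReal_mul]
  rw [← h1]
  ring

/-- Weights are real, but a complex scalar can be moved into the first factor of an outer product.
Hence the whole complex span of the basis is contained in the set. -/
theorem dense_quadSet : Dense (quadSet H) := by
  have h1 : ∀ A ∈ Submodule.span ℂ (Set.range (HSOperator.outerBasis (auxBasis H))),
      ∀ c : ℂ, c • A ∈ quadSet H := fun A hA => by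
    induction hA using Submodule.span_induction with
    | mem A hA =>
      obtain ⟨p, rfl⟩ := hA
      intro c
      rw [HSOperator.outerBasis_apply, ← HSOperator.outer_smul_left]
      exact outer_mem_quadSet _ _
    | zero =>
      exact fun c => ⟨Empty, inferInstance, Empty.elim, Empty.elim, fun T _ => by
        simp [quadFunctional]⟩
    | add A B _ _ hA hB =>
      intro c
      rw [smul_add]
      exact add_mem_quadSet (hA c) (hB c)
    | smul d A _ hA =>
      intro c
      rw [smul_smul]
      exact hA _
  exact (Submodule.dense_iff_topologicalClosure_eq_top.2
    (HSOperator.outerBasis (auxBasis H)).dense_span).mono fun A hA => by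
      simpa using h1 A hA 1

theorem dense_image_reFunctional : Dense (reFunctional '' quadSet H) := by
  -- Riesz representation in the underlying real Hilbert space: `reFunctional` is a continuous
  -- surjection, so it carries dense sets to dense sets.
  let : InnerProductSpace ℝ (HSOperator H) := InnerProductSpace.complexToReal
  exact (InnerProductSpace.toDual ℝ (HSOperator H)).surjective.denseRange.dense_image
    (InnerProductSpace.toDual ℝ (HSOperator H)).continuous dense_quadSet

end Dual

/-! ### Mean and variance of the limit law. -/

section Gaussian

variable {E : Type*} [NormedAddCommGroup E] [NormedSpace ℝ E] [MeasurableSpace E] [BorelSpace E]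

theorem variance_eq_of_tendsto_charFunDual {P : ℕ → ProbabilityMeasure E} {μ : ProbabilityMeasure E}
    (h : Tendsto P atTop (𝓝 μ)) {L : StrongDual ℝ E} {v : ℝ≥0}
    (hv : (μ : Measure E).map L = gaussianReal 0 v) {q : ℝ}
    (hq : Tendsto (fun n => charFunDual (P n : Measure E) L) atTop
      (𝓝 (Complex.exp (-(q / 2 : ℝ))))) : (v : ℝ) = q := by
  have h1 := tendsto_nhds_unique (tendsto_charFunDual h L) hq
  rw [charFunDual_eq_charFun_map_one, hv, charFun_gaussianReal] at h1
  have h2 : (Complex.ofReal (Real.exp (-(v / 2)))) = Complex.ofReal (Real.exp (-(q / 2))) := by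
    push_cast at h1 ⊢
    rw [← h1]
    congr 1
    simp
  have h3 := Real.exp_injective (Complex.ofReal_injective h2)
  linarith

theorem integral_eq_zero_of_map_eq_gaussianReal [CompleteSpace E] {μ : Measure E}
    (hint : Integrable (fun x => x) μ)
    (h : ∀ L : StrongDual ℝ E, ∃ v : ℝ≥0, μ.map L = gaussianReal 0 v) : ∫ x, x ∂μ = 0 := by
  refine (SeparatingDual.eq_zero_iff_forall_dual_eq_zero (R := ℝ) _).2 fun L => ?_
  obtain ⟨v, hv⟩ := h L
  rw [← L.integral_comp_comm hint]
  have h1 := integral_map (μ := μ) L.continuous.measurable.aemeasurable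
    (f := fun x : ℝ => x) aestronglyMeasurable_id
  rw [← h1, hv, integral_id_gaussianReal]

end Gaussian

/-! ### Tightness and the limit law of the normalized error. -/

section CLT

variable {H : Type*} [NormedAddCommGroup H] [InnerProductSpace ℂ H] [CompleteSpace H]
  [TopologicalSpace.SeparableSpace H] [MeasurableSpace H] [BorelSpace H]
  {Ω : Type*} [MeasurableSpace Ω] {P : Measure Ω} [IsProbabilityMeasure P] {X : ℝ → Ω → H}
  {κ ι : Type*} {r : HilbertBasis κ ℂ H} {e : HilbertBasis ι ℂ H} {δ Δ : ℕ → ℝ} {δlim θ : ℝ}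
  {K : ℝ → ℝ}

/-- The distribution of `𝒯_n`. -/
noncomputable def errorLaw (hgauss : IsGaussianProcess X P) (K : ℝ → ℝ) (n : ℕ) (δ Δ θ : ℝ) :
    ProbabilityMeasure (HSOperator H) :=
  ⟨P.map (normalizedError P X K n δ Δ θ),
    Measure.isProbabilityMeasure_map (aemeasurable_normalizedError hgauss K n δ Δ θ)⟩

theorem charFunDual_errorLaw (hgauss : IsGaussianProcess X P) (n : ℕ) (δ Δ θ : ℝ)
    (L : StrongDual ℝ (HSOperator H)) (t : ℝ) :
    charFunDual (errorLaw hgauss K n δ Δ θ : Measure (HSOperator H)) (t • L)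
      = charFun (P.map fun ω => L (normalizedError P X K n δ Δ θ ω)) t := by
  rw [← charFun_map_eq_charFunDual_smul]
  congr 1
  exact AEMeasurable.map_map_of_aemeasurable L.continuous.measurable.aemeasurable
    (aemeasurable_normalizedError hgauss K n δ Δ θ)

theorem isTightMeasureSet_errorLaw (hgauss : IsGaussianProcess X P) {s : ι × ι → ℝ≥0∞}
    (hs : ∑' p, s p ≠ ∞) (h : ∀ n p, ∫⁻ ω, ‖inner ℂ (HSOperator.outerBasis e p)
      (normalizedError P X K n (δ n) (Δ n) θ ω)‖ₑ ^ 2 ∂P ≤ s p) :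
    IsTightMeasureSet
      {(errorLaw hgauss K n (δ n) (Δ n) θ : Measure (HSOperator H)) | n : ℕ} := by
  have := countable_of_orthonormal e.orthonormal
  refine isTightMeasureSet_of_coordinates (HSOperator.outerBasis e) hs ?_
  rintro _ ⟨n, rfl⟩ p
  refine le_trans (le_of_eq ?_) (h n p)
  exact lintegral_map' ((continuous_const.inner continuous_id).enorm.measurable.pow_const
    2).aemeasurable (aemeasurable_normalizedError hgauss K n (δ n) (Δ n) θ)

/-- Supplies the bound `q L ≤ C ‖L‖²` on the limit variances required by `exists_gaussian_limit`,
from the same summable family as tightness. -/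
theorem integral_sq_le (hgauss : IsGaussianProcess X P) {s : ι × ι → ℝ≥0∞}
    (hs : ∑' p, s p ≠ ∞) (h : ∀ n p, ∫⁻ ω, ‖inner ℂ (HSOperator.outerBasis e p)
      (normalizedError P X K n (δ n) (Δ n) θ ω)‖ₑ ^ 2 ∂P ≤ s p) (n : ℕ)
    (L : StrongDual ℝ (HSOperator H)) :
    ∫ ω, L (normalizedError P X K n (δ n) (Δ n) θ ω) ^ 2 ∂P ≤ (∑' p, s p).toReal * ‖L‖ ^ 2 := by
  have := countable_of_orthonormal e.orthonormal
  have hm := aemeasurable_normalizedError hgauss K n (δ n) (Δ n) θ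
  have h1 : ∫⁻ ω, ‖normalizedError P X K n (δ n) (Δ n) θ ω‖ₑ ^ 2 ∂P ≤ ∑' p, s p := by
    simp_rw [← tsum_enorm_inner_sq (HSOperator.outerBasis e)]
    refine (lintegral_tsum fun p => ?_).trans_le (ENNReal.tsum_le_tsum (h n))
    exact (Continuous.measurable (f := fun T : HSOperator H =>
      ‖inner ℂ (HSOperator.outerBasis e p) T‖ₑ) (by fun_prop)).comp_aemeasurable hm |>.pow_const 2
  have hL : AEMeasurable (fun ω => L (normalizedError P X K n (δ n) (Δ n) θ ω)) P :=
    L.continuous.measurable.comp_aemeasurable hm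
  rw [integral_eq_lintegral_of_nonneg_ae (ae_of_all _ fun _ => sq_nonneg _)
    (hL.pow_const 2).aestronglyMeasurable]
  have h2 : ∫⁻ ω, ENNReal.ofReal (L (normalizedError P X K n (δ n) (Δ n) θ ω) ^ 2) ∂P
      ≤ (∑' p, s p) * ‖L‖ₑ ^ 2 := by
    calc _ ≤ ∫⁻ ω, ‖normalizedError P X K n (δ n) (Δ n) θ ω‖ₑ ^ 2 * ‖L‖ₑ ^ 2 ∂P := by
          refine lintegral_mono fun ω => ?_
          dsimp only
          rw [← sq_abs, ENNReal.ofReal_pow (abs_nonneg _), ← Real.norm_eq_abs, ofReal_norm,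
            ← mul_pow, mul_comm]
          gcongr
          exact L.le_opENorm _
      _ = (∫⁻ ω, ‖normalizedError P X K n (δ n) (Δ n) θ ω‖ₑ ^ 2 ∂P) * ‖L‖ₑ ^ 2 :=
          lintegral_mul_const' _ _ (by simp)
      _ ≤ _ := by gcongr
  refine (ENNReal.toReal_mono (ENNReal.mul_ne_top hs (by simp)) h2).trans (le_of_eq ?_)
  rw [ENNReal.toReal_mul, ENNReal.toReal_pow, toReal_enorm]

/-- The last clause asks for agreement of `Re ⟪A, ·⟫` with a quadratic functional on self-adjoint
operators only. Hence one `A` may be matched with a functional that differs from it elsewhere, in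
particular with the zero functional. -/
theorem exists_limit_law (hgauss : IsGaussianProcess X P)
    (hmean : ∀ t, ∫ ω, X t ω ∂P = 0) (hstat : IsStationary r P X) (hK : KernelCondition K)
    (h : CLTCondition r e P X δ Δ δlim θ) (hθ : 0 < δlim → |θ| ≤ Real.pi / δlim)
    (hedge : 0 < δlim → |θ| = Real.pi / δlim →
      Tendsto (fun n => Δ n * (δ n - δlim)) atTop (𝓝 0)) :
    ∃ μ : ProbabilityMeasure (HSOperator H),
      Tendsto (fun n => errorLaw hgauss K n (δ n) (Δ n) θ) atTop (𝓝 μ) ∧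
      (∀ L : StrongDual ℝ (HSOperator H),
        ∃ v : ℝ≥0, (μ : Measure (HSOperator H)).map L = gaussianReal 0 v) ∧
      ∀ (J : Type) [Fintype J] (a : J → ℝ) (g : J → H) (A : HSOperator H),
        (∀ T : HSOperator H, (∀ x y, (starRingEnd ℂ) (inner ℂ x (HSOperator.toCLM T y)) =
          inner ℂ y (HSOperator.toCLM T x)) → (inner ℂ A T).re = (quadFunctional a g T).re) →
        ∃ v : ℝ≥0, (μ : Measure (HSOperator H)).map (reFunctional A) = gaussianReal 0 v ∧
          v = limitVariance r P X K θ δlim a g := by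
  obtain ⟨s, hs, hbound⟩ := exists_coordinate_bound hgauss hmean hstat hK h
  have key : ∀ {J : Type} [Fintype J] {a : J → ℝ} {g : J → H} {A : HSOperator H},
      (∀ T : HSOperator H, (∀ x y, (starRingEnd ℂ) (inner ℂ x (HSOperator.toCLM T y)) =
        inner ℂ y (HSOperator.toCLM T x)) → (inner ℂ A T).re = (quadFunctional a g T).re) →
      Tendsto (fun n => ∫ ω, reFunctional A (normalizedError P X K n (δ n) (Δ n) θ ω) ^ 2 ∂P)
        atTop (𝓝 (limitVariance r P X K θ δlim a g)) ∧
      ∀ t : ℝ, Tendsto (fun n => charFunDual (errorLaw hgauss K n (δ n) (Δ n) θ :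
        Measure (HSOperator H)) (t • reFunctional A)) atTop
        (𝓝 (Complex.exp (-(t ^ 2 * limitVariance r P X K θ δlim a g / 2 : ℝ)))) :=
    fun {J _ a g A} hA => by
      have h1 : ∀ n ω, reFunctional A (normalizedError P X K n (δ n) (Δ n) θ ω)
          = (quadFunctional a g (normalizedError P X K n (δ n) (Δ n) θ ω)).re := fun n ω =>
        hA _ fun x y => conj_inner_normalizedError hgauss hmean hK.symm n _ _ _ x y ω
      simp_rw [charFunDual_errorLaw, h1]
      exact ⟨tendsto_integral_sq_quadFunctional hgauss hmean hstat hK h hθ hedge a g,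
        tendsto_charFun_quadFunctional hgauss hmean hstat hK h hθ hedge a g⟩
  have hlim : ∀ L ∈ reFunctional '' quadSet H, ∃ q : ℝ,
      (0 ≤ q ∧ q ≤ (∑' p, s p).toReal * ‖L‖ ^ 2) ∧
      ∀ t : ℝ, Tendsto (fun n => charFunDual (errorLaw hgauss K n (δ n) (Δ n) θ :
        Measure (HSOperator H)) (t • L)) atTop
        (𝓝 (Complex.exp (-(t ^ 2 * q / 2 : ℝ)))) := by
    rintro _ ⟨A, ⟨J, _, a, g, hA⟩, rfl⟩
    obtain ⟨h1, h2⟩ := key hA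
    exact ⟨_, ⟨ge_of_tendsto' h1 fun n => integral_nonneg fun ω => sq_nonneg _,
      le_of_tendsto' h1 fun n => integral_sq_le hgauss hs hbound n _⟩, h2⟩
  choose! q hq hq' using hlim
  obtain ⟨μ, hμ, hμL⟩ := exists_gaussian_limit
    (isTightMeasureSet_errorLaw hgauss hs hbound) dense_image_reFunctional hq hq'
  refine ⟨μ, hμ, hμL, fun J _ a g A hA => ?_⟩
  obtain ⟨v, hv⟩ := hμL (reFunctional A)
  have h1 := (key hA).2 1
  rw [one_smul, one_pow, one_mul] at h1
  exact ⟨v, hv, variance_eq_of_tendsto_charFunDual hμ hv h1⟩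

end CLT

end SpectralCLT

/-! ### The central limit theorem. -/

theorem mainTheorem1
    {H : Type*} [NormedAddCommGroup H] [InnerProductSpace ℂ H] [CompleteSpace H]
    [TopologicalSpace.SeparableSpace H] [MeasurableSpace H] [BorelSpace H]
    {Ω : Type*} [MeasurableSpace Ω] (P : Measure Ω) [IsProbabilityMeasure P]
    {κ ι : Type*} (r : HilbertBasis κ ℂ H) (e : HilbertBasis ι ℂ H)
    (X : ℝ → Ω → H) (hgauss : IsGaussianProcess X P) (hmean : ∀ t, ∫ ω, X t ω ∂P = 0)
    (hstat : SpectralCLT.IsStationary r P X)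
    (K : ℝ → ℝ) (hK : SpectralCLT.KernelCondition K)
    (δ Δ : ℕ → ℝ) (δlim θ : ℝ)
    (hCLT : SpectralCLT.CLTCondition r e P X δ Δ δlim θ)
    (hθ : 0 < δlim → |θ| ≤ Real.pi / δlim)
    (hedge : 0 < δlim → |θ| = Real.pi / δlim →
      Tendsto (fun n => Δ n * (δ n - δlim)) atTop (𝓝 0)) :
    ∃ (μ : Measure (SpectralCLT.HSOperator H)) (_ : IsGaussian μ),
      ∫ T, T ∂μ = 0 ∧
      (∀ (m : ℕ) (g : Fin m → H) (a : Fin m → ℝ), (∀ l, 0 < a l) →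
        (∀ᵐ T ∂μ, (∑ l, (a l : ℂ) *
          inner ℂ (g l) (SpectralCLT.HSOperator.toCLM T (g l))).im = 0) ∧
        Var[fun T => (∑ l, (a l : ℂ) *
          inner ℂ (g l) (SpectralCLT.HSOperator.toCLM T (g l))).re; μ] =
          (∫ x, K x ^ 2) * ∑ l₁, ∑ l₂, a l₁ * a l₂ *
            (‖inner ℂ (g l₁) (SpectralCLT.specDensity P X θ δlim (g l₂))‖ ^ 2 +
              SpectralCLT.cInd θ δlim *
                ‖inner ℂ (g l₁) (SpectralCLT.pseudoSpecDensity r P X θ δlim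
                  (SpectralCLT.conjH r (g l₂)))‖ ^ 2)) ∧
      TendstoInDistribution
        (fun n => SpectralCLT.normalizedError P X K n (δ n) (Δ n) θ) atTop id (fun _ => P) μ := by
  obtain ⟨μ, hμ, hμL, hμq⟩ := SpectralCLT.exists_limit_law hgauss hmean hstat hK hCLT hθ hedge
  have hG : IsGaussian (μ : Measure (SpectralCLT.HSOperator H)) :=
    isGaussian_of_map_eq_gaussianReal fun L => ⟨0, hμL L⟩
  refine ⟨μ, hG, SpectralCLT.integral_eq_zero_of_map_eq_gaussianReal
    IsGaussian.integrable_id hμL, fun m g a _ => ⟨?_, ?_⟩, ?_⟩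
  -- The real functional of `i · quadRep a g` is the imaginary part of the quadratic functional,
  -- which vanishes on self-adjoint operators. It is thus represented by the empty sum, its limit
  -- variance is zero, and its law under `μ` is the Dirac mass at `0`.
  · obtain ⟨v, h1, hv⟩ := hμq Empty Empty.elim Empty.elim (Complex.I • SpectralCLT.quadRep a g)
      fun T hT => by
        have h2 : (SpectralCLT.quadFunctional a g T).im = 0 := by
          rw [← Complex.conj_eq_iff_im, SpectralCLT.quadFunctional, map_sum]
          refine Finset.sum_congr rfl fun l _ => ?_
          rw [map_mul, Complex.conj_ofReal, hT]
        rw [inner_smul_left, SpectralCLT.inner_quadRep]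
        simp [SpectralCLT.quadFunctional] at h2 ⊢
        exact h2
    have h3 : SpectralCLT.limitVariance r P X K θ δlim (Empty.elim : Empty → ℝ)
        (Empty.elim : Empty → H) = 0 := by simp [SpectralCLT.limitVariance]
    rw [h3, NNReal.coe_eq_zero] at hv
    rw [hv, gaussianReal_zero_var] at h1
    have h4 : ∀ᵐ x ∂(μ : Measure (SpectralCLT.HSOperator H)).map
        (SpectralCLT.reFunctional (Complex.I • SpectralCLT.quadRep a g)), x = 0 := by
      rw [h1]
      exact (ae_dirac_iff (measurableSet_singleton 0)).2 rfl
    filter_upwards [ae_of_ae_map (ContinuousLinearMap.measurable _).aemeasurable h4] with T hT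
    rw [SpectralCLT.reFunctional_apply, inner_smul_left, SpectralCLT.inner_quadRep] at hT
    simpa [SpectralCLT.quadFunctional] using hT
  · obtain ⟨v, h1, hv⟩ := hμq (Fin m) a g (SpectralCLT.quadRep a g)
      fun T _ => by rw [SpectralCLT.inner_quadRep]
    have h2 := variance_map (μ := (μ : Measure (SpectralCLT.HSOperator H))) (X := id)
      aemeasurable_id
      (SpectralCLT.reFunctional (SpectralCLT.quadRep a g)).measurable.aemeasurable
    rw [h1, variance_id_gaussianReal, Function.id_comp, show ⇑(SpectralCLT.reFunctional (SpectralCLT.quadRep a g)) =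
      fun T => (SpectralCLT.quadFunctional a g T).re from funext fun T => by
        rw [SpectralCLT.reFunctional_apply, SpectralCLT.inner_quadRep]] at h2
    exact h2.symm.trans hv
  · refine ⟨fun n => SpectralCLT.aemeasurable_normalizedError hgauss K n _ _ _,
      aemeasurable_id, ?_⟩
    have h1 : (⟨(μ : Measure (SpectralCLT.HSOperator H)).map id,
        Measure.isProbabilityMeasure_map aemeasurable_id⟩ :
        ProbabilityMeasure (SpectralCLT.HSOperator H)) = μ := Subtype.ext Measure.map_id
    rw [h1]
    exact hμ
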